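/- Let $d\in\mathbb N$ and let $\mathscr R$ be the family of open sets $A\subsetneq\mathbb R^d$ that are increasing ($x\in A$, $y\in[0,\infty)^d$ imply $x+y\in A$), have convex complement, and satisfy $0\notin\overline A$. On a probability space consider: * claims $X^{(1)},X^{(2)},\dots$: random vectors that are a.s. in $[0,\infty)^d$, identically distributed with law $F$; write $X$ for a vector with law $F$ and $Y_A^{(i)}=\sup\{u: X^{(i)}\in uA\}$; * arrival times $T_1\le T_2\le\dots$ of a renewal process $N(t)=\#\{i:T_i\le t\}$ (partial sums of i.i.d. nonnegative inter-arrival times that are not a.s. zero), with renewal function $\lambda(t)=\sum_{i\ge1}P[T_i\le t]$, $t\in[0,\infty]$, and $\Lambda=\{t\in[0,\infty]:\lambda(t)>0\}$; * a càdlàg real process $(\xi(t))_{t\ge0}$ with $\xi(0)=0$. The claim sequence, the arrival times and $\xi$ are mutually independent. Put $D(t)=\sum_{i=1}^{N(t)}X^{(i)}e^{-\xi(T_i)}$ for $t\in[0,\infty]$. Let $A\in\mathscr R$. Assume $F\in MRV(\alpha,V,\mu)$ with $0<\alpha<\infty$: $V$ is a distribution on $\mathbb R$ with $\overline V(tx)/\overline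 V(x)\to t^{-\alpha}$ for all $t>0$, and $\mu\ne0$ is a measure on $[0,\infty)^d\setminus\{0\}$, finite away from the origin, such that $P[X\in xB]/\overline V(x)\to\mu(B)$ as $x\to\infty$ for every Borel set $B$ with $0\notin\overline B$ and $\mu(\partial B)=0$. Assume $\mu(A)>0$. Assume that the claims are tail asymptotically independent on $A$: for all $i\ne j$, $P[Y_A^{(i)}>x_i\mid Y_A^{(j)}>x_j]\to0$ as $x_i\wedge x_j\to\infty$. Assume finally that there are $0<k_1<\alpha<k_2<\infty$ such that * if $\alpha>1$: $\sum_{i\ge1}\big(E[e^{-k_1\xi(T_i)}]^{1/k_1}\vee E[e^{-k_2\xi(T_i)}]^{1/k_2}\big)<\infty$; * if $\alpha=1$: $\sum_{i\ge1}\big(E[e^{-k_1\xi(T_i)}]\vee E[e^{-k_2\xi(T_i)}]\big)^{1/k_2}<\infty$; * if $\alpha<1$: $k_2<1$ and $\sum_{i\ge1}\big(E[e^{-k_1\xi(T_i)}]\vee E[e^{-k_2\xi(T_i)}]\big)<\infty$. Then the series $D(\infty)$ converges a.s., and $$P[D(t)\in xA]\;\sim\;P[X\in xA]\int_0^tE\big[e^{-\alpha\xi(s)}\big]\,\lambda(ds)\qquad(x\to\infty)\tag{1}$$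 holds uniformly for $t\in[t_0,\infty]$ for every $t_0\in\Lambda$ (hence uniformly on all of $\Lambda$ if $\Lambda$ contains its infimum). If moreover, for some $k>\alpha$ and some $t_1\in\Lambda$, $\sup\{E[e^{-k\xi(s)}]: s\in\Lambda,\ s<\infty,\ s\le t_1\}<\infty$ (for instance, if $\xi$ is a.s. bounded below by a constant on $[0,t_1]$ for some finite $t_1\in\Lambda$), then (1) holds uniformly for $t\in\Lambda$, including $t=\infty$. Here "uniformly for $t\in\Delta$" means that the supremum over $t\in\Delta$ of the absolute value of the ratio of the two sides minus $1$ tends to $0$. -/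

import Mathlib

open Set Filter Topology MeasureTheory ProbabilityTheory
open scoped NNReal ENNReal Pointwise

noncomputable section

/-- The family `𝓡` of rare sets: proper open increasing subsets of `ℝᵈ` whose complement is convex
and whose closure does not contain the origin. -/
structure IsRareSet {d : ℕ} (A : Set (Fin d → ℝ)) : Prop where
  ne_univ : A ≠ Set.univ
  isOpen : IsOpen A
  increasing : ∀ x ∈ A, ∀ y : Fin d → ℝ, 0 ≤ y → x + y ∈ A
  convex_compl : Convex ℝ Aᶜ
  zero_notMem_closure : (0 : Fin d → ℝ) ∉ closure A

/-- `Y_A = sup {u : x ∈ u A}` as a function of the vector `x`. -/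
def rareLevel {d : ℕ} (A : Set (Fin d → ℝ)) (x : Fin d → ℝ) : ℝ :=
  sSup {u : ℝ | x ∈ u • A}

/-- The distribution `V` on the real line has a regularly varying tail with index `-α`. -/
def IsRegVar (V : Measure ℝ) (α : ℝ) : Prop :=
  ∀ t : ℝ, 0 < t →
    Tendsto (fun x : ℝ => V.real (Ioi (t * x)) / V.real (Ioi x)) atTop (𝓝 (t ^ (-α)))

/-- `F ∈ MRV(α, V, ν)`: standard multivariate regular variation on the positive orthant. The limit
measure `ν` lives on the orthant without the origin, is finite away from the origin, is not zero,
and `P[X ∈ x B] / P[V > x] → ν B` for every Borel `ν`-continuity set `B` bounded away from the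
origin (vague convergence). -/
structure IsMRV {d : ℕ} (F : Measure (Fin d → ℝ)) (α : ℝ) (V : Measure ℝ)
    (ν : Measure (Fin d → ℝ)) : Prop where
  index_pos : 0 < α
  isProbabilityMeasure : IsProbabilityMeasure V
  regVar : IsRegVar V α
  orthant : ν {x | 0 ≤ x ∧ x ≠ 0}ᶜ = 0
  finite_away : ∀ ε : ℝ, 0 < ε → ν {x | ε ≤ ‖x‖} < ∞
  ne_zero : ν ≠ 0
  tendsto : ∀ B : Set (Fin d → ℝ), MeasurableSet B → (0 : Fin d → ℝ) ∉ closure B →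
    ν (frontier B) = 0 →
    Tendsto (fun x : ℝ => F (x • B) / V (Ioi x)) atTop (𝓝 (ν B))

section Model

variable {Ω : Type*} [MeasurableSpace Ω]

/-- Tail asymptotic independence on `A`: for `i ≠ j`,
`P[Y_A⁽ⁱ⁾ > x_i | Y_A⁽ʲ⁾ > x_j] → 0` as `min x_i x_j → ∞`. -/
def IsTAI {d : ℕ} (P : Measure Ω) (A : Set (Fin d → ℝ)) (X : ℕ → Ω → Fin d → ℝ) : Prop :=
  ∀ i j : ℕ, i ≠ j →
    Tendsto (fun p : ℝ × ℝ =>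
        ProbabilityTheory.cond P {ω | p.2 < rareLevel A (X j ω)} {ω | p.1 < rareLevel A (X i ω)})
      (atTop ×ˢ atTop) (𝓝 0)

/-- `T` is the sequence of arrival times of a renewal process: `T i` is the sum of the first `i + 1`
terms of an i.i.d. sequence of nonnegative inter-arrival times that are not a.s. zero. -/
def IsRenewalTimes (P : Measure Ω) (T : ℕ → Ω → ℝ≥0) : Prop :=
  ∃ τ : ℕ → Ω → ℝ≥0,
    (∀ i, Measurable (τ i)) ∧ iIndepFun τ P ∧ (∀ i, IdentDistrib (τ i) (τ 0) P P) ∧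
    ¬ (∀ᵐ ω ∂P, τ 0 ω = 0) ∧
    ∀ i ω, T i ω = ∑ j ∈ Finset.range (i + 1), τ j ω

/-- A real process, started at zero, whose paths are right-continuous with left limits. -/
structure IsCadlagProcess (ξ : ℝ≥0 → Ω → ℝ) : Prop where
  measurable : ∀ t, Measurable (ξ t)
  init : ∀ ω, ξ 0 ω = 0
  right_continuous : ∀ ω t, ContinuousWithinAt (fun s => ξ s ω) (Ici t) t
  left_limits : ∀ ω t, ∃ l : ℝ, Tendsto (fun s => ξ s ω) (𝓝[<] t) (𝓝 l)

/-- Mutual independence of the claims, the arrival times and the return process. -/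
def IndepIngredients {d : ℕ} (P : Measure Ω) (X : ℕ → Ω → Fin d → ℝ) (T : ℕ → Ω → ℝ≥0)
    (ξ : ℝ≥0 → Ω → ℝ) : Prop :=
  iIndep ![MeasurableSpace.comap (fun ω i => X i ω) inferInstance,
    MeasurableSpace.comap (fun ω i => T i ω) inferInstance,
    MeasurableSpace.comap (fun ω t => ξ t ω) inferInstance] P

/-- The renewal function `λ(t) = E[N(t)] = ∑ᵢ P[Tᵢ ≤ t]`, for `t ∈ [0, ∞]`. -/
def renewalFunction (P : Measure Ω) (T : ℕ → Ω → ℝ≥0) (t : ℝ≥0∞) : ℝ≥0∞ :=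
  ∑' i, P {ω | (T i ω : ℝ≥0∞) ≤ t}

/-- The renewal measure `λ(ds)`, whose distribution function is the renewal function. -/
def renewalMeasure (P : Measure Ω) (T : ℕ → Ω → ℝ≥0) : Measure ℝ≥0 :=
  Measure.sum fun i => P.map (T i)

/-- The set `Λ = {t ∈ [0, ∞] : λ(t) > 0}`. -/
def renewalSupport (P : Measure Ω) (T : ℕ → Ω → ℝ≥0) : Set ℝ≥0∞ :=
  {t | 0 < renewalFunction P T t}

/-- The moment `E[e^{-k ξ(S)}] ∈ [0, ∞]` at a random time `S`. -/
def discountMoment (P : Measure Ω) (ξ : ℝ≥0 → Ω → ℝ) (k : ℝ) (S : Ω → ℝ≥0) : ℝ≥0∞ :=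
  ∫⁻ ω, ENNReal.ofReal (Real.exp (-k * ξ (S ω) ω)) ∂P

/-- The moment summability conditions on the discount factors at the arrival times. -/
def MomentSummability (P : Measure Ω) (T : ℕ → Ω → ℝ≥0) (ξ : ℝ≥0 → Ω → ℝ) (α : ℝ) : Prop :=
  (1 < α → ∃ k₁ k₂ : ℝ, 0 < k₁ ∧ k₁ < α ∧ α < k₂ ∧
    ∑' i, max (discountMoment P ξ k₁ (T i) ^ (1 / k₁))
      (discountMoment P ξ k₂ (T i) ^ (1 / k₂)) < ∞) ∧
  (α = 1 → ∃ k₁ k₂ : ℝ, 0 < k₁ ∧ k₁ < α ∧ α < k₂ ∧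
    ∑' i, max (discountMoment P ξ k₁ (T i) ^ (1 / k₂))
      (discountMoment P ξ k₂ (T i) ^ (1 / k₂)) < ∞) ∧
  (α < 1 → ∃ k₁ k₂ : ℝ, 0 < k₁ ∧ k₁ < α ∧ α < k₂ ∧ k₂ < 1 ∧
    ∑' i, max (discountMoment P ξ k₁ (T i)) (discountMoment P ξ k₂ (T i)) < ∞)

/-- Some moment of the discount factor of order larger than `α` is bounded on an initial piece
`{s ∈ Λ : s ≤ t₁}` of `Λ`, with `t₁ ∈ Λ`. -/
def InitialMomentBound (P : Measure Ω) (T : ℕ → Ω → ℝ≥0) (ξ : ℝ≥0 → Ω → ℝ) (α : ℝ) : Prop :=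
  ∃ k : ℝ, α < k ∧ ∃ t₁ ∈ renewalSupport P T, ∃ C : ℝ≥0,
    ∀ s : ℝ≥0, (s : ℝ≥0∞) ∈ renewalSupport P T → (s : ℝ≥0∞) ≤ t₁ →
      discountMoment P ξ k (fun _ => s) ≤ C

/-- The discounted aggregate claims `D(t) = ∑_{i ≤ N(t)} X⁽ⁱ⁾ e^{-ξ(Tᵢ)}`, for `t ∈ [0, ∞]`; the
`i`-th claim is counted by `N(t)` exactly when `Tᵢ ≤ t`. -/
def discountedClaims {d : ℕ} (X : ℕ → Ω → Fin d → ℝ) (T : ℕ → Ω → ℝ≥0) (ξ : ℝ≥0 → Ω → ℝ)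
    (t : ℝ≥0∞) (ω : Ω) : Fin d → ℝ :=
  ∑' i, {j : ℕ | (T j ω : ℝ≥0∞) ≤ t}.indicator
    (fun j => Real.exp (-ξ (T j ω) ω) • X j ω) i

/-- The integral `∫_0^t E[e^{-α ξ(s)}] λ(ds)`, for `t ∈ [0, ∞]`. -/
def discountIntegral (P : Measure Ω) (T : ℕ → Ω → ℝ≥0) (ξ : ℝ≥0 → Ω → ℝ) (α : ℝ)
    (t : ℝ≥0∞) : ℝ≥0∞ :=
  ∫⁻ s in {s : ℝ≥0 | (s : ℝ≥0∞) ≤ t}, discountMoment P ξ α (fun _ => s) ∂(renewalMeasure P T)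

end Model

/-- `f(x; t) ∼ g(x; t)` as `x → ∞`, uniformly for `t ∈ Δ`: `sup_{t ∈ Δ} |f / g - 1| → 0`. -/
def UniformlyEquivalent (f g : ℝ → ℝ≥0∞ → ℝ) (Δ : Set ℝ≥0∞) : Prop :=
  TendstoUniformlyOn (fun x t => f x t / g x t) (fun _ => 1) atTop Δ

end

/-!
For `x > 0` a vector `v` lies in `x A` exactly when its gauge `φ v` with respect to the convex set
`Aᶜ` exceeds `x`. As `φ` is subadditive and `A` is increasing, with `θᵢ = e^{-ξ(Tᵢ)}`, `Yᵢ = φ(Xᵢ)`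
and `Sᵢ = {Tᵢ ≤ t}`, the event `{D(t) ∈ x A}` lies between `⋃ᵢ Sᵢ ∩ {θᵢ Yᵢ > x}` and
`{∑ᵢ θᵢ Yᵢ 1_{Sᵢ} > x}`. Multivariate regular variation makes the tail `G` of the `Yᵢ` regularly
varying with index `-α`, so everything reduces to one dimension: both bounds have to be compared
with `G(x) ∑ᵢ E[θᵢ^α; Sᵢ]`, uniformly in the events `Sᵢ`, which are independent of the claims.

Conditioning on the discount factors, Potter's bounds and the moments of orders `k₁ < α < k₂` settle
the single terms. Asymptotic independence makes it unlikely that two terms are large, which leaves a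
single big jump, and the summability of the moments makes the contribution of all but finitely many
terms negligible with respect to `G`. The resulting error is small with respect to `G(x)`. This is
enough when `t ≥ t₀ ∈ Λ`, for then the main term is bounded below.

If `t` decreases to `inf Λ ∉ Λ`, the main term vanishes like `P[T₀ ≤ t]`: right-continuity of `ξ`
and Fatou's lemma bound it below by `c G(x) P[T₀ ≤ t]`. By the moment bound on an initial piece of
`Λ`, the `i`-th term exceeds `x / 2^(i+1)` with probability at most `C^(i+1) G(x) P[T₀ ≤ t]^(i+1)`
for a constant `C`, so the first term dominates once `P[T₀ ≤ t]` is small.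
-/

/-- `G` behaves like the tail `x ↦ P[Y > x]` of a probability distribution that is regularly varying
with index `-α`. -/
structure IsRegVarTail (G : ℝ → ℝ) (α : ℝ) : Prop where
  index_pos : 0 < α
  antitone : Antitone G
  nonneg : ∀ x, 0 ≤ G x
  le_one : ∀ x, G x ≤ 1
  tendsto : ∀ t : ℝ, 0 < t → Tendsto (fun x => G (t * x) / G x) atTop (𝓝 (t ^ (-α)))

theorem tendstoLocallyUniformlyOn_of_monotoneOn {ι E : Type*} [LinearOrder E] [TopologicalSpace E]
    [OrderTopology E] {l : Filter ι} {F : ι → E → ℝ} {f : E → ℝ} {s : Set E} (hs : IsOpen s)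
    (hmono : ∀ᶠ i in l, MonotoneOn (F i) s) (hf : ContinuousOn f s)
    (hlim : ∀ u ∈ s, Tendsto (fun i => F i u) l (𝓝 (f u))) :
    TendstoLocallyUniformlyOn F f l s := by
  rw [Metric.tendstoLocallyUniformlyOn_iff]
  intro ε hε u hu
  have hnhds : s ∩ f ⁻¹' Metric.ball (f u) (ε / 4) ∈ 𝓝 u :=
    inter_mem (hs.mem_nhds hu)
      ((hf.continuousAt (hs.mem_nhds hu)) (Metric.ball_mem_nhds _ (by positivity)))
  obtain ⟨a, b, hu', habu, hab⟩ := exists_Icc_mem_subset_of_mem_nhds hnhds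
  refine ⟨Icc a b, mem_nhdsWithin_of_mem_nhds habu, ?_⟩
  have ha : a ∈ Icc a b := left_mem_Icc.2 (hu'.1.trans hu'.2)
  have hb : b ∈ Icc a b := right_mem_Icc.2 (hu'.1.trans hu'.2)
  have close : ∀ v ∈ s, ∀ᶠ i in l, dist (F i v) (f v) < ε / 4 := fun v hv =>
    (hlim v hv).eventually (Metric.ball_mem_nhds _ (by positivity))
  filter_upwards [hmono, close a (hab ha).1, close b (hab hb).1] with i hi hia hib v hv
  have hav : F i a ≤ F i v := hi (hab ha).1 (hab hv).1 hv.1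
  have hvb : F i v ≤ F i b := hi (hab hv).1 (hab hb).1 hv.2
  have hfa : dist (f a) (f u) < ε / 4 := (hab ha).2
  have hfb : dist (f b) (f u) < ε / 4 := (hab hb).2
  have hfv : dist (f v) (f u) < ε / 4 := (hab hv).2
  simp only [Real.dist_eq, abs_lt] at hia hib hfa hfb hfv ⊢
  constructor <;> linarith

namespace IsRegVarTail

variable {G : ℝ → ℝ} {α k k₁ k₂ : ℝ}

theorem pos (h : IsRegVarTail G α) (x : ℝ) : 0 < G x := by
  have hlim : Tendsto (fun y => G y / G y) atTop (𝓝 1) := by simpa using h.tendsto 1 one_pos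
  obtain ⟨y, hxy, hy⟩ :=
    ((eventually_ge_atTop x).and (hlim.eventually_ne one_ne_zero)).exists
  have hGy : 0 < G y := (h.nonneg y).lt_of_ne' fun h0 => hy (by simp [h0])
  exact hGy.trans_le (h.antitone hxy)

theorem tendsto_div (h : IsRegVarTail G α) {s : ℝ} (hs : 0 < s) :
    Tendsto (fun x => G (x / s) / G x) atTop (𝓝 (s ^ α)) := by
  simpa only [Real.inv_rpow hs.le, Real.rpow_neg hs.le, inv_inv, div_eq_inv_mul _ s]
    using h.tendsto s⁻¹ (by positivity)

theorem eventually_le_two_rpow_mul (h : IsRegVarTail G α) (hk : α < k) :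
    ∀ᶠ z in atTop, G z ≤ 2 ^ k * G (2 * z) := by
  have hlt : (2 : ℝ) ^ (-k) < 2 ^ (-α) :=
    Real.rpow_lt_rpow_of_exponent_lt one_lt_two (neg_lt_neg hk)
  filter_upwards [(h.tendsto 2 two_pos).eventually (lt_mem_nhds hlt)] with z hz
  rw [lt_div_iff₀ (h.pos z), Real.rpow_neg two_pos.le, inv_mul_lt_iff₀ (by positivity)] at hz
  exact hz.le

theorem eventually_two_mul_le (h : IsRegVarTail G α) (hk : k < α) :
    ∀ᶠ z in atTop, G (2 * z) ≤ 2 ^ (-k) * G z := by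
  have hlt : (2 : ℝ) ^ (-α) < 2 ^ (-k) :=
    Real.rpow_lt_rpow_of_exponent_lt one_lt_two (neg_lt_neg hk)
  filter_upwards [(h.tendsto 2 two_pos).eventually (gt_mem_nhds hlt)] with z hz
  exact ((div_lt_iff₀ (h.pos z)).1 hz).le

theorem le_two_pow_rpow_mul {x₀ : ℝ} (hx₀ : 0 < x₀)
    (hdouble : ∀ z, x₀ ≤ z → G z ≤ 2 ^ k * G (2 * z)) {z : ℝ} (hz : x₀ ≤ z) (n : ℕ) :
    G z ≤ (2 ^ n) ^ k * G (2 ^ n * z) := by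
  induction n with
  | zero => simp
  | succ n ih =>
    have hz' : x₀ ≤ 2 ^ n * z :=
      hz.trans (le_mul_of_one_le_left (hx₀.le.trans hz) (one_le_pow₀ one_le_two))
    calc G z ≤ (2 ^ n) ^ k * G (2 ^ n * z) := ih
      _ ≤ (2 ^ n) ^ k * (2 ^ k * G (2 * (2 ^ n * z))) := by gcongr; exact hdouble _ hz'
      _ = (2 ^ (n + 1)) ^ k * G (2 ^ (n + 1) * z) := by
        rw [pow_succ', Real.mul_rpow two_pos.le (by positivity), mul_assoc 2]; ring

theorem two_pow_mul_le {x₀ : ℝ} (hx₀ : 0 < x₀)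
    (hdouble : ∀ z, x₀ ≤ z → G (2 * z) ≤ 2 ^ (-k) * G z) {z : ℝ} (hz : x₀ ≤ z) (n : ℕ) :
    G (2 ^ n * z) ≤ (2 ^ n) ^ (-k) * G z := by
  induction n with
  | zero => simp
  | succ n ih =>
    have hz' : x₀ ≤ 2 ^ n * z :=
      hz.trans (le_mul_of_one_le_left (hx₀.le.trans hz) (one_le_pow₀ one_le_two))
    calc G (2 ^ (n + 1) * z) = G (2 * (2 ^ n * z)) := by rw [pow_succ', mul_assoc]
      _ ≤ 2 ^ (-k) * G (2 ^ n * z) := hdouble _ hz'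
      _ ≤ 2 ^ (-k) * ((2 ^ n) ^ (-k) * G z) := by gcongr
      _ = (2 ^ (n + 1)) ^ (-k) * G z := by
        rw [pow_succ', Real.mul_rpow two_pos.le (by positivity), mul_assoc]

theorem exists_le_rpow_mul (h : IsRegVarTail G α) (hk : α < k) :
    ∃ x₀ > 0, ∀ z ≥ x₀, ∀ s ≥ 1, G z ≤ 2 ^ k * s ^ k * G (s * z) := by
  obtain ⟨x₀, hx₀, hdouble⟩ :=
    ((eventually_gt_atTop (0 : ℝ)).and
      (eventually_forall_ge_atTop.2 (h.eventually_le_two_rpow_mul hk))).exists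
  have hk0 : 0 < k := h.index_pos.trans hk
  refine ⟨x₀, hx₀, fun z hz s hs => ?_⟩
  have hz0 : 0 < z := hx₀.trans_le hz
  obtain ⟨n, hn, hsn⟩ := exists_nat_pow_near hs one_lt_two
  calc G z ≤ (2 ^ (n + 1)) ^ k * G (2 ^ (n + 1) * z) := le_two_pow_rpow_mul hx₀ hdouble hz _
    _ ≤ (2 * s) ^ k * G (s * z) := by
      gcongr
      · exact h.nonneg _
      · rw [pow_succ']; gcongr
      · exact h.antitone (by gcongr)
    _ = 2 ^ k * s ^ k * G (s * z) := by rw [Real.mul_rpow two_pos.le (by positivity)]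

theorem potter_upper (h : IsRegVarTail G α) (hk : α < k) :
    ∃ C > 0, ∀ᶠ z in atTop, ∀ s ≥ 1, G (z / s) ≤ C * s ^ k * G z := by
  obtain ⟨x₀, hx₀, hle⟩ := h.exists_le_rpow_mul hk
  have hk0 : 0 < k := h.index_pos.trans hk
  have hG₀ : 0 < G x₀ := h.pos x₀
  refine ⟨2 ^ k / G x₀, by positivity, ?_⟩
  filter_upwards [eventually_ge_atTop x₀] with z hz s hs
  have hs0 : 0 < s := by positivity
  have hGz : 0 < G z := h.pos z
  rcases le_or_gt x₀ (z / s) with hzs | hzs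
  · calc G (z / s) ≤ 2 ^ k * s ^ k * G z := by
          simpa only [mul_div_cancel₀ _ hs0.ne'] using hle (z / s) hzs s hs
      _ ≤ 2 ^ k / G x₀ * s ^ k * G z := by
          gcongr; exact le_div_self (by positivity) hG₀ (h.le_one _)
  · have hG : G x₀ ≤ 2 ^ k * s ^ k * G z := by
      calc G x₀ ≤ 2 ^ k * (z / x₀) ^ k * G z := by
            simpa only [div_mul_cancel₀ _ hx₀.ne'] using hle x₀ le_rfl _ ((one_le_div hx₀).2 hz)
        _ ≤ 2 ^ k * s ^ k * G z := by
            gcongr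
            · exact div_nonneg (hx₀.le.trans hz) hx₀.le
            · exact (div_lt_comm₀ hs0 hx₀).1 hzs |>.le
    calc G (z / s) ≤ 1 := h.le_one _
      _ ≤ 2 ^ k * s ^ k * G z / G x₀ := (one_le_div hG₀).2 hG
      _ = 2 ^ k / G x₀ * s ^ k * G z := by ring

theorem potter_lower (h : IsRegVarTail G α) (hk0 : 0 < k) (hk : k < α) :
    ∃ C > 0, ∀ᶠ z in atTop, ∀ s ≥ 1, G (s * z) ≤ C * s ^ (-k) * G z := by
  obtain ⟨x₀, hx₀, hdouble⟩ :=
    ((eventually_gt_atTop (0 : ℝ)).and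
      (eventually_forall_ge_atTop.2 (h.eventually_two_mul_le hk))).exists
  refine ⟨2 ^ k, by positivity, ?_⟩
  filter_upwards [eventually_ge_atTop x₀] with z hz s hs
  have hz0 : 0 < z := hx₀.trans_le hz
  obtain ⟨n, hn, hsn⟩ := exists_nat_pow_near hs one_lt_two
  calc G (s * z) ≤ G (2 ^ n * z) := h.antitone (by gcongr)
    _ ≤ (2 ^ n) ^ (-k) * G z := two_pow_mul_le hx₀ hdouble hz n
    _ ≤ (s / 2) ^ (-k) * G z := by
      refine mul_le_mul_of_nonneg_right ?_ (h.nonneg z)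
      refine Real.rpow_le_rpow_of_nonpos (by positivity) ?_ (by linarith)
      rw [pow_succ] at hsn
      linarith
    _ = 2 ^ k * s ^ (-k) * G z := by
      rw [Real.div_rpow (by positivity) two_pos.le, Real.rpow_neg two_pos.le, div_inv_eq_mul,
        mul_comm (s ^ (-k))]

theorem potter (h : IsRegVarTail G α) (hk₁ : 0 < k₁) (hk₁α : k₁ < α) (hαk₂ : α < k₂) :
    ∃ C > 0, ∀ᶠ x in atTop, ∀ s > 0, G (x / s) ≤ C * (s ^ k₁ + s ^ k₂) * G x := by
  obtain ⟨C₁, hC₁, hlower⟩ := h.potter_lower hk₁ hk₁α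
  obtain ⟨C₂, -, hupper⟩ := h.potter_upper hαk₂
  refine ⟨max C₁ C₂, by positivity, ?_⟩
  filter_upwards [hlower, hupper] with x hlower hupper s hs
  have hGx : 0 ≤ G x := h.nonneg x
  rcases le_total 1 s with hs1 | hs1
  · calc G (x / s) ≤ C₂ * s ^ k₂ * G x := hupper s hs1
      _ ≤ max C₁ C₂ * (s ^ k₁ + s ^ k₂) * G x := by
        gcongr
        · exact le_max_right _ _
        · exact le_add_of_nonneg_left (by positivity)
  · calc G (x / s) = G (s⁻¹ * x) := by rw [div_eq_inv_mul]
      _ ≤ C₁ * s⁻¹ ^ (-k₁) * G x := hlower s⁻¹ ((one_le_inv₀ hs).2 hs1)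
      _ = C₁ * s ^ k₁ * G x := by rw [Real.inv_rpow hs.le, Real.rpow_neg hs.le, inv_inv]
      _ ≤ max C₁ C₂ * (s ^ k₁ + s ^ k₂) * G x := by
        gcongr
        · exact le_max_left _ _
        · exact le_add_of_nonneg_right (by positivity)

theorem tendstoUniformlyOn_Icc (h : IsRegVarTail G α) {a : ℝ} (ha : 0 < a) (b : ℝ) :
    TendstoUniformlyOn (fun x s => G (x / s) / G x) (fun s => s ^ α) atTop (Icc a b) := by
  have hsub : Icc a b ⊆ Ioi 0 := fun s hs => ha.trans_le hs.1
  refine (tendstoLocallyUniformlyOn_iff_tendstoUniformlyOn_of_compact isCompact_Icc).1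
    (TendstoLocallyUniformlyOn.mono ?_ hsub)
  refine tendstoLocallyUniformlyOn_of_monotoneOn isOpen_Ioi ?_
    (fun s hs => (Real.continuousAt_rpow_const _ _ (Or.inl hs.ne')).continuousWithinAt)
    fun s hs => h.tendsto_div hs
  filter_upwards [eventually_gt_atTop 0] with x hx s hs t _ hst
  exact div_le_div_of_nonneg_right
    (h.antitone (div_le_div_of_nonneg_left hx.le hs hst)) (h.nonneg x)

theorem eventually_abs_sub_le_of_mem_Icc (h : IsRegVarTail G α) {a : ℝ} (ha : 0 < a) (b : ℝ)
    {ε : ℝ} (hε : 0 < ε) :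
    ∀ᶠ x in atTop, ∀ s ∈ Icc a b, |G (x / s) - s ^ α * G x| ≤ ε * G x := by
  filter_upwards [Metric.tendstoUniformlyOn_iff.1 (h.tendstoUniformlyOn_Icc ha b) ε hε]
    with x hx s hs
  have hG : 0 < G x := h.pos x
  calc |G (x / s) - s ^ α * G x| = |G (x / s) / G x - s ^ α| * G x := by
        rw [← abs_of_pos hG, ← abs_mul, abs_of_pos hG, sub_mul, div_mul_cancel₀ _ hG.ne']
    _ ≤ ε * G x := by
        gcongr
        rw [abs_sub_comm]
        exact (hx s hs).le

theorem exists_abs_sub_le_of_rpow_le (h : IsRegVarTail G α) (hk₁ : 0 < k₁) (hk₁α : k₁ < α)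
    (hαk₂ : α < k₂) :
    ∃ C > 0, ∀ᶠ x in atTop, ∀ s > 0, ∀ w, s ^ k₁ ≤ w → s ^ α ≤ w → s ^ k₂ ≤ w →
      |G (x / s) - s ^ α * G x| ≤ C * w * G x := by
  obtain ⟨C, hC, hpotter⟩ := h.potter hk₁ hk₁α hαk₂
  refine ⟨2 * C + 1, by positivity, ?_⟩
  filter_upwards [hpotter] with x hpotter s hs w hw₁ hw hw₂
  have hGx : 0 ≤ G x := h.nonneg x
  calc |G (x / s) - s ^ α * G x| ≤ G (x / s) + s ^ α * G x := by
        refine (abs_sub _ _).trans_eq ?_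
        rw [abs_of_nonneg (h.nonneg _), abs_of_nonneg (by positivity)]
    _ ≤ C * (s ^ k₁ + s ^ k₂) * G x + s ^ α * G x := by gcongr; exact hpotter s hs
    _ ≤ C * (w + w) * G x + w * G x := by gcongr
    _ = (2 * C + 1) * w * G x := by ring

/-- On a compact interval the convergence is uniform; outside it, Potter's bounds with exponents
strictly inside `(k₁, k₂)` make both terms small relative to `s ^ k₁ + s ^ k₂`. -/
theorem eventually_abs_sub_le (h : IsRegVarTail G α) (hk₁ : 0 < k₁) (hk₁α : k₁ < α)
    (hαk₂ : α < k₂) {η : ℝ} (hη : 0 < η) :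
    ∀ᶠ x in atTop, ∀ s > 0, |G (x / s) - s ^ α * G x| ≤ η * (s ^ k₁ + s ^ k₂) * G x := by
  obtain ⟨l₁, hk₁l₁, hl₁α⟩ := exists_between hk₁α
  obtain ⟨l₂, hαl₂, hl₂k₂⟩ := exists_between hαk₂
  obtain ⟨C, -, hcrude⟩ := h.exists_abs_sub_le_of_rpow_le (hk₁.trans hk₁l₁) hl₁α hαl₂
  have hlim {p : ℝ} (hp : p < 0) : ∀ᶠ s : ℝ in atTop, C * s ^ p < η := by
    have := (tendsto_rpow_neg_atTop (neg_pos.2 hp)).const_mul C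
    rw [neg_neg, mul_zero] at this
    exact this.eventually (gt_mem_nhds hη)
  obtain ⟨B, hB1, hB⟩ := ((eventually_ge_atTop (1 : ℝ)).and (eventually_forall_ge_atTop.2
    ((hlim (sub_neg.2 hk₁l₁)).and (hlim (sub_neg.2 hl₂k₂))))).exists
  have hB0 : 0 < B := by positivity
  filter_upwards [hcrude, h.eventually_abs_sub_le_of_mem_Icc (inv_pos.2 hB0) B
    (show 0 < η * B⁻¹ ^ k₁ by positivity)] with x hcrude hcompact s hs
  have hG : 0 ≤ G x := h.nonneg x
  rcases lt_or_ge s B⁻¹ with hsB | hBs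
  · have hs1 : s ≤ 1 := hsB.le.trans (inv_le_one_of_one_le₀ hB1)
    calc |G (x / s) - s ^ α * G x| ≤ C * s ^ l₁ * G x := hcrude s hs _ le_rfl
          (Real.rpow_le_rpow_of_exponent_ge hs hs1 hl₁α.le)
          (Real.rpow_le_rpow_of_exponent_ge hs hs1 (hl₁α.trans hαl₂).le)
      _ = C * s⁻¹ ^ (k₁ - l₁) * s ^ k₁ * G x := by
          rw [Real.inv_rpow hs.le, ← Real.rpow_neg hs.le, mul_assoc C (_ ^ _) (s ^ k₁),
            ← Real.rpow_add hs]
          ring_nf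
      _ ≤ η * (s ^ k₁ + s ^ k₂) * G x := by
          gcongr
          · exact (hB s⁻¹ ((lt_inv_comm₀ hs hB0).1 hsB).le).1.le
          · exact le_add_of_nonneg_right (by positivity)
  rcases le_or_gt s B with hsB | hBs'
  · calc |G (x / s) - s ^ α * G x| ≤ η * B⁻¹ ^ k₁ * G x := hcompact s ⟨hBs, hsB⟩
      _ ≤ η * (s ^ k₁ + s ^ k₂) * G x := by
          gcongr
          exact (Real.rpow_le_rpow (by positivity) hBs hk₁.le).trans
            (le_add_of_nonneg_right (by positivity))
  · have hs1 : 1 ≤ s := hB1.trans hBs'.le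
    calc |G (x / s) - s ^ α * G x| ≤ C * s ^ l₂ * G x := hcrude s hs _
          (Real.rpow_le_rpow_of_exponent_le hs1 (hl₁α.trans hαl₂).le)
          (Real.rpow_le_rpow_of_exponent_le hs1 hαl₂.le) le_rfl
      _ = C * s ^ (l₂ - k₂) * s ^ k₂ * G x := by
          rw [mul_assoc C (_ ^ _) (s ^ k₂), ← Real.rpow_add hs, sub_add_cancel]
      _ ≤ η * (s ^ k₁ + s ^ k₂) * G x := by
          gcongr
          · exact (hB s hBs'.le).2.le
          · exact le_add_of_nonneg_left (by positivity)

end IsRegVarTail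

section TailSums

variable {Ω : Type*} [MeasurableSpace Ω] {P : Measure Ω} {G : ℝ → ℝ} {α k l x : ℝ}

theorem tsum_rpow_le_rpow_tsum {ι : Type*} (a : ι → ℝ≥0∞) (hk : 1 ≤ k) :
    ∑' i, a i ^ k ≤ (∑' i, a i) ^ k := by
  have hsplit (b : ℝ≥0∞) : b ^ k = b * b ^ (k - 1) := by
    conv_rhs => rw [← ENNReal.rpow_one b, ENNReal.rpow_one b]
    nth_rewrite 2 [← ENNReal.rpow_one b]
    rw [← ENNReal.rpow_add_of_nonneg _ _ zero_le_one (by linarith), add_sub_cancel]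
  calc ∑' i, a i ^ k = ∑' i, a i * a i ^ (k - 1) := by simp only [hsplit]
    _ ≤ ∑' i, a i * (∑' j, a j) ^ (k - 1) := by
      gcongr with i
      exact ENNReal.le_tsum i
    _ = (∑' i, a i) ^ k := by rw [ENNReal.tsum_mul_right, ← hsplit]

theorem lintegral_sum_rpow_le {ι : Type*} {f : ι → Ω → ℝ≥0∞} (hf : ∀ i, Measurable (f i))
    (hk : 1 ≤ k) (s : Finset ι) :
    (∫⁻ ω, (∑ i ∈ s, f i ω) ^ k ∂P) ^ (1 / k) ≤ ∑ i ∈ s, (∫⁻ ω, f i ω ^ k ∂P) ^ (1 / k) := by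
  classical
  have hk0 : 0 < k := one_pos.trans_le hk
  induction s using Finset.induction_on with
  | empty => simp [hk0]
  | insert j s hj ih =>
    simp only [Finset.sum_insert hj]
    exact (ENNReal.lintegral_Lp_add_le (hf j).aemeasurable
      (Finset.measurable_sum s fun i _ => hf i).aemeasurable hk).trans (by gcongr)

theorem lintegral_tsum_rpow_le {f : ℕ → Ω → ℝ≥0∞} (hf : ∀ i, Measurable (f i)) (hk : 1 ≤ k) :
    ∫⁻ ω, (∑' i, f i ω) ^ k ∂P ≤ (∑' i, (∫⁻ ω, f i ω ^ k ∂P) ^ (1 / k)) ^ k := by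
  have hk0 : 0 < k := one_pos.trans_le hk
  have hmono : Monotone fun n ω => (∑ i ∈ Finset.range n, f i ω) ^ k := fun a b hab ω => by
    dsimp only
    gcongr
  have hsup (ω : Ω) : (∑' i, f i ω) ^ k = ⨆ n, (∑ i ∈ Finset.range n, f i ω) ^ k :=
    tendsto_nhds_unique ((ENNReal.continuous_rpow_const.tendsto _).comp
      (ENNReal.tendsto_nat_tsum fun i => f i ω)) (tendsto_atTop_iSup fun a b hab => hmono hab ω)
  simp only [hsup]
  rw [lintegral_iSup (fun n => (Finset.measurable_sum _ fun i _ => hf i).pow_const k) hmono]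
  refine iSup_le fun n => ?_
  calc ∫⁻ ω, (∑ i ∈ Finset.range n, f i ω) ^ k ∂P
      = ((∫⁻ ω, (∑ i ∈ Finset.range n, f i ω) ^ k ∂P) ^ (1 / k)) ^ k := by
        rw [one_div, ENNReal.rpow_inv_rpow hk0.ne']
    _ ≤ (∑' i, (∫⁻ ω, f i ω ^ k ∂P) ^ (1 / k)) ^ k := by
        gcongr
        exact (lintegral_sum_rpow_le hf hk _).trans (ENNReal.sum_le_tsum _)

theorem lintegral_ofReal_sub_eq {U : Ω → ℝ} (hU : Measurable U) (x : ℝ) :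
    ∫⁻ ω, ENNReal.ofReal (U ω - x) ∂P = ∫⁻ y in Ioi x, P {ω | y < U ω} := by
  calc ∫⁻ ω, ENNReal.ofReal (U ω - x) ∂P
      = ∫⁻ ω, ENNReal.ofReal (max (U ω - x) 0) ∂P := by
        simp only [ENNReal.ofReal_max, ENNReal.ofReal_zero, max_eq_left zero_le]
    _ = ∫⁻ t in Ioi 0, P {ω | t < max (U ω - x) 0} :=
        lintegral_eq_lintegral_meas_lt P (ae_of_all _ fun ω => le_max_right _ _)
          ((hU.sub_const x).max measurable_const).aemeasurable
    _ = ∫⁻ t in Ioi 0, P {ω | x + t < U ω} := by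
        refine setLIntegral_congr_fun measurableSet_Ioi fun t (ht : 0 < t) => ?_
        simp [lt_sub_iff_add_lt', ht.not_gt]
    _ = ∫⁻ y in Ioi x, P {ω | y < U ω} := by
        simpa using (measurePreserving_add_left volume x).setLIntegral_comp_preimage_emb
          (measurableEmbedding_addLeft x) (fun y => P {ω | y < U ω}) (Ioi x)

theorem IsRegVarTail.lintegral_Ioi_le (h : IsRegVarTail G α) (hα : 1 < α) :
    ∃ C > 0, ∀ᶠ x in atTop,
      ∫⁻ y in Ioi x, ENNReal.ofReal (G y) ≤ ENNReal.ofReal (C * x * G x) := by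
  obtain ⟨k, hk1, hkα⟩ := exists_between hα
  obtain ⟨C, hC, hpotter⟩ := h.potter_lower (one_pos.trans hk1) hkα
  have hk0 : 0 < k - 1 := sub_pos.2 hk1
  refine ⟨C / (k - 1), by positivity, ?_⟩
  filter_upwards [hpotter, eventually_gt_atTop 0] with x hpotter hx
  have hint : IntegrableOn (fun y : ℝ => y ^ (-k)) (Ioi x) :=
    integrableOn_Ioi_rpow_of_lt (by linarith) hx
  have hGx : 0 ≤ G x := h.nonneg x
  calc ∫⁻ y in Ioi x, ENNReal.ofReal (G y)
      ≤ ∫⁻ y in Ioi x, ENNReal.ofReal (C * x ^ k * G x * y ^ (-k)) := by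
        refine setLIntegral_mono' measurableSet_Ioi fun y hy => ENNReal.ofReal_le_ofReal ?_
        have hy0 : 0 < y := hx.trans hy
        calc G y = G (y / x * x) := by rw [div_mul_cancel₀ _ hx.ne']
          _ ≤ C * (y / x) ^ (-k) * G x := hpotter _ ((one_le_div hx).2 (le_of_lt hy))
          _ = C * x ^ k * G x * y ^ (-k) := by
            rw [Real.div_rpow hy0.le hx.le, Real.rpow_neg hx.le, div_inv_eq_mul]
            ring
    _ = ENNReal.ofReal (C * x ^ k * G x * ∫ y in Ioi x, y ^ (-k)) := by
        rw [← integral_const_mul, ← ofReal_integral_eq_lintegral_ofReal (hint.const_mul _)]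
        filter_upwards [ae_restrict_mem measurableSet_Ioi] with y hy
        have hy0 : 0 < y := hx.trans hy
        positivity
    _ = ENNReal.ofReal (C / (k - 1) * x * G x) := by
        rw [integral_Ioi_rpow_of_lt (by linarith) hx, Real.rpow_add hx, Real.rpow_neg hx.le,
          Real.rpow_one, show -k + 1 = -(k - 1) by ring]
        congr 1
        field_simp

/-- Markov's inequality for the convex combination of the excesses of the `U i` over `x`. -/
theorem measure_lt_tsum_mul_le {U : ℕ → Ω → ℝ} (hU : ∀ i, Measurable (U i)) {w : ℕ → ℝ≥0∞}
    {V b : ℝ≥0∞} (hw : ∑' i, w i ≤ V) (hV0 : V ≠ 0) (hV : V ≠ ⊤) (hx : 0 < x)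
    (hexcess : ∀ i, ∫⁻ ω, ENNReal.ofReal (U i ω - x) ∂P ≤ ENNReal.ofReal x * b) :
    P {ω | 2 * V * ENNReal.ofReal x < ∑' i, w i * ENNReal.ofReal (U i ω)} ≤ b := by
  have hxV0 : V * ENNReal.ofReal x ≠ 0 := mul_ne_zero hV0 (by simpa using hx)
  have hxV : V * ENNReal.ofReal x ≠ ⊤ := ENNReal.mul_ne_top hV ENNReal.ofReal_ne_top
  have hmeas (i : ℕ) : Measurable fun ω => ENNReal.ofReal (U i ω - x) :=
    ((hU i).sub_const x).ennreal_ofReal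
  have hsub (ω : Ω) : ∑' i, w i * ENNReal.ofReal (U i ω) ≤
      ∑' i, w i * ENNReal.ofReal (U i ω - x) + V * ENNReal.ofReal x := by
    calc ∑' i, w i * ENNReal.ofReal (U i ω)
        ≤ ∑' i, w i * (ENNReal.ofReal (U i ω - x) + ENNReal.ofReal x) := by
          gcongr with i
          exact (ENNReal.ofReal_le_ofReal (sub_add_cancel _ _).ge).trans ENNReal.ofReal_add_le
      _ = ∑' i, w i * ENNReal.ofReal (U i ω - x) + (∑' i, w i) * ENNReal.ofReal x := by
          simp only [mul_add, ENNReal.tsum_add, ENNReal.tsum_mul_right]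
      _ ≤ ∑' i, w i * ENNReal.ofReal (U i ω - x) + V * ENNReal.ofReal x := by gcongr
  refine (ENNReal.mul_le_mul_iff_right hxV0 hxV).1 ?_
  calc V * ENNReal.ofReal x * P {ω | 2 * V * ENNReal.ofReal x < ∑' i, w i * ENNReal.ofReal (U i ω)}
      ≤ V * ENNReal.ofReal x *
          P {ω | V * ENNReal.ofReal x ≤ ∑' i, w i * ENNReal.ofReal (U i ω - x)} := by
        gcongr with ω
        intro hω
        refine (ENNReal.add_le_add_iff_right hxV).1 (le_of_lt ?_)
        rw [← two_mul, ← mul_assoc]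
        exact hω.trans_le (hsub ω)
    _ ≤ ∫⁻ ω, ∑' i, w i * ENNReal.ofReal (U i ω - x) ∂P :=
        mul_meas_ge_le_lintegral (Measurable.tsum fun i => (hmeas i).const_mul _) _
    _ = ∑' i, w i * ∫⁻ ω, ENNReal.ofReal (U i ω - x) ∂P := by
        rw [lintegral_tsum fun i => ((hmeas i).const_mul _).aemeasurable]
        simp only [lintegral_const_mul _ (hmeas _)]
    _ ≤ ∑' i, w i * (ENNReal.ofReal x * b) := by gcongr with i; exact hexcess i
    _ ≤ V * ENNReal.ofReal x * b := by rw [ENNReal.tsum_mul_right, mul_assoc]; gcongr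

/-- The tails `∑ i ≥ m, Z i` of a series become negligible with respect to `G` as `m` grows: given
`ε`, some tail of the series exceeds a high level `x` with probability at most `ε * G x`. -/
def HasNegligibleTails (P : Measure Ω) (G : ℝ → ℝ) (Z : ℕ → Ω → ℝ≥0∞) : Prop :=
  ∀ ε : ℝ≥0∞, ε ≠ 0 → ∃ m : ℕ, ∀ᶠ x in atTop,
    P {ω | ENNReal.ofReal x < ∑' i, Z (i + m) ω} ≤ ε * ENNReal.ofReal (G x)

theorem exists_pos_mul_rpow_lt (hk : 0 < k) {K ε : ℝ≥0∞} (hK : K ≠ ⊤) (hε : ε ≠ 0) :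
    ∃ δ : ℝ, 0 < δ ∧ K * ENNReal.ofReal (δ ^ k) < ε := by
  have hlim : Tendsto (fun δ : ℝ => K * ENNReal.ofReal (δ ^ k)) (𝓝 0)
      (𝓝 (K * ENNReal.ofReal (0 ^ k))) :=
    ENNReal.Tendsto.const_mul (ENNReal.tendsto_ofReal
      (Real.continuousAt_rpow_const 0 k (Or.inr hk.le))) (Or.inr hK)
  rw [Real.zero_rpow hk.ne', ENNReal.ofReal_zero, mul_zero] at hlim
  obtain ⟨δ, hδ, hδ0⟩ := (((hlim.mono_left nhdsWithin_le_nhds).eventually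
    (gt_mem_nhds (pos_iff_ne_zero.2 hε))).and (self_mem_nhdsWithin (s := Ioi 0))).exists
  exact ⟨δ, hδ0, hδ⟩

theorem exists_tsum_nat_add_le {w : ℕ → ℝ≥0∞} (hw : ∑' i, w i ≠ ⊤) {ε : ℝ≥0∞} (hε : ε ≠ 0) :
    ∃ m : ℕ, ∑' i, w (i + m) ≤ ε :=
  ((ENNReal.tendsto_sum_nat_add w hw).eventually (ge_mem_nhds (pos_iff_ne_zero.2 hε))).exists

theorem hasNegligibleTails_of_one_lt (h : IsRegVarTail G α) (hα : 1 < α) {U : ℕ → Ω → ℝ}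
    (hU : ∀ i, Measurable (U i)) {w : ℕ → ℝ≥0∞} (hw : ∑' i, w i ≠ ⊤) {K : ℝ≥0∞} (hK : K ≠ ⊤)
    (htail : ∀ᶠ y in atTop, ∀ i, P {ω | y < U i ω} ≤ K * ENNReal.ofReal (G y)) :
    HasNegligibleTails P G fun i ω => w i * ENNReal.ofReal (U i ω) := by
  intro ε hε
  obtain ⟨C, hC, hkaramata⟩ := h.lintegral_Ioi_le hα
  have hKC : K * ENNReal.ofReal C ≠ ⊤ := ENNReal.mul_ne_top hK ENNReal.ofReal_ne_top
  obtain ⟨δ, hδ, hδε⟩ := exists_pos_mul_rpow_lt (one_pos.trans hα) hKC hε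
  obtain ⟨m, hm⟩ := exists_tsum_nat_add_le hw (ENNReal.ofReal_pos.2 (half_pos hδ)).ne'
  have hscale : ∀ᶠ y in atTop, K * ENNReal.ofReal C * ENNReal.ofReal (G (y / δ) / G y) < ε :=
    (ENNReal.Tendsto.const_mul (ENNReal.tendsto_ofReal (h.tendsto_div hδ)) (Or.inr hKC)).eventually
      (gt_mem_nhds hδε)
  have hdiv : Tendsto (fun y : ℝ => y / δ) atTop atTop := tendsto_id.atTop_div_const hδ
  refine ⟨m, ?_⟩
  filter_upwards [hscale, hdiv.eventually hkaramata, hdiv.eventually (eventually_gt_atTop 0),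
    hdiv.eventually (eventually_forall_ge_atTop.2 htail)] with y hscale hkaramata hy htail
  have hexcess (i : ℕ) : ∫⁻ ω, ENNReal.ofReal (U (i + m) ω - y / δ) ∂P ≤
      ENNReal.ofReal (y / δ) * (K * ENNReal.ofReal C * ENNReal.ofReal (G (y / δ))) := by
    calc ∫⁻ ω, ENNReal.ofReal (U (i + m) ω - y / δ) ∂P
        = ∫⁻ z in Ioi (y / δ), P {ω | z < U (i + m) ω} := lintegral_ofReal_sub_eq (hU _) _
      _ ≤ ∫⁻ z in Ioi (y / δ), K * ENNReal.ofReal (G z) :=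
          setLIntegral_mono' measurableSet_Ioi fun z hz => htail z (le_of_lt hz) _
      _ = K * ∫⁻ z in Ioi (y / δ), ENNReal.ofReal (G z) := lintegral_const_mul' _ _ hK
      _ ≤ K * ENNReal.ofReal (C * (y / δ) * G (y / δ)) := by gcongr
      _ = ENNReal.ofReal (y / δ) * (K * ENNReal.ofReal C * ENNReal.ofReal (G (y / δ))) := by
          rw [ENNReal.ofReal_mul (by positivity), ENNReal.ofReal_mul hC.le]
          ring
  have hlevel : 2 * ENNReal.ofReal (δ / 2) * ENNReal.ofReal (y / δ) = ENNReal.ofReal y := by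
    rw [← ENNReal.ofReal_ofNat, ← ENNReal.ofReal_mul (by positivity),
      ← ENNReal.ofReal_mul (by positivity)]
    congr 1
    field_simp
  calc P {ω | ENNReal.ofReal y < ∑' i, w (i + m) * ENNReal.ofReal (U (i + m) ω)}
      ≤ K * ENNReal.ofReal C * ENNReal.ofReal (G (y / δ)) := by
        rw [← hlevel]
        exact measure_lt_tsum_mul_le (fun i => hU _) hm (by simpa using hδ) ENNReal.ofReal_ne_top
          hy hexcess
    _ = K * ENNReal.ofReal C * ENNReal.ofReal (G (y / δ) / G y) * ENNReal.ofReal (G y) := by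
        rw [mul_assoc _ (ENNReal.ofReal (_ / _)),
          ← ENNReal.ofReal_mul (div_nonneg (h.nonneg _) (h.nonneg _)),
          div_mul_cancel₀ _ (h.pos y).ne']
    _ ≤ ε * ENNReal.ofReal (G y) := by gcongr

theorem setLIntegral_Ioo_rpow (hk : 0 < k) (hx : 0 < x) :
    ∫⁻ t in Ioo 0 x, ENNReal.ofReal (t ^ (k - 1)) = ENNReal.ofReal (x ^ k / k) := by
  have hint : IntervalIntegrable (fun t : ℝ => t ^ (k - 1)) volume 0 x :=
    intervalIntegral.intervalIntegrable_rpow' (by linarith)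
  rw [setLIntegral_congr Ioo_ae_eq_Ioc, ← ofReal_integral_eq_lintegral_ofReal
    ((intervalIntegrable_iff_integrableOn_Ioc_of_le hx.le).1 hint),
    ← intervalIntegral.integral_of_le hx.le, integral_rpow (Or.inl (by linarith)),
    sub_add_cancel, Real.zero_rpow hk.ne', sub_zero]
  filter_upwards [ae_restrict_mem measurableSet_Ioc] with t ht
  have ht0 : 0 < t := ht.1
  positivity

theorem measure_lt_min_mul_rpow_le {Z : Ω → ℝ} {t : ℝ} (ht : 0 < t) (hx : 0 < x) {B : ℝ≥0∞}
    (htail : ∀ u ≥ 1, P {ω | x / u < Z ω} ≤ ENNReal.ofReal (u ^ l) * B) :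
    P {ω | t < max (min (Z ω) x) 0} * ENNReal.ofReal (t ^ (k - 1)) ≤
      (Ioo 0 x).indicator
        (fun t => ENNReal.ofReal (x ^ l) * B * ENNReal.ofReal (t ^ (k - l - 1))) t := by
  have hlt {ω : Ω} (hω : t < max (min (Z ω) x) 0) : t < Z ω ∧ t < x :=
    lt_min_iff.1 ((lt_max_iff.1 hω).resolve_right ht.not_gt)
  by_cases htx : t < x
  · have hsub : {ω | t < max (min (Z ω) x) 0} ⊆ {ω | x / (x / t) < Z ω} := fun ω hω => by
      rw [mem_ofPred_eq, div_div_cancel₀ hx.ne']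
      exact (hlt hω).1
    rw [indicator_of_mem (mem_Ioo.2 ⟨ht, htx⟩)]
    calc P {ω | t < max (min (Z ω) x) 0} * ENNReal.ofReal (t ^ (k - 1))
        ≤ ENNReal.ofReal ((x / t) ^ l) * B * ENNReal.ofReal (t ^ (k - 1)) := by
          gcongr
          exact (measure_mono hsub).trans (htail _ ((one_le_div ht).2 htx.le))
      _ = ENNReal.ofReal (x ^ l) * B * ENNReal.ofReal (t ^ (k - l - 1)) := by
          rw [mul_right_comm, mul_right_comm _ B, ← ENNReal.ofReal_mul (by positivity),
            ← ENNReal.ofReal_mul (by positivity), Real.div_rpow hx.le ht.le, div_eq_mul_inv,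
            mul_assoc, ← Real.rpow_neg ht.le, ← Real.rpow_add ht]
          ring_nf
  · rw [show {ω | t < max (min (Z ω) x) 0} = ∅ from
      eq_empty_of_forall_notMem fun ω hω => htx (hlt hω).2, measure_empty, zero_mul]
    exact zero_le

theorem lintegral_min_rpow_le {Z : Ω → ℝ} (hZ : Measurable Z) (hk : 0 < k) (hlk : l < k)
    (hx : 0 < x) {B : ℝ≥0∞} (hB : B ≠ ⊤)
    (htail : ∀ u ≥ 1, P {ω | x / u < Z ω} ≤ ENNReal.ofReal (u ^ l) * B) :
    ∫⁻ ω, min (ENNReal.ofReal (Z ω)) (ENNReal.ofReal x) ^ k ∂P ≤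
      ENNReal.ofReal (k / (k - l)) * ENNReal.ofReal x ^ k * B := by
  have htrunc (ω : Ω) : min (ENNReal.ofReal (Z ω)) (ENNReal.ofReal x) ^ k =
      ENNReal.ofReal (max (min (Z ω) x) 0 ^ k) := by
    rw [← ENNReal.ofReal_min, ← ENNReal.ofReal_rpow_of_nonneg (le_max_right _ _) hk.le,
      ENNReal.ofReal_max, ENNReal.ofReal_zero, max_eq_left zero_le]
  calc ∫⁻ ω, min (ENNReal.ofReal (Z ω)) (ENNReal.ofReal x) ^ k ∂P
      = ENNReal.ofReal k *
          ∫⁻ t in Ioi 0, P {ω | t < max (min (Z ω) x) 0} * ENNReal.ofReal (t ^ (k - 1)) := by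
        simp only [htrunc]
        exact lintegral_rpow_eq_lintegral_meas_lt_mul P (ae_of_all _ fun ω => le_max_right _ _)
          ((hZ.min measurable_const).max measurable_const).aemeasurable hk
    _ ≤ ENNReal.ofReal k * ∫⁻ t in Ioo 0 x,
          ENNReal.ofReal (x ^ l) * B * ENNReal.ofReal (t ^ (k - l - 1)) := by
        rw [← lintegral_indicator measurableSet_Ioo]
        refine mul_le_mul_right (le_trans ?_ (setLIntegral_le_lintegral (Ioi 0) _)) _
        exact setLIntegral_mono' measurableSet_Ioi fun t (ht : 0 < t) =>
          measure_lt_min_mul_rpow_le ht hx htail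
    _ = ENNReal.ofReal (k / (k - l)) * ENNReal.ofReal x ^ k * B := by
        rw [lintegral_const_mul' _ _ (ENNReal.mul_ne_top ENNReal.ofReal_ne_top hB),
          setLIntegral_Ioo_rpow (sub_pos.2 hlk) hx, ENNReal.ofReal_rpow_of_pos hx,
          mul_right_comm _ B, ← mul_assoc, ← ENNReal.ofReal_mul (by positivity),
          ← ENNReal.ofReal_mul hk.le, ← ENNReal.ofReal_mul (div_pos hk (sub_pos.2 hlk)).le,
          mul_div_assoc', ← Real.rpow_add hx, add_sub_cancel]
        congr 2
        ring

theorem measure_lt_tsum_le {Z : ℕ → Ω → ℝ≥0∞} (a : ℝ≥0∞) :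
    P {ω | a < ∑' i, Z i ω} ≤
      ∑' i, P {ω | a < Z i ω} + P {ω | a ≤ ∑' i, min (Z i ω) a} := by
  refine (measure_mono (t := (⋃ i, {ω | a < Z i ω}) ∪ {ω | a ≤ ∑' i, min (Z i ω) a})
    fun ω hω => ?_).trans ((measure_union_le _ _).trans (by gcongr; exact measure_iUnion_le _))
  by_cases hbig : ∃ i, a < Z i ω
  · exact Or.inl (mem_iUnion.2 hbig)
  · refine Or.inr ?_
    simp only [not_exists, not_lt] at hbig
    simpa only [mem_ofPred_eq, min_eq_left (hbig _)] using le_of_lt hω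

theorem measure_lt_tsum_le_of_truncation {Z : ℕ → Ω → ℝ} (hZ : ∀ i, Measurable (Z i)) (hk : 1 ≤ k)
    (hlk : l < k) (hx : 0 < x) {M : ℕ → ℝ≥0∞} (hM : ∀ i, M i ≠ ⊤) {B : ℝ≥0∞} (hB : B ≠ ⊤)
    (htail : ∀ i, ∀ u ≥ 1, P {ω | x / u < Z i ω} ≤ ENNReal.ofReal (u ^ l) * (M i * B)) :
    P {ω | ENNReal.ofReal x < ∑' i, ENNReal.ofReal (Z i ω)} ≤
      (1 + ENNReal.ofReal (k / (k - l))) * (∑' i, M i ^ (1 / k)) ^ k * B := by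
  have hk0 : 0 < k := one_pos.trans_le hk
  set S := (∑' i, M i ^ (1 / k)) ^ k
  set c := ENNReal.ofReal (k / (k - l))
  set a := ENNReal.ofReal x with ha
  have hlarge : ∑' i, P {ω | a < ENNReal.ofReal (Z i ω)} ≤ S * B := by
    calc ∑' i, P {ω | a < ENNReal.ofReal (Z i ω)} ≤ ∑' i, M i * B := by
          gcongr with i
          simpa [ha, ENNReal.ofReal_lt_ofReal_iff_of_nonneg hx.le] using htail i 1 le_rfl
      _ = (∑' i, (M i ^ (1 / k)) ^ k) * B := by
          simp only [ENNReal.tsum_mul_right, one_div, ENNReal.rpow_inv_rpow hk0.ne']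
      _ ≤ S * B := by gcongr; exact tsum_rpow_le_rpow_tsum _ hk
  have hmoment : ∫⁻ ω, (∑' i, min (ENNReal.ofReal (Z i ω)) a) ^ k ∂P ≤ a ^ k * (c * S * B) := by
    calc ∫⁻ ω, (∑' i, min (ENNReal.ofReal (Z i ω)) a) ^ k ∂P
        ≤ (∑' i, (∫⁻ ω, min (ENNReal.ofReal (Z i ω)) a ^ k ∂P) ^ (1 / k)) ^ k :=
          lintegral_tsum_rpow_le (fun i => (hZ i).ennreal_ofReal.min measurable_const) hk
      _ ≤ (∑' i, (c * a ^ k * (M i * B)) ^ (1 / k)) ^ k := by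
          gcongr with i
          exact lintegral_min_rpow_le (hZ i) hk0 hlk hx (ENNReal.mul_ne_top (hM i) hB) (htail i)
      _ = (∑' i, (c * a ^ k * B) ^ (1 / k) * M i ^ (1 / k)) ^ k := by
          simp only [← ENNReal.mul_rpow_of_nonneg _ _ (one_div_pos.2 hk0).le, mul_comm (M _),
            ← mul_assoc]
      _ = a ^ k * (c * S * B) := by
          rw [ENNReal.tsum_mul_left, ENNReal.mul_rpow_of_nonneg _ _ hk0.le, one_div,
            ENNReal.rpow_inv_rpow hk0.ne', ← one_div]
          ring
  have hsmall : P {ω | a ≤ ∑' i, min (ENNReal.ofReal (Z i ω)) a} ≤ c * S * B := by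
    have ha0 : a ^ k ≠ 0 := by simp [ha, ENNReal.rpow_eq_zero_iff, hx]
    have hatop : a ^ k ≠ ⊤ := ENNReal.rpow_ne_top_of_nonneg hk0.le ENNReal.ofReal_ne_top
    refine (ENNReal.mul_le_mul_iff_right ha0 hatop).1 (le_trans ?_ hmoment)
    simpa only [ENNReal.rpow_le_rpow_iff hk0] using mul_meas_ge_le_lintegral (μ := P)
      ((Measurable.tsum fun i => (hZ i).ennreal_ofReal.min measurable_const).pow_const k) (a ^ k)
  calc P {ω | a < ∑' i, ENNReal.ofReal (Z i ω)} ≤ S * B + c * S * B :=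
        (measure_lt_tsum_le a).trans (add_le_add hlarge hsmall)
    _ = (1 + c) * S * B := by ring

theorem hasNegligibleTails_of_truncation {Z : ℕ → Ω → ℝ} (hZ : ∀ i, Measurable (Z i))
    (hk : 1 ≤ k) (hlk : l < k) {M : ℕ → ℝ≥0∞} (hM : ∑' i, M i ^ (1 / k) ≠ ⊤) {K : ℝ≥0∞}
    (hK : K ≠ ⊤)
    (htail : ∀ᶠ x in atTop, ∀ i, ∀ u ≥ 1, P {ω | x / u < Z i ω} ≤
      ENNReal.ofReal (u ^ l) * (M i * (K * ENNReal.ofReal (G x)))) :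
    HasNegligibleTails P G fun i ω => ENNReal.ofReal (Z i ω) := by
  have hk0 : 0 < k := one_pos.trans_le hk
  have hMtop (i : ℕ) : M i ≠ ⊤ := fun hi =>
    ENNReal.ne_top_of_tsum_ne_top hM i (by simp [hi, hk0])
  intro ε hε
  have hconst : (1 + ENNReal.ofReal (k / (k - l))) * K ≠ ⊤ :=
    ENNReal.mul_ne_top (by simp) hK
  obtain ⟨δ, hδ, hδε⟩ := exists_pos_mul_rpow_lt hk0 hconst hε
  obtain ⟨m, hm⟩ := exists_tsum_nat_add_le hM (ENNReal.ofReal_pos.2 hδ).ne'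
  refine ⟨m, ?_⟩
  filter_upwards [htail, eventually_gt_atTop 0] with x htail hx
  calc P {ω | ENNReal.ofReal x < ∑' i, ENNReal.ofReal (Z (i + m) ω)}
      ≤ (1 + ENNReal.ofReal (k / (k - l))) * (∑' i, M (i + m) ^ (1 / k)) ^ k *
          (K * ENNReal.ofReal (G x)) :=
        measure_lt_tsum_le_of_truncation (fun i => hZ _) hk hlk hx (fun i => hMtop _)
          (ENNReal.mul_ne_top hK ENNReal.ofReal_ne_top) fun i => htail _
    _ ≤ (1 + ENNReal.ofReal (k / (k - l))) * ENNReal.ofReal (δ ^ k) *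
          (K * ENNReal.ofReal (G x)) := by
        rw [← ENNReal.ofReal_rpow_of_pos hδ]
        gcongr
    _ = (1 + ENNReal.ofReal (k / (k - l))) * K * ENNReal.ofReal (δ ^ k) * ENNReal.ofReal (G x) := by
        ring
    _ ≤ ε * ENNReal.ofReal (G x) := by gcongr

theorem HasNegligibleTails.ae_tsum_ne_top {Z : ℕ → Ω → ℝ≥0∞} (h : HasNegligibleTails P G Z)
    (hG : ∀ x, G x ≤ 1) (hZfin : ∀ i ω, Z i ω ≠ ⊤) : ∀ᵐ ω ∂P, ∑' i, Z i ω ≠ ⊤ := by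
  refine nonpos_iff_eq_zero.1 (le_of_forall_pos_le_add fun ε hε => ?_)
  rw [zero_add]
  obtain ⟨m, hm⟩ := h ε hε.ne'
  obtain ⟨x, hx⟩ := hm.exists
  refine (measure_mono fun ω hω => ?_).trans
    (hx.trans (mul_le_of_le_one_right zero_le (ENNReal.ofReal_le_one.2 (hG x))))
  have hsplit := ENNReal.summable.sum_add_tsum_nat_add' (f := fun i => Z i ω) (k := m)
  rw [not_not.1 hω, ENNReal.add_eq_top] at hsplit
  have htail : ∑' i, Z (i + m) ω = ⊤ :=
    hsplit.resolve_left (ENNReal.sum_ne_top.2 fun i _ => hZfin i ω)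
  rw [mem_ofPred_eq, htail]
  exact ENNReal.ofReal_lt_top

end TailSums

section DiscountedTails

variable {Ω : Type*} [MeasurableSpace Ω] {P : Measure Ω} {G : ℝ → ℝ} {α k l k₁ k₂ : ℝ}

/-- The moment `E[θᵏ]` of a nonnegative random variable. -/
noncomputable def posMoment (P : Measure Ω) (θ : Ω → ℝ) (k : ℝ) : ℝ≥0∞ :=
  ∫⁻ ω, ENNReal.ofReal (θ ω ^ k) ∂P

theorem posMoment_ne_zero [NeZero P] {θ : Ω → ℝ} (hθm : Measurable θ) (hθ : ∀ ω, 0 < θ ω) :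
    posMoment P θ k ≠ 0 := by
  have hsupport : (Function.support fun ω => ENNReal.ofReal (θ ω ^ k)) = univ :=
    eq_univ_of_forall fun ω => by simpa using Real.rpow_pos_of_pos (hθ ω) k
  rw [posMoment, ← pos_iff_ne_zero, lintegral_pos_iff_support (hθm.pow_const k).ennreal_ofReal,
    hsupport]
  exact NeZero.pos _

theorem posMoment_rpow_one_div_le [IsProbabilityMeasure P] {θ : Ω → ℝ} (hθm : Measurable θ)
    (hθ : ∀ ω, 0 < θ ω) (hk : 0 < k) (hkl : k ≤ l) :
    posMoment P θ k ^ (1 / k) ≤ posMoment P θ l ^ (1 / l) := by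
  have hnorm {p : ℝ} (hp : 0 < p) : eLpNorm' θ p P = posMoment P θ p ^ (1 / p) := by
    rw [eLpNorm', posMoment]
    congr 1
    refine lintegral_congr fun ω => ?_
    rw [Real.enorm_eq_ofReal (hθ ω).le, ENNReal.ofReal_rpow_of_nonneg (hθ ω).le hp.le]
  simpa only [hnorm hk, hnorm (hk.trans_le hkl)] using
    eLpNorm'_le_eLpNorm'_of_exponent_le hk hkl P hθm.aestronglyMeasurable

theorem posMoment_div_le_one {θ : Ω → ℝ} (hθ : ∀ ω, 0 < θ ω) {w : ℝ} (hw : 0 < w)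
    (h : posMoment P θ k ≤ ENNReal.ofReal w ^ k) : posMoment P (fun ω => θ ω / w) k ≤ 1 := by
  have hwk : 0 < w ^ k := Real.rpow_pos_of_pos hw k
  refine (ENNReal.mul_le_mul_iff_right (a := ENNReal.ofReal (w ^ k)) (by simpa using hwk)
    ENNReal.ofReal_ne_top).1 ?_
  calc ENNReal.ofReal (w ^ k) * posMoment P (fun ω => θ ω / w) k = posMoment P θ k := by
        rw [posMoment, posMoment, ← lintegral_const_mul' _ _ ENNReal.ofReal_ne_top]
        refine lintegral_congr fun ω => ?_
        rw [← ENNReal.ofReal_mul hwk.le, ← Real.mul_rpow hw.le (div_pos (hθ ω) hw).le,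
          mul_div_cancel₀ _ hw.ne']
    _ ≤ ENNReal.ofReal (w ^ k) * 1 := by rwa [mul_one, ← ENNReal.ofReal_rpow_of_pos hw]

theorem tsum_posMoment_ne_top_of_one_le [IsProbabilityMeasure P] {θ : ℕ → Ω → ℝ}
    (hθm : ∀ i, Measurable (θ i)) (hθ : ∀ i ω, 0 < θ i ω) (hk : 1 ≤ k) (hkl : k ≤ l)
    (hsum : ∑' i, posMoment P (θ i) l ^ (1 / l) ≠ ⊤) : ∑' i, posMoment P (θ i) k ≠ ⊤ := by
  have hk0 : 0 < k := one_pos.trans_le hk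
  refine ne_top_of_le_ne_top (ENNReal.rpow_ne_top_of_nonneg hk0.le hsum) ?_
  calc ∑' i, posMoment P (θ i) k = ∑' i, (posMoment P (θ i) k ^ (1 / k)) ^ k := by
        simp only [one_div, ENNReal.rpow_inv_rpow hk0.ne']
    _ ≤ ∑' i, (posMoment P (θ i) l ^ (1 / l)) ^ k := by
        gcongr with i
        exact posMoment_rpow_one_div_le (hθm i) (hθ i) hk0 hkl
    _ ≤ (∑' i, posMoment P (θ i) l ^ (1 / l)) ^ k := tsum_rpow_le_rpow_tsum _ hk

theorem tsum_ne_top_of_tsum_rpow_ne_top {ι : Type*} {a : ι → ℝ≥0∞} (hk : 1 ≤ k)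
    (ha : ∑' i, a i ^ (1 / k) ≠ ⊤) : ∑' i, a i ≠ ⊤ := by
  have hk0 : 0 < k := one_pos.trans_le hk
  refine ne_top_of_le_ne_top (ENNReal.rpow_ne_top_of_nonneg hk0.le ha) ?_
  simpa only [one_div, ENNReal.rpow_inv_rpow hk0.ne'] using
    tsum_rpow_le_rpow_tsum (fun i => a i ^ (1 / k)) hk

namespace IsRegVarTail

theorem eventually_lintegral_le_mul_lintegral (h : IsRegVarTail G α) (hk₁ : 0 < k₁)
    (hk₁α : k₁ < α) (hαk₂ : α < k₂) :
    ∃ C > 0, ∀ᶠ x in atTop, ∀ (μ : Measure Ω) (θ : Ω → ℝ), (∀ ω, 0 < θ ω) →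
      ∫⁻ ω, ENNReal.ofReal (G (x / θ ω)) ∂μ ≤
        ENNReal.ofReal C * ENNReal.ofReal (G x) *
          ∫⁻ ω, ENNReal.ofReal (θ ω ^ k₁ + θ ω ^ k₂) ∂μ := by
  obtain ⟨C, hC, hpotter⟩ := h.potter hk₁ hk₁α hαk₂
  refine ⟨C, hC, ?_⟩
  filter_upwards [hpotter] with x hx μ θ hθ
  rw [← ENNReal.ofReal_mul hC.le, ← lintegral_const_mul' _ _ ENNReal.ofReal_ne_top]
  refine lintegral_mono fun ω => ?_
  rw [← ENNReal.ofReal_mul (mul_nonneg hC.le (h.nonneg _)), mul_right_comm]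
  exact ENNReal.ofReal_le_ofReal (hx _ (hθ ω))

theorem eventually_lintegral_le (h : IsRegVarTail G α) (hk₁ : 0 < k₁) (hk₁α : k₁ < α)
    (hαk₂ : α < k₂) {η : ℝ} (hη : 0 < η) :
    ∀ᶠ x in atTop, ∀ (μ : Measure Ω) (θ : Ω → ℝ), Measurable θ → (∀ ω, 0 < θ ω) →
      ∫⁻ ω, ENNReal.ofReal (G (x / θ ω)) ∂μ ≤
        ENNReal.ofReal (G x) * (∫⁻ ω, ENNReal.ofReal (θ ω ^ α) ∂μ +
          ENNReal.ofReal η * ∫⁻ ω, ENNReal.ofReal (θ ω ^ k₁ + θ ω ^ k₂) ∂μ) := by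
  filter_upwards [h.eventually_abs_sub_le hk₁ hk₁α hαk₂ hη] with x hx μ θ hθm hθ
  rw [← lintegral_const_mul' _ _ ENNReal.ofReal_ne_top,
    ← lintegral_add_left (hθm.pow_const α).ennreal_ofReal,
    ← lintegral_const_mul' _ _ ENNReal.ofReal_ne_top]
  refine lintegral_mono fun ω => ?_
  have hθω := hθ ω
  rw [← ENNReal.ofReal_mul hη.le, ← ENNReal.ofReal_add (by positivity) (by positivity),
    ← ENNReal.ofReal_mul (h.nonneg x)]
  exact ENNReal.ofReal_le_ofReal (by linarith [(abs_le.1 (hx _ hθω)).2])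

theorem eventually_le_lintegral (h : IsRegVarTail G α) (hk₁ : 0 < k₁) (hk₁α : k₁ < α)
    (hαk₂ : α < k₂) {η : ℝ} (hη : 0 < η) :
    ∀ᶠ x in atTop, ∀ (μ : Measure Ω) (θ : Ω → ℝ), Measurable θ → (∀ ω, 0 < θ ω) →
      ENNReal.ofReal (G x) * ∫⁻ ω, ENNReal.ofReal (θ ω ^ α) ∂μ ≤
        ∫⁻ ω, ENNReal.ofReal (G (x / θ ω)) ∂μ + ENNReal.ofReal (G x) *
          (ENNReal.ofReal η * ∫⁻ ω, ENNReal.ofReal (θ ω ^ k₁ + θ ω ^ k₂) ∂μ) := by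
  filter_upwards [h.eventually_abs_sub_le hk₁ hk₁α hαk₂ hη] with x hx μ θ hθm hθ
  have hGm : Measurable fun ω => ENNReal.ofReal (G (x / θ ω)) :=
    (h.antitone.measurable.comp (hθm.const_div x)).ennreal_ofReal
  rw [← lintegral_const_mul' _ _ ENNReal.ofReal_ne_top,
    ← lintegral_const_mul' _ _ ENNReal.ofReal_ne_top,
    ← lintegral_const_mul' _ _ ENNReal.ofReal_ne_top, ← lintegral_add_left hGm]
  refine lintegral_mono fun ω => ?_
  have hθω := hθ ω
  have hGx := h.nonneg x
  rw [← ENNReal.ofReal_mul hη.le, ← ENNReal.ofReal_mul hGx, ← ENNReal.ofReal_mul hGx,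
    ← ENNReal.ofReal_add (h.nonneg _) (by positivity)]
  exact ENNReal.ofReal_le_ofReal (by linarith [(abs_le.1 (hx _ hθω)).1])

theorem eventually_le_mul (h : IsRegVarTail G α) {c L : ℝ} (hc : 0 < c) (hL : c ^ (-α) < L) :
    ∀ᶠ x in atTop, G (c * x) ≤ L * G x := by
  filter_upwards [(h.tendsto c hc).eventually (gt_mem_nhds hL)] with x hx
  exact ((div_lt_iff₀ (h.pos x)).1 hx).le

end IsRegVarTail

theorem lintegral_ofReal_rpow_add {θ : Ω → ℝ} (hθm : Measurable θ) (hθ : ∀ ω, 0 < θ ω)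
    (k₁ k₂ : ℝ) : ∫⁻ ω, ENNReal.ofReal (θ ω ^ k₁ + θ ω ^ k₂) ∂P =
      posMoment P θ k₁ + posMoment P θ k₂ := by
  rw [posMoment, posMoment, ← lintegral_add_left (hθm.pow_const k₁).ennreal_ofReal]
  refine lintegral_congr fun ω => ENNReal.ofReal_add ?_ ?_ <;>
  exact Real.rpow_nonneg (hθ ω).le _

variable {θ W : ℕ → Ω → ℝ} {K : ℝ≥0∞}

/-- The factor `θ i` is normalised by its norm `w i` in `L^k`, which makes the tails of
`θ i * W i / w i` comparable to `G` uniformly in `i`. -/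
theorem hasNegligibleTails_mul_of_one_lt [IsProbabilityMeasure P] (h : IsRegVarTail G α)
    (hα : 1 < α) (hθm : ∀ i, Measurable (θ i)) (hθ : ∀ i ω, 0 < θ i ω)
    (hWm : ∀ i, Measurable (W i)) (hK : K ≠ ⊤)
    (htail : ∀ i x, 0 < x → P {ω | x < θ i ω * W i ω} ≤
      K * ∫⁻ ω, ENNReal.ofReal (G (x / θ i ω)) ∂P)
    (hk : α < k) (hsum : ∑' i, posMoment P (θ i) k ^ (1 / k) ≠ ⊤) :
    HasNegligibleTails P G fun i ω => ENNReal.ofReal (θ i ω * W i ω) := by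
  have hk0 : 0 < k := h.index_pos.trans hk
  have hα2 : α / 2 < α := half_lt_self h.index_pos
  have hw (i : ℕ) : ∃ w : ℝ, 0 < w ∧ ENNReal.ofReal w = posMoment P (θ i) k ^ (1 / k) :=
    ⟨_, ENNReal.toReal_pos ((ENNReal.rpow_pos_of_nonneg
      (pos_iff_ne_zero.2 (posMoment_ne_zero (hθm i) (hθ i))) (by positivity)).ne')
      (ENNReal.ne_top_of_tsum_ne_top hsum i),
      ENNReal.ofReal_toReal (ENNReal.ne_top_of_tsum_ne_top hsum i)⟩
  choose w hw0 hwk using hw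
  have hmoment (i : ℕ) {p : ℝ} (hp : 0 < p) (hpk : p ≤ k) :
      posMoment P (fun ω => θ i ω / w i) p ≤ 1 := by
    refine posMoment_div_le_one (hθ i) (hw0 i) ?_
    rw [hwk, ← ENNReal.rpow_inv_rpow hp.ne' (posMoment P (θ i) p), ← one_div]
    exact ENNReal.rpow_le_rpow (posMoment_rpow_one_div_le (hθm i) (hθ i) hp hpk) hp.le
  obtain ⟨C, -, hC⟩ :=
    h.eventually_lintegral_le_mul_lintegral (Ω := Ω) (half_pos h.index_pos) hα2 hk
  have hscaled : ∀ᶠ y in atTop, ∀ i, P {ω | y < θ i ω * W i ω / w i} ≤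
      K * ENNReal.ofReal C * 2 * ENNReal.ofReal (G y) := by
    filter_upwards [hC, eventually_gt_atTop 0] with y hC hy i
    calc P {ω | y < θ i ω * W i ω / w i} = P {ω | y * w i < θ i ω * W i ω} := by
          simp only [lt_div_iff₀ (hw0 i)]
      _ ≤ K * ∫⁻ ω, ENNReal.ofReal (G (y / (θ i ω / w i))) ∂P := by
          simpa only [div_div_eq_mul_div] using htail i _ (mul_pos hy (hw0 i))
      _ ≤ K * (ENNReal.ofReal C * ENNReal.ofReal (G y) * (1 + 1)) := by
          gcongr
          refine (hC P _ fun ω => div_pos (hθ i ω) (hw0 i)).trans ?_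
          rw [lintegral_ofReal_rpow_add ((hθm i).div_const _) fun ω => div_pos (hθ i ω) (hw0 i)]
          gcongr <;> exact hmoment i (by linarith) (by linarith)
      _ = K * ENNReal.ofReal C * 2 * ENNReal.ofReal (G y) := by rw [one_add_one_eq_two]; ring
  have hnegl := hasNegligibleTails_of_one_lt h hα
    (U := fun i ω => θ i ω * W i ω / w i)
    (fun i => ((hθm i).mul (hWm i)).div_const (w i)) (by simpa only [hwk] using hsum)
    (ENNReal.mul_ne_top (ENNReal.mul_ne_top hK ENNReal.ofReal_ne_top) ENNReal.ofNat_ne_top) hscaled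
  simpa only [← hwk, ← ENNReal.ofReal_mul (hw0 _).le, mul_div_cancel₀ _ (hw0 _).ne'] using hnegl

theorem mul_rpow_add_mul_rpow_le {s u l : ℝ} (hs : 0 < s) (hu : 1 ≤ u) (hk₁l : k₁ ≤ l)
    (hlk₂ : l ≤ k₂) : (u * s) ^ k₁ + (u * s) ^ l ≤ u ^ l * (2 * (s ^ k₁ + s ^ k₂)) := by
  have hu0 : 0 < u := one_pos.trans_le hu
  have hsl : s ^ l ≤ s ^ k₁ + s ^ k₂ := by
    rcases le_total s 1 with hs1 | hs1
    · exact (Real.rpow_le_rpow_of_exponent_ge hs hs1 hk₁l).trans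
        (le_add_of_nonneg_right (Real.rpow_nonneg hs.le _))
    · exact (Real.rpow_le_rpow_of_exponent_le hs1 hlk₂).trans
        (le_add_of_nonneg_left (Real.rpow_nonneg hs.le _))
  calc (u * s) ^ k₁ + (u * s) ^ l = u ^ k₁ * s ^ k₁ + u ^ l * s ^ l := by
        rw [Real.mul_rpow hu0.le hs.le, Real.mul_rpow hu0.le hs.le]
    _ ≤ u ^ l * s ^ k₁ + u ^ l * s ^ l := by gcongr
    _ ≤ u ^ l * (2 * (s ^ k₁ + s ^ k₂)) := by
        rw [← mul_add]
        gcongr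
        linarith [Real.rpow_pos_of_pos hs k₂]

theorem hasNegligibleTails_mul_of_max (h : IsRegVarTail G α)
    (hθm : ∀ i, Measurable (θ i)) (hθ : ∀ i ω, 0 < θ i ω)
    (hWm : ∀ i, Measurable (W i)) (hK : K ≠ ⊤)
    (htail : ∀ i x, 0 < x → P {ω | x < θ i ω * W i ω} ≤
      K * ∫⁻ ω, ENNReal.ofReal (G (x / θ i ω)) ∂P)
    (hk : 1 ≤ k) (hαk : α < k) (hk₁ : 0 < k₁) (hk₁α : k₁ < α) (hαk₂ : α < k₂)
    (hsum : ∑' i, max (posMoment P (θ i) k₁) (posMoment P (θ i) k₂) ^ (1 / k) ≠ ⊤) :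
    HasNegligibleTails P G fun i ω => ENNReal.ofReal (θ i ω * W i ω) := by
  obtain ⟨l, hαl, hl⟩ := exists_between (lt_min hαk hαk₂)
  obtain ⟨hlk, hlk₂⟩ := lt_min_iff.1 hl
  obtain ⟨C, -, hC⟩ := h.eventually_lintegral_le_mul_lintegral (Ω := Ω) hk₁ hk₁α hαl
  refine hasNegligibleTails_of_truncation (K := K * ENNReal.ofReal C * 4)
    (fun i => (hθm i).mul (hWm i)) hk hlk hsum (ENNReal.mul_ne_top
      (ENNReal.mul_ne_top hK ENNReal.ofReal_ne_top) ENNReal.ofNat_ne_top) ?_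
  filter_upwards [hC, eventually_gt_atTop 0] with x hC hx i u hu
  have hu0 : 0 < u := one_pos.trans_le hu
  calc P {ω | x / u < θ i ω * W i ω}
      ≤ K * ∫⁻ ω, ENNReal.ofReal (G (x / (u * θ i ω))) ∂P := by
        simpa only [div_div] using htail i _ (div_pos hx hu0)
    _ ≤ K * (ENNReal.ofReal C * ENNReal.ofReal (G x) *
          ∫⁻ ω, ENNReal.ofReal ((u * θ i ω) ^ k₁ + (u * θ i ω) ^ l) ∂P) := by
        gcongr
        exact hC P _ fun ω => mul_pos hu0 (hθ i ω)
    _ ≤ K * (ENNReal.ofReal C * ENNReal.ofReal (G x) * (ENNReal.ofReal (u ^ l) * (2 *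
          ∫⁻ ω, ENNReal.ofReal (θ i ω ^ k₁ + θ i ω ^ k₂) ∂P))) := by
        rw [← ENNReal.ofReal_ofNat 2, ← lintegral_const_mul' _ _ ENNReal.ofReal_ne_top,
          ← lintegral_const_mul' _ _ ENNReal.ofReal_ne_top]
        gcongr with ω
        rw [← ENNReal.ofReal_mul two_pos.le, ← ENNReal.ofReal_mul (by positivity)]
        exact ENNReal.ofReal_le_ofReal
          (mul_rpow_add_mul_rpow_le (hθ i ω) hu (hk₁α.trans hαl).le hlk₂.le)
    _ ≤ K * (ENNReal.ofReal C * ENNReal.ofReal (G x) * (ENNReal.ofReal (u ^ l) * (2 *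
          (max (posMoment P (θ i) k₁) (posMoment P (θ i) k₂) +
            max (posMoment P (θ i) k₁) (posMoment P (θ i) k₂))))) := by
        rw [lintegral_ofReal_rpow_add (hθm i) (hθ i)]
        gcongr <;> simp
    _ = ENNReal.ofReal (u ^ l) * (max (posMoment P (θ i) k₁) (posMoment P (θ i) k₂) *
          (K * ENNReal.ofReal C * 4 * ENNReal.ofReal (G x))) := by ring

end DiscountedTails

section LargeSums

theorem exists_lt_or_exists_offDiag_lt_of_lt_sum {ι : Type*} {s : Finset ι}
    {b : ι → ℝ} {x y : ℝ} (hx : 0 ≤ x) (hy : 0 < y) (h : x + y < ∑ i ∈ s, b i) :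
    (∃ i ∈ s, x < b i) ∨
      ∃ p ∈ s.offDiag, y / (s.card + 1) < b p.1 ∧ y / (s.card + 1) < b p.2 := by
  classical
  have hsum {t : Finset ι} (ht : t ⊆ s) (hbt : ∀ i ∈ t, b i ≤ y / (s.card + 1)) :
      ∑ i ∈ t, b i ≤ y := by
    calc ∑ i ∈ t, b i ≤ t.card * (y / (s.card + 1)) := by
          simpa using Finset.sum_le_card_nsmul t b _ hbt
      _ ≤ (s.card + 1) * (y / (s.card + 1)) := by
          gcongr
          exact_mod_cast (Finset.card_le_card ht).trans (Nat.le_succ _)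
      _ = y := by field_simp
  by_contra! hcon
  obtain ⟨hone, htwo⟩ := hcon
  obtain ⟨i, hi, hbi⟩ : ∃ i ∈ s, y / (s.card + 1) < b i := by
    by_contra! hsmall
    linarith [hsum subset_rfl hsmall]
  have hrest : ∑ j ∈ s.erase i, b j ≤ y := hsum (Finset.erase_subset i s) fun j hj =>
    htwo (i, j) (Finset.mem_offDiag.2
      ⟨hi, Finset.mem_of_mem_erase hj, (Finset.ne_of_mem_erase hj).symm⟩) hbi
  linarith [hone i hi, Finset.add_sum_erase s b hi]

theorem lt_sum_or_lt_tsum_of_lt_tsum {b : ℕ → ℝ} (hb : ∀ i, 0 ≤ b i) {x y : ℝ} (hy : 0 ≤ y)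
    (m : ℕ) (h : ENNReal.ofReal (x + y) < ∑' i, ENNReal.ofReal (b i)) :
    x < ∑ i ∈ Finset.range m, b i ∨ ENNReal.ofReal y < ∑' i, ENNReal.ofReal (b (i + m)) := by
  by_contra! hcon
  obtain ⟨hhead, htail⟩ := hcon
  have hx : 0 ≤ x := (Finset.sum_nonneg fun i _ => hb i).trans hhead
  refine h.not_ge ?_
  rw [← ENNReal.summable.sum_add_tsum_nat_add' (f := fun i => ENNReal.ofReal (b i)) (k := m),
    ← ENNReal.ofReal_sum_of_nonneg fun i _ => hb i, ENNReal.ofReal_add hx hy]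
  gcongr

theorem sum_measure_le_measure_biUnion_add {Ω ι : Type*} [MeasurableSpace Ω]
    {P : Measure Ω} {A : ι → Set Ω} (hA : ∀ i, MeasurableSet (A i)) (s : Finset ι) :
    ∑ i ∈ s, P (A i) ≤ P (⋃ i ∈ s, A i) + ∑ p ∈ s.offDiag, P (A p.1 ∩ A p.2) := by
  classical
  induction s using Finset.induction_on with
  | empty => simp
  | insert a s ha ih =>
    set U := ⋃ i ∈ s, A i with hU
    have hUm : MeasurableSet U := Finset.measurableSet_biUnion _ fun i _ => hA i
    have hunion : P (⋃ i ∈ insert a s, A i) = P U + P (A a \ U) := by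
      rw [Finset.set_biUnion_insert, ← hU, union_comm, ← union_sdiff_self,
        measure_union disjoint_sdiff_right ((hA a).diff hUm)]
    have hnew : P (A a) ≤ P (A a \ U) + ∑ j ∈ s, P (A a ∩ A j) := by
      rw [← measure_inter_add_sdiff (A a) hUm, add_comm, hU, inter_iUnion₂]
      gcongr
      exact measure_biUnion_finset_le _ _
    have hpairs : ∑ p ∈ s.offDiag, P (A p.1 ∩ A p.2) + ∑ j ∈ s, P (A a ∩ A j) ≤
        ∑ p ∈ (insert a s).offDiag, P (A p.1 ∩ A p.2) := by
      have hdisj : Disjoint s.offDiag ({a} ×ˢ s) := by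
        simp only [Finset.disjoint_left, Finset.mem_offDiag, Finset.mem_product,
          Finset.mem_singleton, not_and]
        rintro p ⟨hp, -⟩ rfl
        exact absurd hp ha
      have hrow : ∑ j ∈ s, P (A a ∩ A j) = ∑ p ∈ {a} ×ˢ s, P (A p.1 ∩ A p.2) := by
        rw [Finset.sum_product, Finset.sum_singleton]
      rw [hrow, ← Finset.sum_union hdisj, Finset.offDiag_insert ha]
      exact Finset.sum_le_sum_of_subset Finset.subset_union_left
    rw [Finset.sum_insert ha, hunion]
    calc P (A a) + ∑ i ∈ s, P (A i)
        ≤ (P (A a \ U) + ∑ j ∈ s, P (A a ∩ A j)) +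
            (P U + ∑ p ∈ s.offDiag, P (A p.1 ∩ A p.2)) := add_le_add hnew ih
      _ = P U + P (A a \ U) +
            (∑ p ∈ s.offDiag, P (A p.1 ∩ A p.2) + ∑ j ∈ s, P (A a ∩ A j)) := by ring
      _ ≤ P U + P (A a \ U) + ∑ p ∈ (insert a s).offDiag, P (A p.1 ∩ A p.2) := by gcongr

theorem setOf_lt_tsum_indicator_subset {Ω : Type*} {b : ℕ → Ω → ℝ} (hb : ∀ i ω, 0 ≤ b i ω)
    {x y : ℝ} (hx : 0 ≤ x) (hy : 0 < y) (n : ℕ) (S : ℕ → Set Ω) :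
    {ω | ENNReal.ofReal (x + y + y) < ∑' i, ENNReal.ofReal ((S i).indicator (b i) ω)} ⊆
      (⋃ i, S i ∩ {ω | x < b i ω}) ∪
        ((⋃ p ∈ (Finset.range n).offDiag,
          {ω | y / (n + 1) < b p.1 ω} ∩ {ω | y / (n + 1) < b p.2 ω}) ∪
        {ω | ENNReal.ofReal y < ∑' i, ENNReal.ofReal (b (i + n) ω)}) := by
  intro ω hω
  have hle (i : ℕ) : (S i).indicator (b i) ω ≤ b i ω :=
    indicator_le_self' (fun _ _ => hb i _) _
  rcases lt_sum_or_lt_tsum_of_lt_tsum (fun i => indicator_apply_nonneg fun _ => hb i ω) hy.le n hω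
    with hhead | htail
  · rcases exists_lt_or_exists_offDiag_lt_of_lt_sum hx hy hhead with ⟨i, -, hi⟩ | ⟨p, hp, hp₁, hp₂⟩
    · have hiS : ω ∈ S i := mem_of_indicator_ne_zero (hx.trans_lt hi).ne'
      exact Or.inl (mem_iUnion.2 ⟨i, hiS, hi.trans_le (hle i)⟩)
    · rw [Finset.card_range] at hp₁ hp₂
      exact Or.inr (Or.inl (mem_biUnion hp ⟨hp₁.trans_le (hle _), hp₂.trans_le (hle _)⟩))
  · exact Or.inr (Or.inr (htail.trans_le
      (ENNReal.tsum_le_tsum fun i => ENNReal.ofReal_le_ofReal (hle _))))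

end LargeSums

section DiscountedModel

variable {Ω : Type*} {m : MeasurableSpace Ω} [mΩ : MeasurableSpace Ω] {P : Measure Ω}
  {G : ℝ → ℝ} {α k₁ k₂ : ℝ} {θ Y : ℕ → Ω → ℝ} {ε : ℝ≥0∞}

/-- Products `θ i * Y i` of positive discount factors, measurable with respect to `m`, and
nonnegative claims with tail function `G` that are independent of `m`. Only the consequence `tail`
of the independence is recorded. -/
structure IsDiscountedModel {Ω : Type*} (m : MeasurableSpace Ω) [mΩ : MeasurableSpace Ω]
    (P : Measure Ω) (G : ℝ → ℝ) (θ Y : ℕ → Ω → ℝ) : Prop where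
  le : m ≤ mΩ
  measurable_discount : ∀ i, Measurable[m] (θ i)
  discount_pos : ∀ i ω, 0 < θ i ω
  measurable_claim : ∀ i, Measurable (Y i)
  claim_nonneg : ∀ i ω, 0 ≤ Y i ω
  tail : ∀ i x S, 0 < x → MeasurableSet[m] S →
    P (S ∩ {ω | x < θ i ω * Y i ω}) = ∫⁻ ω in S, ENNReal.ofReal (G (x / θ i ω)) ∂P

/-- The moments of `θ i` of two orders `k₁ < α < k₂` enclosing `α` are summable over `i`. -/
structure HasSummableMoments {Ω : Type*} [MeasurableSpace Ω] (P : Measure Ω) (θ : ℕ → Ω → ℝ)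
    (α k₁ k₂ : ℝ) : Prop where
  pos : 0 < k₁
  lt_index : k₁ < α
  index_lt : α < k₂
  tsum_ne_top : ∑' i, ∫⁻ ω, ENNReal.ofReal (θ i ω ^ k₁ + θ i ω ^ k₂) ∂P ≠ ⊤

/-- Any two of the variables `Y i` exceed a high level simultaneously with a probability that is
negligible with respect to the tail function `G`. -/
def PairwiseTAI (P : Measure Ω) (G : ℝ → ℝ) (Y : ℕ → Ω → ℝ) : Prop :=
  ∀ i j, i ≠ j → ∀ ε : ℝ≥0∞, ε ≠ 0 →
    ∀ᶠ x in atTop, P ({ω | x < Y i ω} ∩ {ω | x < Y j ω}) ≤ ε * ENNReal.ofReal (G x)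

theorem IsRegVarTail.exists_forall_eventually_comp_mul_le (h : IsRegVarTail G α) {c : ℝ}
    (hc : 0 < c) (hε : ε ≠ 0) :
    ∃ ε' ≠ 0, ∀ f : ℝ → ℝ≥0∞, (∀ᶠ x in atTop, f x ≤ ε' * ENNReal.ofReal (G x)) →
      ∀ᶠ x in atTop, f (c * x) ≤ ε * ENNReal.ofReal (G x) := by
  set L := c ^ (-α) + 1
  have hL : 0 < L := by positivity
  have hL' : ENNReal.ofReal L ≠ 0 := by simpa using hL
  refine ⟨ε / ENNReal.ofReal L, ENNReal.div_ne_zero.2 ⟨hε, ENNReal.ofReal_ne_top⟩, fun f hf => ?_⟩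
  filter_upwards [(tendsto_id.const_mul_atTop hc).eventually hf,
    h.eventually_le_mul hc (lt_add_one (c ^ (-α)))] with x hfx hGx
  calc f (c * x) ≤ ε / ENNReal.ofReal L * ENNReal.ofReal (G (c * x)) := hfx
    _ ≤ ε / ENNReal.ofReal L * (ENNReal.ofReal L * ENNReal.ofReal (G x)) := by
        rw [← ENNReal.ofReal_mul hL.le]
        gcongr
    _ = ε * ENNReal.ofReal (G x) := by
        rw [← mul_assoc, ENNReal.div_mul_cancel hL' ENNReal.ofReal_ne_top]

theorem tendsto_setLIntegral_natCast_lt [IsFiniteMeasure P] {f : Ω → ℝ≥0∞}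
    (hf : ∫⁻ ω, f ω ∂P ≠ ⊤) {U : Ω → ℝ} (hU : Measurable U) :
    Tendsto (fun n : ℕ => ∫⁻ ω in {ω | n < U ω}, f ω ∂P) atTop (𝓝 0) := by
  refine tendsto_setLIntegral_zero hf ?_
  have hanti : Antitone fun n : ℕ => {ω | (n : ℝ) < U ω} := fun a b hab ω hω =>
    lt_of_le_of_lt (Nat.cast_le.2 hab) (mem_ofPred.1 hω)
  have hempty : ⋂ n : ℕ, {ω | (n : ℝ) < U ω} = ∅ :=
    eq_empty_of_forall_notMem fun ω hω =>
      let ⟨n, hn⟩ := exists_nat_ge (U ω)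
      hn.not_gt (mem_iInter.1 hω n)
  simpa only [hempty, measure_empty] using tendsto_measure_iInter_atTop (μ := P)
    (fun _ => (measurableSet_lt measurable_const hU).nullMeasurableSet) hanti
    ⟨0, measure_ne_top _ _⟩

theorem rpow_le_rpow_add_rpow {s : ℝ} (hs : 0 < s) (hk₁ : k₁ ≤ α) (hk₂ : α ≤ k₂) :
    s ^ α ≤ s ^ k₁ + s ^ k₂ := by
  rcases le_total s 1 with hs₁ | hs₁
  · exact (Real.rpow_le_rpow_of_exponent_ge hs hs₁ hk₁).trans
      (le_add_of_nonneg_right (Real.rpow_nonneg hs.le _))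
  · exact (Real.rpow_le_rpow_of_exponent_le hs₁ hk₂).trans
      (le_add_of_nonneg_left (Real.rpow_nonneg hs.le _))

theorem exists_one_sub_two_mul_rpow_lt (α : ℝ) {η : ℝ} (hη : 0 < η) :
    ∃ δ : ℝ, 0 < δ ∧ δ < 1 / 2 ∧ (1 - 2 * δ) ^ (-α) < 1 + η := by
  have hcont : ContinuousAt (fun δ : ℝ => (1 - 2 * δ) ^ (-α)) 0 :=
    ContinuousAt.rpow_const (by fun_prop) (Or.inl (by norm_num))
  have hlt : ∀ᶠ δ : ℝ in 𝓝[>] 0, (1 - 2 * δ) ^ (-α) < 1 + η :=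
    nhdsWithin_le_nhds (hcont.eventually_lt continuousAt_const (by simpa using hη))
  obtain ⟨δ, ⟨hδη, hδ⟩, hδ'⟩ := ((hlt.and self_mem_nhdsWithin).and
    (nhdsWithin_le_nhds (Iio_mem_nhds one_half_pos))).exists
  exact ⟨δ, hδ, hδ', hδη⟩

namespace IsDiscountedModel

theorem measurable_discount' (D : IsDiscountedModel m P G θ Y) (i : ℕ) : Measurable (θ i) :=
  (D.measurable_discount i).mono D.le le_rfl

theorem measurableSet_lt_mul (D : IsDiscountedModel m P G θ Y) (i : ℕ) (x : ℝ) :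
    MeasurableSet {ω | x < θ i ω * Y i ω} :=
  measurableSet_lt measurable_const ((D.measurable_discount' i).mul (D.measurable_claim i))

theorem mul_nonneg (D : IsDiscountedModel m P G θ Y) (i : ℕ) (ω : Ω) : 0 ≤ θ i ω * Y i ω :=
  _root_.mul_nonneg (D.discount_pos i ω).le (D.claim_nonneg i ω)

theorem lt_mul_inter_lt_mul_subset (D : IsDiscountedModel m P G θ Y) (i j : ℕ) {n : ℝ} (hn : 0 < n)
    (x : ℝ) :
    {ω | x < θ i ω * Y i ω} ∩ {ω | x < θ j ω * Y j ω} ⊆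
      ({ω | n⁻¹ * x < Y i ω} ∩ {ω | n⁻¹ * x < Y j ω}) ∪
        ({ω | n < max (θ i ω) (θ j ω)} ∩ {ω | x < θ j ω * Y j ω}) := by
  rintro ω ⟨hi, hj⟩
  by_cases hω : n < max (θ i ω) (θ j ω)
  · exact Or.inr ⟨hω, hj⟩
  · have hclaim {l : ℕ} (hl : θ l ω ≤ n) (hx : x < θ l ω * Y l ω) : n⁻¹ * x < Y l ω := by
      rw [inv_mul_lt_iff₀ hn]
      exact hx.trans_le (mul_le_mul_of_nonneg_right hl (D.claim_nonneg l ω))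
    obtain ⟨hθi, hθj⟩ := max_le_iff.1 (not_lt.1 hω)
    exact Or.inl ⟨hclaim hθi hi, hclaim hθj hj⟩

theorem eventually_measure_inter_le [IsFiniteMeasure P] (D : IsDiscountedModel m P G θ Y)
    (h : IsRegVarTail G α) (hTAI : PairwiseTAI P G Y) (M : HasSummableMoments P θ α k₁ k₂)
    {i j : ℕ} (hij : i ≠ j) (hε : ε ≠ 0) :
    ∀ᶠ x in atTop, P ({ω | x < θ i ω * Y i ω} ∩ {ω | x < θ j ω * Y j ω}) ≤
      ε * ENNReal.ofReal (G x) := by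
  have hε₂ : ε / 2 ≠ 0 := by simpa using hε
  set S : ℕ → Set Ω := fun n => {ω | (n : ℝ) < max (θ i ω) (θ j ω)}
  have hSm (n : ℕ) : MeasurableSet[m] (S n) := measurableSet_lt measurable_const
    ((D.measurable_discount i).max (D.measurable_discount j))
  obtain ⟨C, -, hC⟩ := h.eventually_lintegral_le_mul_lintegral (Ω := Ω) M.pos M.lt_index M.index_lt
  have hlim : Tendsto (fun n => ENNReal.ofReal C *
      ∫⁻ ω in S n, ENNReal.ofReal (θ j ω ^ k₁ + θ j ω ^ k₂) ∂P) atTop (𝓝 0) := by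
    have hUm : Measurable fun ω => max (θ i ω) (θ j ω) :=
      (D.measurable_discount' i).max (D.measurable_discount' j)
    simpa only [mul_zero] using ENNReal.Tendsto.const_mul (a := ENNReal.ofReal C)
      (tendsto_setLIntegral_natCast_lt (ENNReal.ne_top_of_tsum_ne_top M.tsum_ne_top j) hUm)
      (Or.inr ENNReal.ofReal_ne_top)
  obtain ⟨n, hn, hn₁⟩ := ((hlim.eventually (ge_mem_nhds (pos_iff_ne_zero.2 hε₂))).and
    (eventually_ge_atTop 1)).exists
  have hn₀ : (0 : ℝ) < n := by exact_mod_cast hn₁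
  obtain ⟨ε', hε', hscale⟩ := h.exists_forall_eventually_comp_mul_le (inv_pos.2 hn₀) hε₂
  filter_upwards [hscale _ (hTAI i j hij ε' hε'), hC, eventually_gt_atTop 0] with x hclaims hC hx
  refine (measure_mono (D.lt_mul_inter_lt_mul_subset i j hn₀ x)).trans ?_
  refine (measure_union_le _ _).trans ?_
  rw [← ENNReal.add_halves ε, add_mul]
  refine add_le_add hclaims ?_
  calc P (S n ∩ {ω | x < θ j ω * Y j ω})
      ≤ ENNReal.ofReal C * ENNReal.ofReal (G x) *
          ∫⁻ ω in S n, ENNReal.ofReal (θ j ω ^ k₁ + θ j ω ^ k₂) ∂P := by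
        rw [D.tail j x _ hx (hSm n)]
        exact hC (P.restrict (S n)) _ (D.discount_pos j)
    _ = (ENNReal.ofReal C * ∫⁻ ω in S n, ENNReal.ofReal (θ j ω ^ k₁ + θ j ω ^ k₂) ∂P) *
          ENNReal.ofReal (G x) := by ring
    _ ≤ ε / 2 * ENNReal.ofReal (G x) := by gcongr

theorem eventually_sum_offDiag_le [IsFiniteMeasure P] (D : IsDiscountedModel m P G θ Y)
    (h : IsRegVarTail G α) (hTAI : PairwiseTAI P G Y) (M : HasSummableMoments P θ α k₁ k₂)
    (s : Finset ℕ) (hε : ε ≠ 0) :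
    ∀ᶠ x in atTop, ∑ p ∈ s.offDiag,
      P ({ω | x < θ p.1 ω * Y p.1 ω} ∩ {ω | x < θ p.2 ω * Y p.2 ω}) ≤
        ε * ENNReal.ofReal (G x) := by
  set N : ℝ≥0∞ := s.offDiag.card + 1
  have hε' : ε / N ≠ 0 := ENNReal.div_ne_zero.2 ⟨hε, by finiteness⟩
  filter_upwards [(Filter.eventually_all_finset s.offDiag).2 fun _ hp =>
    D.eventually_measure_inter_le h hTAI M (Finset.mem_offDiag.1 hp).2.2 hε'] with x hx
  calc _ ≤ ∑ _ ∈ s.offDiag, ε / N * ENNReal.ofReal (G x) := Finset.sum_le_sum hx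
    _ = s.offDiag.card * (ε / N) * ENNReal.ofReal (G x) := by
        rw [Finset.sum_const, nsmul_eq_mul, mul_assoc]
    _ ≤ N * (ε / N) * ENNReal.ofReal (G x) := by
        gcongr
        exact le_self_add
    _ ≤ ε * ENNReal.ofReal (G x) := by
        gcongr
        exact ENNReal.mul_div_le

theorem eventually_measure_inter_lt_mul_le (D : IsDiscountedModel m P G θ Y)
    (h : IsRegVarTail G α) (hk₁ : 0 < k₁) (hk₁α : k₁ < α) (hαk₂ : α < k₂) {η : ℝ} (hη : 0 < η) :
    ∀ᶠ x in atTop, ∀ i S, MeasurableSet[m] S → P (S ∩ {ω | x < θ i ω * Y i ω}) ≤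
      ENNReal.ofReal (G x) * (∫⁻ ω in S, ENNReal.ofReal (θ i ω ^ α) ∂P +
        ENNReal.ofReal η * ∫⁻ ω in S, ENNReal.ofReal (θ i ω ^ k₁ + θ i ω ^ k₂) ∂P) := by
  filter_upwards [h.eventually_lintegral_le (Ω := Ω) hk₁ hk₁α hαk₂ hη,
    eventually_gt_atTop 0] with x hle hx i S hS
  rw [D.tail i x S hx hS]
  exact hle (P.restrict S) _ (D.measurable_discount' i) (D.discount_pos i)

theorem eventually_le_measure_inter_lt_mul (D : IsDiscountedModel m P G θ Y)
    (h : IsRegVarTail G α) (hk₁ : 0 < k₁) (hk₁α : k₁ < α) (hαk₂ : α < k₂) {η : ℝ} (hη : 0 < η) :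
    ∀ᶠ x in atTop, ∀ i S, MeasurableSet[m] S →
      ENNReal.ofReal (G x) * ∫⁻ ω in S, ENNReal.ofReal (θ i ω ^ α) ∂P ≤
        P (S ∩ {ω | x < θ i ω * Y i ω}) + ENNReal.ofReal (G x) *
          (ENNReal.ofReal η * ∫⁻ ω in S, ENNReal.ofReal (θ i ω ^ k₁ + θ i ω ^ k₂) ∂P) := by
  filter_upwards [h.eventually_le_lintegral (Ω := Ω) hk₁ hk₁α hαk₂ hη,
    eventually_gt_atTop 0] with x hle hx i S hS
  rw [D.tail i x S hx hS]
  exact hle (P.restrict S) _ (D.measurable_discount' i) (D.discount_pos i)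

theorem eventually_tsum_measure_inter_lt_mul_le (D : IsDiscountedModel m P G θ Y)
    (h : IsRegVarTail G α) (M : HasSummableMoments P θ α k₁ k₂) (hε : ε ≠ 0) :
    ∀ᶠ x in atTop, ∀ S : ℕ → Set Ω, (∀ i, MeasurableSet[m] (S i)) →
      ∑' i, P (S i ∩ {ω | x < θ i ω * Y i ω}) ≤
        ENNReal.ofReal (G x) * (∑' i, ∫⁻ ω in S i, ENNReal.ofReal (θ i ω ^ α) ∂P + ε) := by
  obtain ⟨η, hη, hηε⟩ := exists_pos_mul_rpow_lt one_pos M.tsum_ne_top hε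
  filter_upwards [D.eventually_measure_inter_lt_mul_le h M.pos M.lt_index M.index_lt hη]
    with x hx S hS
  calc ∑' i, P (S i ∩ {ω | x < θ i ω * Y i ω})
      ≤ ∑' i, ENNReal.ofReal (G x) * (∫⁻ ω in S i, ENNReal.ofReal (θ i ω ^ α) ∂P +
          ENNReal.ofReal η * ∫⁻ ω, ENNReal.ofReal (θ i ω ^ k₁ + θ i ω ^ k₂) ∂P) :=
        ENNReal.tsum_le_tsum fun i => (hx i (S i) (hS i)).trans
          (by gcongr; exact Measure.restrict_le_self)
    _ = ENNReal.ofReal (G x) * (∑' i, ∫⁻ ω in S i, ENNReal.ofReal (θ i ω ^ α) ∂P +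
          ENNReal.ofReal η * ∑' i, ∫⁻ ω, ENNReal.ofReal (θ i ω ^ k₁ + θ i ω ^ k₂) ∂P) := by
        rw [ENNReal.tsum_mul_left, ENNReal.tsum_add, ENNReal.tsum_mul_left]
    _ ≤ ENNReal.ofReal (G x) * (∑' i, ∫⁻ ω in S i, ENNReal.ofReal (θ i ω ^ α) ∂P + ε) := by
        gcongr
        rw [mul_comm]
        simpa using hηε.le

theorem setLIntegral_rpow_le (D : IsDiscountedModel m P G θ Y)
    (hk₁α : k₁ ≤ α) (hαk₂ : α ≤ k₂) (i : ℕ) (S : Set Ω) :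
    ∫⁻ ω in S, ENNReal.ofReal (θ i ω ^ α) ∂P ≤
      ∫⁻ ω in S, ENNReal.ofReal (θ i ω ^ k₁ + θ i ω ^ k₂) ∂P :=
  lintegral_mono fun ω => ENNReal.ofReal_le_ofReal <|
    rpow_le_rpow_add_rpow (D.discount_pos i ω) hk₁α hαk₂

theorem exists_eventually_tsum_measure_inter_lt_mul_le (D : IsDiscountedModel m P G θ Y)
    (h : IsRegVarTail G α) (M : HasSummableMoments P θ α k₁ k₂) (hε : ε ≠ 0) :
    ∃ δ : ℝ, 0 < δ ∧ δ < 1 / 2 ∧ ∀ᶠ x in atTop, ∀ S : ℕ → Set Ω, (∀ i, MeasurableSet[m] (S i)) →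
      ∑' i, P (S i ∩ {ω | (1 - 2 * δ) * x < θ i ω * Y i ω}) ≤
        ENNReal.ofReal (G x) * (∑' i, ∫⁻ ω in S i, ENNReal.ofReal (θ i ω ^ α) ∂P + ε) := by
  set W := ∑' i, ∫⁻ ω, ENNReal.ofReal (θ i ω ^ k₁ + θ i ω ^ k₂) ∂P
  have hε₂ : ε / 2 ≠ 0 := by simpa using hε
  set ε₁ := min (ε / 2) 1
  have hε₁ : ε₁ ≠ 0 := (lt_min (pos_iff_ne_zero.2 hε₂) one_pos).ne'
  obtain ⟨η, hη, hηε⟩ := exists_pos_mul_rpow_lt (K := W + 1) one_pos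
    (ENNReal.add_ne_top.2 ⟨M.tsum_ne_top, ENNReal.one_ne_top⟩) hε₂
  obtain ⟨δ, hδ, hδ', hδη⟩ := exists_one_sub_two_mul_rpow_lt α hη
  have hδ₁ : 0 < 1 - 2 * δ := by linarith
  refine ⟨δ, hδ, hδ', ?_⟩
  filter_upwards [(tendsto_id.const_mul_atTop hδ₁).eventually
    (D.eventually_tsum_measure_inter_lt_mul_le h M hε₁),
    h.eventually_le_mul hδ₁ hδη] with x hx hG S hS
  set I := ∑' i, ∫⁻ ω in S i, ENNReal.ofReal (θ i ω ^ α) ∂P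
  calc ∑' i, P (S i ∩ {ω | (1 - 2 * δ) * x < θ i ω * Y i ω})
      ≤ ENNReal.ofReal (G ((1 - 2 * δ) * x)) * (I + ε₁) := hx S hS
    _ ≤ ((1 + ENNReal.ofReal η) * ENNReal.ofReal (G x)) * (I + ε₁) := by
        gcongr
        rw [← ENNReal.ofReal_one, ← ENNReal.ofReal_add zero_le_one hη.le,
          ← ENNReal.ofReal_mul (by positivity)]
        exact ENNReal.ofReal_le_ofReal hG
    _ = ENNReal.ofReal (G x) * (I + (ε₁ + (I + ε₁) * ENNReal.ofReal η)) := by ring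
    _ ≤ ENNReal.ofReal (G x) * (I + (ε / 2 + (W + 1) * ENNReal.ofReal η)) := by
        gcongr
        · exact min_le_left _ _
        · exact ENNReal.tsum_le_tsum fun i =>
            (D.setLIntegral_rpow_le M.lt_index.le M.index_lt.le i (S i)).trans
              (setLIntegral_le_lintegral _ _)
        · exact min_le_right _ _
    _ ≤ ENNReal.ofReal (G x) * (I + (ε / 2 + ε / 2)) := by
        gcongr
        simpa using hηε.le
    _ = ENNReal.ofReal (G x) * (I + ε) := by rw [ENNReal.add_halves]

theorem eventually_measure_lt_tsum_indicator_le [IsFiniteMeasure P]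
    (D : IsDiscountedModel m P G θ Y) (h : IsRegVarTail G α) (hTAI : PairwiseTAI P G Y)
    (hneg : HasNegligibleTails P G fun i ω => ENNReal.ofReal (θ i ω * Y i ω))
    (M : HasSummableMoments P θ α k₁ k₂) (hε : ε ≠ 0) :
    ∀ᶠ x in atTop, ∀ S : ℕ → Set Ω, (∀ i, MeasurableSet[m] (S i)) →
      P {ω | ENNReal.ofReal x <
          ∑' i, ENNReal.ofReal ((S i).indicator (fun ω => θ i ω * Y i ω) ω)} ≤
        ENNReal.ofReal (G x) *
          (∑' i, ∫⁻ ω in S i, ENNReal.ofReal (θ i ω ^ α) ∂P + ε) := by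
  have hε₃ : ε / 3 ≠ 0 := by simpa using hε
  obtain ⟨δ, hδ, hδ', hsingle⟩ := D.exists_eventually_tsum_measure_inter_lt_mul_le h M hε₃
  obtain ⟨ε₁, hε₁, htailScale⟩ := h.exists_forall_eventually_comp_mul_le hδ hε₃
  obtain ⟨n, htail⟩ := hneg ε₁ hε₁
  have hδn : 0 < δ / (n + 1) := by positivity
  obtain ⟨ε₂, hε₂, hpairScale⟩ := h.exists_forall_eventually_comp_mul_le hδn hε₃
  filter_upwards [hsingle, htailScale _ htail, eventually_gt_atTop 0,
    hpairScale _ (D.eventually_sum_offDiag_le h hTAI M (Finset.range n) hε₂)]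
    with x hsingle htail hx hpair S hS
  set g := ENNReal.ofReal (G x)
  set I := ∑' i, ∫⁻ ω in S i, ENNReal.ofReal (θ i ω ^ α) ∂P
  have hδx : 0 ≤ (1 - 2 * δ) * x := _root_.mul_nonneg (by linarith) hx.le
  have hsplit := setOf_lt_tsum_indicator_subset (b := fun i ω => θ i ω * Y i ω) D.mul_nonneg
    hδx (mul_pos hδ hx) n S
  rw [show (1 - 2 * δ) * x + δ * x + δ * x = x by ring, mul_div_right_comm] at hsplit
  calc _ ≤ _ := measure_mono hsplit
    _ ≤ g * (I + ε / 3) + (ε / 3 * g + ε / 3 * g) := by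
        refine (measure_union_le _ _).trans (add_le_add ?_
          ((measure_union_le _ _).trans (add_le_add ?_ htail)))
        · exact (measure_iUnion_le _).trans (hsingle S hS)
        · exact (measure_biUnion_finset_le _ _).trans hpair
    _ = g * (I + (ε / 3 + ε / 3 + ε / 3)) := by ring
    _ = g * (I + ε) := by rw [ENNReal.add_thirds]

theorem eventually_le_measure_iUnion_inter_lt_mul [IsFiniteMeasure P]
    (D : IsDiscountedModel m P G θ Y) (h : IsRegVarTail G α) (hTAI : PairwiseTAI P G Y)
    (M : HasSummableMoments P θ α k₁ k₂) (hε : ε ≠ 0) :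
    ∀ᶠ x in atTop, ∀ S : ℕ → Set Ω, (∀ i, MeasurableSet[m] (S i)) →
      ENNReal.ofReal (G x) * ∑' i, ∫⁻ ω in S i, ENNReal.ofReal (θ i ω ^ α) ∂P ≤
        P (⋃ i, S i ∩ {ω | x < θ i ω * Y i ω}) + ENNReal.ofReal (G x) * ε := by
  have hε₃ : ε / 3 ≠ 0 := by simpa using hε
  obtain ⟨η, hη, hηε⟩ := exists_pos_mul_rpow_lt one_pos M.tsum_ne_top hε₃
  obtain ⟨n, hn⟩ := exists_tsum_nat_add_le M.tsum_ne_top hε₃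
  filter_upwards [D.eventually_le_measure_inter_lt_mul h M.pos M.lt_index M.index_lt hη,
    D.eventually_sum_offDiag_le h hTAI M (Finset.range n) hε₃] with x hsingle hpair S hS
  set g := ENNReal.ofReal (G x)
  set I : ℕ → ℝ≥0∞ := fun i => ∫⁻ ω in S i, ENNReal.ofReal (θ i ω ^ α) ∂P
  set A : ℕ → Set Ω := fun i => S i ∩ {ω | x < θ i ω * Y i ω}
  have hAm (i : ℕ) : MeasurableSet (A i) := (D.le _ (hS i)).inter (D.measurableSet_lt_mul i x)
  have hhead : ∑ i ∈ Finset.range n, g * I i ≤ ∑ i ∈ Finset.range n, P (A i) + g * (ε / 3) := by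
    refine (Finset.sum_le_sum fun i _ => hsingle i (S i) (hS i)).trans ?_
    rw [Finset.sum_add_distrib, ← Finset.mul_sum, ← Finset.mul_sum]
    gcongr
    rw [Real.rpow_one, mul_comm] at hηε
    refine (mul_le_mul_right ?_ _).trans hηε.le
    exact (ENNReal.sum_le_tsum _).trans
      (ENNReal.tsum_le_tsum fun i => setLIntegral_le_lintegral _ _)
  have hunion : ∑ i ∈ Finset.range n, P (A i) ≤ P (⋃ i, A i) + g * (ε / 3) := by
    refine (sum_measure_le_measure_biUnion_add hAm (Finset.range n)).trans (add_le_add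
      (measure_mono (iUnion₂_subset fun i _ => subset_iUnion A i)) ?_)
    rw [mul_comm]
    exact (Finset.sum_le_sum fun _ _ => measure_mono
      (inter_subset_inter inter_subset_right inter_subset_right)).trans hpair
  have htail : ∑' i, I (i + n) ≤ ε / 3 :=
    (ENNReal.tsum_le_tsum fun i =>
      (D.setLIntegral_rpow_le M.lt_index.le M.index_lt.le (i + n) (S (i + n))).trans
        (setLIntegral_le_lintegral _ _)).trans hn
  calc g * ∑' i, I i = ∑ i ∈ Finset.range n, g * I i + g * ∑' i, I (i + n) := by
        rw [← ENNReal.summable.sum_add_tsum_nat_add' (f := I) (k := n), mul_add, Finset.mul_sum]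
    _ ≤ ((P (⋃ i, A i) + g * (ε / 3)) + g * (ε / 3)) + g * (ε / 3) := by
        gcongr
        exact hhead.trans (by gcongr)
    _ = P (⋃ i, A i) + g * (ε / 3 + ε / 3 + ε / 3) := by ring
    _ = P (⋃ i, A i) + g * ε := by rw [ENNReal.add_thirds]

end IsDiscountedModel

end DiscountedModel

section SmallTimes

theorem pow_succ_mul_pow_max_le {r q : ℝ≥0∞} (hr : 1 ≤ r) (hrq : r * q ≤ 2⁻¹) (i : ℕ) :
    r ^ (i + 1) * q ^ (max i 1 + 1) ≤ 2 * r ^ 2 * q ^ 2 * 2⁻¹ ^ i := by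
  rcases i with _ | n
  · calc r ^ (0 + 1) * q ^ (max 0 1 + 1) = 1 * (1 * r) * q ^ 2 := by simp
      _ ≤ 2 * (r * r) * q ^ 2 := by gcongr; norm_num
      _ = 2 * r ^ 2 * q ^ 2 * 2⁻¹ ^ 0 := by ring
  · have htwo : (2 : ℝ≥0∞) * 2⁻¹ = 1 := ENNReal.mul_inv_cancel (by simp) (by simp)
    rw [max_eq_left (by omega)]
    calc r ^ (n + 1 + 1) * q ^ (n + 1 + 1) = r ^ 2 * q ^ 2 * (r * q) ^ n := by ring
      _ ≤ r ^ 2 * q ^ 2 * 2⁻¹ ^ n := by gcongr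
      _ = 2 * 2⁻¹ * (r ^ 2 * q ^ 2 * 2⁻¹ ^ n) := by rw [htwo, one_mul]
      _ = 2 * r ^ 2 * q ^ 2 * 2⁻¹ ^ (n + 1) := by ring

theorem exists_div_two_pow_lt_of_lt_tsum {b : ℕ → ℝ} {x : ℝ} (hx : 0 ≤ x)
    (h : ENNReal.ofReal x < ∑' i, ENNReal.ofReal (b i)) : ∃ i, x / 2 ^ (i + 1) < b i := by
  by_contra! hcon
  refine h.not_ge ?_
  calc ∑' i, ENNReal.ofReal (b i) ≤ ∑' i, ENNReal.ofReal (x / 2 / 2 ^ i) := by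
        refine ENNReal.tsum_le_tsum fun i => ENNReal.ofReal_le_ofReal ((hcon i).trans_eq ?_)
        rw [pow_succ', div_div]
    _ = ENNReal.ofReal (∑' i : ℕ, x / 2 / 2 ^ i) :=
        (ENNReal.ofReal_tsum_of_nonneg (fun i => by positivity) (summable_geometric_two' x)).symm
    _ = ENNReal.ofReal x := by rw [tsum_geometric_two']

theorem setOf_lt_tsum_indicator_subset_of_antitone {Ω : Type*} {b : ℕ → Ω → ℝ} {x : ℝ}
    (hx : 0 ≤ x) {S : ℕ → Set Ω} (hS : Antitone S) :
    {ω | ENNReal.ofReal x < ∑' i, ENNReal.ofReal ((S i).indicator (b i) ω)} ⊆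
      (S 0 ∩ {ω | x < b 0 ω}) ∪ ⋃ i, S (max i 1) ∩ {ω | x / 2 ^ (i + 1) < b i ω} := by
  have hmem {i : ℕ} {y : ℝ} {ω : Ω} (hy : 0 ≤ y) (h : y < (S i).indicator (b i) ω) :
      ω ∈ S i ∩ {ω | y < b i ω} := by
    have hω : ω ∈ S i := mem_of_indicator_ne_zero (hy.trans_lt h).ne'
    exact ⟨hω, by simpa [hω] using h⟩
  intro ω hω
  by_cases hω₁ : ω ∈ S 1
  · obtain ⟨i, hi⟩ := exists_div_two_pow_lt_of_lt_tsum hx hω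
    obtain ⟨hiS, hib⟩ := hmem (by positivity) hi
    refine Or.inr (mem_iUnion.2 ⟨i, ?_, hib⟩)
    rcases max_choice i 1 with hmax | hmax <;> rwa [hmax]
  · have hzero (i : ℕ) (hi : i ≠ 0) : ENNReal.ofReal ((S i).indicator (b i) ω) = 0 := by
      rw [indicator_of_notMem fun h => hω₁ (hS (Nat.one_le_iff_ne_zero.2 hi) h),
        ENNReal.ofReal_zero]
    rw [mem_ofPred, tsum_eq_single 0 hzero, ENNReal.ofReal_lt_ofReal_iff_of_nonneg hx] at hω
    exact Or.inl (hmem hx hω)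

variable {Ω : Type*} {m : MeasurableSpace Ω} [mΩ : MeasurableSpace Ω] {P : Measure Ω}
  {G : ℝ → ℝ} {α k₁ k₂ : ℝ} {θ Y : ℕ → Ω → ℝ} {ε K : ℝ≥0∞}

/-- The properties of the events `S i = {Tᵢ ≤ t}` that are used for small times `t`: their
probabilities decay geometrically in `i`, and the discount factors have moments of orders `k₁` and
`k₂` bounded by `K` conditionally on any of the events that occur later. -/
structure IsGeometricFamily {Ω : Type*} (m : MeasurableSpace Ω) [MeasurableSpace Ω]
    (P : Measure Ω) (θ : ℕ → Ω → ℝ) (k₁ k₂ : ℝ) (K : ℝ≥0∞) (S : ℕ → Set Ω) : Prop where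
  measurableSet : ∀ i, MeasurableSet[m] (S i)
  antitone : Antitone S
  measure_le_pow : ∀ i, P (S i) ≤ P (S 0) ^ (i + 1)
  setLIntegral_le : ∀ i j, i ≤ j →
    ∫⁻ ω in S j, ENNReal.ofReal (θ i ω ^ k₁ + θ i ω ^ k₂) ∂P ≤ K * P (S j)

namespace IsDiscountedModel

theorem exists_eventually_measure_inter_div_lt_mul_le (D : IsDiscountedModel m P G θ Y)
    (h : IsRegVarTail G α) (hk₁ : 0 < k₁) (hk₁α : k₁ < α) (hαk₂ : α < k₂) :
    ∃ C : ℝ, ∀ᶠ x in atTop, ∀ i S, MeasurableSet[m] S → ∀ u ≥ 1,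
      P (S ∩ {ω | x / u < θ i ω * Y i ω}) ≤ ENNReal.ofReal C * ENNReal.ofReal (G x) *
        (ENNReal.ofReal (u ^ k₂) *
          ∫⁻ ω in S, ENNReal.ofReal (θ i ω ^ k₁ + θ i ω ^ k₂) ∂P) := by
  obtain ⟨C, -, hC⟩ := h.eventually_lintegral_le_mul_lintegral (Ω := Ω) hk₁ hk₁α hαk₂
  refine ⟨C, ?_⟩
  filter_upwards [hC, eventually_gt_atTop 0] with x hC hx i S hS u hu
  have hu₀ : 0 < u := one_pos.trans_le hu
  have huk : u ^ k₁ ≤ u ^ k₂ := Real.rpow_le_rpow_of_exponent_le hu (hk₁α.trans hαk₂).le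
  rw [D.tail i _ S (by positivity) hS]
  simp only [div_div]
  refine (hC (P.restrict S) (fun ω => u * θ i ω) fun ω => mul_pos hu₀ (D.discount_pos i ω)).trans ?_
  gcongr
  rw [← lintegral_const_mul' _ _ ENNReal.ofReal_ne_top]
  refine lintegral_mono fun ω => ?_
  have hθ : 0 < θ i ω := D.discount_pos i ω
  rw [← ENNReal.ofReal_mul (by positivity), Real.mul_rpow hu₀.le hθ.le,
    Real.mul_rpow hu₀.le hθ.le, mul_add]
  gcongr

theorem exists_eventually_tsum_measure_inter_div_two_pow_lt_mul_le
    (D : IsDiscountedModel m P G θ Y) (h : IsRegVarTail G α) (hk₁ : 0 < k₁) (hk₁α : k₁ < α)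
    (hαk₂ : α < k₂) (hK : K ≠ ⊤) :
    ∃ C ≠ ⊤, ∀ᶠ x in atTop, ∀ S, IsGeometricFamily m P θ k₁ k₂ K S →
      ENNReal.ofReal (2 ^ k₂) * P (S 0) ≤ 2⁻¹ →
      ∑' i, P (S (max i 1) ∩ {ω | x / 2 ^ (i + 1) < θ i ω * Y i ω}) ≤
        ENNReal.ofReal (G x) * (C * P (S 0) ^ 2) := by
  obtain ⟨C, hC⟩ := D.exists_eventually_measure_inter_div_lt_mul_le h hk₁ hk₁α hαk₂
  set r := ENNReal.ofReal (2 ^ k₂)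
  have hr : 1 ≤ r := ENNReal.one_le_ofReal.2 <|
    Real.one_le_rpow one_le_two (hk₁.trans (hk₁α.trans hαk₂)).le
  refine ⟨ENNReal.ofReal C * K * (2 * r ^ 2) * 2, by finiteness, ?_⟩
  filter_upwards [hC] with x hC S hS hsmall
  set q := P (S 0)
  have hpow (i : ℕ) : ENNReal.ofReal ((2 ^ (i + 1)) ^ k₂) = r ^ (i + 1) := by
    rw [← ENNReal.ofReal_pow (by positivity), ← Real.rpow_natCast, ← Real.rpow_natCast,
      ← Real.rpow_mul two_pos.le, ← Real.rpow_mul two_pos.le, mul_comm]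
  have hterm (i : ℕ) : P (S (max i 1) ∩ {ω | x / 2 ^ (i + 1) < θ i ω * Y i ω}) ≤
      ENNReal.ofReal C * ENNReal.ofReal (G x) * K * (2 * r ^ 2 * q ^ 2 * 2⁻¹ ^ i) := by
    calc P (S (max i 1) ∩ {ω | x / 2 ^ (i + 1) < θ i ω * Y i ω})
        ≤ ENNReal.ofReal C * ENNReal.ofReal (G x) * (r ^ (i + 1) *
            ∫⁻ ω in S (max i 1), ENNReal.ofReal (θ i ω ^ k₁ + θ i ω ^ k₂) ∂P) := by
          rw [← hpow]
          exact hC i _ (hS.measurableSet _) _ (one_le_pow₀ one_le_two)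
      _ ≤ ENNReal.ofReal C * ENNReal.ofReal (G x) *
            (r ^ (i + 1) * (K * q ^ (max i 1 + 1))) := by
          gcongr
          exact (hS.setLIntegral_le i _ (le_max_left i 1)).trans
            (mul_le_mul_right (hS.measure_le_pow _) K)
      _ = ENNReal.ofReal C * ENNReal.ofReal (G x) * K *
            (r ^ (i + 1) * q ^ (max i 1 + 1)) := by ring
      _ ≤ _ := mul_le_mul_right (pow_succ_mul_pow_max_le hr hsmall i) _
  refine (ENNReal.tsum_le_tsum hterm).trans_eq ?_
  rw [ENNReal.tsum_mul_left, ENNReal.tsum_mul_left, ENNReal.tsum_geometric,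
    ENNReal.one_sub_inv_two, inv_inv]
  ring

theorem exists_eventually_measure_lt_tsum_indicator_le_of_small (D : IsDiscountedModel m P G θ Y)
    (h : IsRegVarTail G α) (hk₁ : 0 < k₁) (hk₁α : k₁ < α) (hαk₂ : α < k₂) (hK : K ≠ ⊤)
    (hε : ε ≠ 0) :
    ∃ q ≠ 0, ∀ᶠ x in atTop, ∀ S, IsGeometricFamily m P θ k₁ k₂ K S → P (S 0) ≤ q →
      P {ω | ENNReal.ofReal x <
          ∑' i, ENNReal.ofReal ((S i).indicator (fun ω => θ i ω * Y i ω) ω)} ≤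
        ENNReal.ofReal (G x) *
          (∑' i, ∫⁻ ω in S i, ENNReal.ofReal (θ i ω ^ α) ∂P + ε * P (S 0)) := by
  have hε₂ : ε / 2 ≠ 0 := by simpa using hε
  obtain ⟨C, hC, hrest⟩ := D.exists_eventually_tsum_measure_inter_div_two_pow_lt_mul_le h
    hk₁ hk₁α hαk₂ hK
  obtain ⟨η, hη, hηε⟩ := exists_pos_mul_rpow_lt one_pos hK hε₂
  obtain ⟨a, ha, haε⟩ := exists_pos_mul_rpow_lt one_pos hC hε₂
  obtain ⟨b, hb, hbε⟩ := exists_pos_mul_rpow_lt (K := ENNReal.ofReal (2 ^ k₂)) (ε := 2⁻¹) one_pos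
    ENNReal.ofReal_ne_top (by simp)
  rw [Real.rpow_one] at hηε haε hbε
  refine ⟨min (ENNReal.ofReal a) (ENNReal.ofReal b), by simp [ha, hb], ?_⟩
  filter_upwards [hrest, D.eventually_measure_inter_lt_mul_le h hk₁ hk₁α hαk₂ hη,
    eventually_gt_atTop 0] with x hrest hfirst hx S hS hq
  set g := ENNReal.ofReal (G x)
  set q := P (S 0)
  set I : ℕ → ℝ≥0∞ := fun i => ∫⁻ ω in S i, ENNReal.ofReal (θ i ω ^ α) ∂P
  obtain ⟨hqa, hqb⟩ := le_min_iff.1 hq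
  calc _ ≤ _ := measure_mono (setOf_lt_tsum_indicator_subset_of_antitone hx.le hS.antitone)
    _ ≤ g * (I 0 + ENNReal.ofReal η * (K * q)) + g * (C * q ^ 2) := by
        refine (measure_union_le _ _).trans (add_le_add ?_ ((measure_iUnion_le _).trans ?_))
        · refine (hfirst 0 _ (hS.measurableSet 0)).trans ?_
          gcongr
          exact hS.setLIntegral_le 0 0 le_rfl
        · exact hrest S hS ((mul_le_mul_right hqb _).trans hbε.le)
    _ = g * (I 0 + (K * ENNReal.ofReal η * q + C * q * q)) := by ring
    _ ≤ g * (∑' i, I i + (ε / 2 * q + ε / 2 * q)) := by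
        gcongr
        · exact ENNReal.le_tsum 0
        · exact (mul_le_mul_right hqa C).trans haε.le
    _ = g * (∑' i, I i + ε * q) := by rw [← add_mul, ENNReal.add_halves]

theorem tsum_setLIntegral_succ_le (D : IsDiscountedModel m P G θ Y) (hk₁α : k₁ ≤ α)
    (hαk₂ : α ≤ k₂) (hS : IsGeometricFamily m P θ k₁ k₂ K S) (hq : P (S 0) ≤ 2⁻¹) :
    ∑' i, ∫⁻ ω in S (i + 1), ENNReal.ofReal (θ (i + 1) ω ^ α) ∂P ≤
      2 * K * P (S 0) * P (S 0) := by
  set q := P (S 0)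
  calc ∑' i, ∫⁻ ω in S (i + 1), ENNReal.ofReal (θ (i + 1) ω ^ α) ∂P
      ≤ ∑' i : ℕ, K * (q * q * 2⁻¹ ^ i) := by
        refine ENNReal.tsum_le_tsum fun i => ?_
        calc ∫⁻ ω in S (i + 1), ENNReal.ofReal (θ (i + 1) ω ^ α) ∂P
            ≤ K * P (S (i + 1)) := (D.setLIntegral_rpow_le hk₁α hαk₂ _ _).trans
              (hS.setLIntegral_le (i + 1) (i + 1) le_rfl)
          _ ≤ K * q ^ (i + 1 + 1) := mul_le_mul_right (hS.measure_le_pow _) K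
          _ = K * (q * q * q ^ i) := by ring
          _ ≤ K * (q * q * 2⁻¹ ^ i) := by gcongr
    _ = 2 * K * q * q := by
        rw [ENNReal.tsum_mul_left, ENNReal.tsum_mul_left, ENNReal.tsum_geometric,
          ENNReal.one_sub_inv_two, inv_inv]
        ring

theorem exists_eventually_le_measure_iUnion_inter_lt_mul_of_small
    (D : IsDiscountedModel m P G θ Y) (h : IsRegVarTail G α) (hk₁ : 0 < k₁) (hk₁α : k₁ < α)
    (hαk₂ : α < k₂) (hK : K ≠ ⊤) (hε : ε ≠ 0) :
    ∃ q ≠ 0, ∀ᶠ x in atTop, ∀ S, IsGeometricFamily m P θ k₁ k₂ K S → P (S 0) ≤ q →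
      ENNReal.ofReal (G x) * ∑' i, ∫⁻ ω in S i, ENNReal.ofReal (θ i ω ^ α) ∂P ≤
        P (⋃ i, S i ∩ {ω | x < θ i ω * Y i ω}) + ENNReal.ofReal (G x) * (ε * P (S 0)) := by
  have hε₂ : ε / 2 ≠ 0 := by simpa using hε
  obtain ⟨η, hη, hηε⟩ := exists_pos_mul_rpow_lt one_pos hK hε₂
  obtain ⟨a, ha, haε⟩ := exists_pos_mul_rpow_lt (K := 2 * K) one_pos (by finiteness) hε₂
  rw [Real.rpow_one] at hηε haε
  refine ⟨min (ENNReal.ofReal a) 2⁻¹, by simp [ha], ?_⟩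
  filter_upwards [D.eventually_le_measure_inter_lt_mul h hk₁ hk₁α hαk₂ hη] with x hfirst S hS hq
  set g := ENNReal.ofReal (G x)
  set q := P (S 0)
  set I : ℕ → ℝ≥0∞ := fun i => ∫⁻ ω in S i, ENNReal.ofReal (θ i ω ^ α) ∂P
  obtain ⟨hqa, hq₂⟩ := le_min_iff.1 hq
  have hrest : ∑' i, I (i + 1) ≤ ε / 2 * q := by
    refine (D.tsum_setLIntegral_succ_le hk₁α.le hαk₂.le hS hq₂).trans ?_
    gcongr
    exact (mul_le_mul_right hqa _).trans haε.le
  have hηK : ENNReal.ofReal η * ∫⁻ ω in S 0, ENNReal.ofReal (θ 0 ω ^ k₁ + θ 0 ω ^ k₂) ∂P ≤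
      ε / 2 * q := by
    calc _ ≤ ENNReal.ofReal η * (K * q) := mul_le_mul_right (hS.setLIntegral_le 0 0 le_rfl) _
      _ = K * ENNReal.ofReal η * q := by ring
      _ ≤ ε / 2 * q := by gcongr
  calc g * ∑' i, I i = g * I 0 + g * ∑' i, I (i + 1) := by
        rw [tsum_eq_zero_add' ENNReal.summable, mul_add]
    _ ≤ P (S 0 ∩ {ω | x < θ 0 ω * Y 0 ω}) + g * (ε / 2 * q) + g * (ε / 2 * q) := by
        gcongr
        exact (hfirst 0 _ (hS.measurableSet 0)).trans (by gcongr)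
    _ ≤ P (⋃ i, S i ∩ {ω | x < θ i ω * Y i ω}) + g * (ε / 2 * q) + g * (ε / 2 * q) := by
        gcongr
        exact subset_iUnion (fun i => S i ∩ {ω | x < θ i ω * Y i ω}) 0
    _ = P (⋃ i, S i ∩ {ω | x < θ i ω * Y i ω}) + g * ((ε / 2 + ε / 2) * q) := by ring
    _ = P (⋃ i, S i ∩ {ω | x < θ i ω * Y i ω}) + g * (ε * q) := by rw [ENNReal.add_halves]

end IsDiscountedModel

end SmallTimes

section RareSets

variable {d : ℕ} {A : Set (Fin d → ℝ)} {x : ℝ}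

namespace IsRareSet

theorem compl_mem_nhds (hA : IsRareSet A) : Aᶜ ∈ 𝓝 (0 : Fin d → ℝ) :=
  mem_of_superset (isClosed_closure.isOpen_compl.mem_nhds hA.zero_notMem_closure)
    (compl_subset_compl.2 subset_closure)

theorem continuous_gauge (hA : IsRareSet A) : Continuous (gauge Aᶜ) :=
  _root_.continuous_gauge hA.convex_compl hA.compl_mem_nhds

theorem one_lt_gauge_iff (hA : IsRareSet A) {v : Fin d → ℝ} : 1 < gauge Aᶜ v ↔ v ∈ A := by
  rw [← not_le, gauge_le_one_iff_mem_closure hA.convex_compl hA.compl_mem_nhds,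
    hA.isOpen.isClosed_compl.closure_eq, notMem_compl_iff]

theorem mem_smul_iff (hA : IsRareSet A) (hx : 0 < x) {v : Fin d → ℝ} :
    v ∈ x • A ↔ x < gauge Aᶜ v := by
  rw [mem_smul_set_iff_inv_smul_mem₀ hx.ne', ← hA.one_lt_gauge_iff,
    gauge_smul_of_nonneg (inv_nonneg.2 hx.le), smul_eq_mul, ← div_eq_inv_mul, one_lt_div hx]

theorem nonneg_of_mem_smul (hA : IsRareSet A) {v : Fin d → ℝ} (hv : 0 ≤ v) (h : v ∈ x • A) :
    0 ≤ x := by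
  by_contra! hx
  rw [mem_smul_set_iff_inv_smul_mem₀ hx.ne] at h
  have hzero : (0 : Fin d → ℝ) ∈ A := by
    simpa using hA.increasing _ h (-x⁻¹ • v)
      (smul_nonneg (neg_nonneg.2 (inv_nonpos.2 hx.le)) hv)
  exact hA.zero_notMem_closure (subset_closure hzero)

theorem rareLevel_eq_gauge (hA : IsRareSet A) {v : Fin d → ℝ} (hv : 0 ≤ v) :
    rareLevel A v = gauge Aᶜ v := by
  have hsubset : {u : ℝ | v ∈ u • A} ⊆ Icc 0 (gauge Aᶜ v) := fun u hu => by
    have hu₀ : 0 ≤ u := hA.nonneg_of_mem_smul hv hu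
    rcases hu₀.eq_or_lt with rfl | hu₀
    · exact ⟨le_rfl, gauge_nonneg v⟩
    · exact ⟨hu₀.le, ((hA.mem_smul_iff hu₀).1 hu).le⟩
  have hsuperset : Ioo 0 (gauge Aᶜ v) ⊆ {u : ℝ | v ∈ u • A} :=
    fun u hu => (hA.mem_smul_iff hu.1).2 hu.2
  rcases (gauge_nonneg (s := Aᶜ) v).eq_or_lt with hzero | hpos
  · rw [← hzero, Icc_self, subset_singleton_iff_eq] at hsubset
    rw [rareLevel, ← hzero]
    rcases hsubset with h | h <;> simp [h]
  · exact ((isLUB_Ioo hpos).of_subset_of_superset (isLUB_Icc hpos.le) hsuperset hsubset).csSup_eq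
      ((nonempty_Ioo.2 hpos).mono hsuperset)

theorem lt_tsum_of_tsum_mem (hA : IsRareSet A) (hx : 0 < x) {v : ℕ → Fin d → ℝ}
    (hv : Summable v) (h : ∑' i, v i ∈ x • A) :
    ENNReal.ofReal x < ∑' i, ENNReal.ofReal (gauge Aᶜ (v i)) := by
  by_contra! hle
  refine ((hA.mem_smul_iff hx).1 h).not_ge (le_of_tendsto
    ((hA.continuous_gauge.tendsto _).comp hv.hasSum) (Eventually.of_forall fun s => ?_))
  refine (gauge_sum_le hA.convex_compl (absorbent_nhds_zero hA.compl_mem_nhds) s v).trans ?_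
  rw [← ENNReal.ofReal_le_ofReal_iff hx.le, ENNReal.ofReal_sum_of_nonneg fun i _ => gauge_nonneg _]
  exact (ENNReal.sum_le_tsum s).trans hle

theorem tsum_mem_of_lt (hA : IsRareSet A) (hx : 0 < x) {v : ℕ → Fin d → ℝ} (hv : Summable v)
    (hv₀ : ∀ i, 0 ≤ v i) {i : ℕ} (hi : x < gauge Aᶜ (v i)) : ∑' i, v i ∈ x • A := by
  rw [← hA.mem_smul_iff hx, mem_smul_set_iff_inv_smul_mem₀ hx.ne'] at hi
  rw [mem_smul_set_iff_inv_smul_mem₀ hx.ne']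
  have hrest : 0 ≤ x⁻¹ • (∑' j, v j - v i) :=
    smul_nonneg (inv_nonneg.2 hx.le) (sub_nonneg.2 (hv.le_tsum i fun j _ => hv₀ j))
  simpa only [← smul_add, add_sub_cancel] using hA.increasing _ hi _ hrest

end IsRareSet

end RareSets

section MultivariateRegularVariation

variable {d : ℕ} {F : Measure (Fin d → ℝ)} {α : ℝ} {V : Measure ℝ} {ν : Measure (Fin d → ℝ)}
  {φ : (Fin d → ℝ) → ℝ}

/-- Continuous, positively homogeneous functions of degree one: the functionals under which
multivariate regular variation becomes one-dimensional. The two examples that matter are the norm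
and the gauge of the complement of a rare set. -/
structure IsHomogeneousFunctional {d : ℕ} (φ : (Fin d → ℝ) → ℝ) : Prop where
  continuous : Continuous φ
  map_smul : ∀ c v, 0 ≤ c → φ (c • v) = c * φ v

theorem isHomogeneousFunctional_norm : IsHomogeneousFunctional fun v : Fin d → ℝ => ‖v‖ where
  continuous := continuous_norm
  map_smul c v hc := by rw [norm_smul, Real.norm_of_nonneg hc]

theorem IsRareSet.isHomogeneousFunctional_gauge {A : Set (Fin d → ℝ)} (hA : IsRareSet A) :
    IsHomogeneousFunctional (gauge Aᶜ) where
  continuous := hA.continuous_gauge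
  map_smul c v hc := by rw [gauge_smul_of_nonneg hc, smul_eq_mul]

namespace IsHomogeneousFunctional

theorem map_zero (hφ : IsHomogeneousFunctional φ) : φ 0 = 0 := by
  simpa using hφ.map_smul 0 0 le_rfl

theorem exists_le_mul_norm (hφ : IsHomogeneousFunctional φ) :
    ∃ R : ℝ, 0 < R ∧ ∀ v, φ v ≤ R * ‖v‖ := by
  obtain ⟨R, hR⟩ :=
    (isCompact_closedBall (0 : Fin d → ℝ) 1).bddAbove_image hφ.continuous.continuousOn
  refine ⟨max R 1, by positivity, fun v => ?_⟩
  rcases eq_or_ne v 0 with rfl | hv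
  · simp [hφ.map_zero]
  have hv₀ : 0 < ‖v‖ := norm_pos_iff.2 hv
  have hunit : φ (‖v‖⁻¹ • v) ≤ max R 1 :=
    (hR (mem_image_of_mem φ (by simp [norm_smul, hv₀.ne']))).trans (le_max_left _ _)
  rwa [hφ.map_smul _ _ (by positivity), inv_mul_le_iff₀ hv₀, mul_comm] at hunit

theorem smul_setOf_lt (hφ : IsHomogeneousFunctional φ) (s : ℝ) {x : ℝ} (hx : 0 < x) :
    x • {v | s < φ v} = {v | s * x < φ v} := by
  ext v
  rw [mem_smul_set_iff_inv_smul_mem₀ hx.ne', mem_ofPred, mem_ofPred,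
    hφ.map_smul _ _ (inv_nonneg.2 hx.le), ← div_eq_inv_mul, lt_div_iff₀ hx]

theorem zero_notMem_closure_setOf_lt (hφ : IsHomogeneousFunctional φ) {s : ℝ} (hs : 0 < s) :
    (0 : Fin d → ℝ) ∉ closure {v | s < φ v} := fun h => by
  have hle : s ≤ φ 0 := closure_minimal (fun _ => le_of_lt)
    (isClosed_le continuous_const hφ.continuous) h
  exact (hφ.map_zero ▸ hle).not_gt hs

end IsHomogeneousFunctional

theorem exists_lt_measure_setOf_lt_ne_zero {E : Type*} [MeasurableSpace E] {μ : Measure E}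
    {f : E → ℝ} {a : ℝ} (h : μ {v | a < f v} ≠ 0) : ∃ b > a, μ {v | b < f v} ≠ 0 := by
  obtain ⟨u, -, hu, hlim⟩ := exists_seq_strictAnti_tendsto a
  by_contra! hnull
  refine h (measure_mono_null (fun v hv => ?_) (measure_iUnion_null fun n => hnull (u n) (hu n)))
  obtain ⟨n, hn⟩ := (hlim.eventually (gt_mem_nhds hv)).exists
  exact mem_iUnion.2 ⟨n, hn⟩

theorem IsRegVar.real_Ioi_ne_zero {V : Measure ℝ} [IsFiniteMeasure V] (hV : IsRegVar V α) (x : ℝ) :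
    V.real (Ioi x) ≠ 0 := fun hx => by
  have hlim : Tendsto (fun y => V.real (Ioi y) / V.real (Ioi y)) atTop (𝓝 1) := by
    simpa using hV 1 one_pos
  obtain ⟨y, hxy, hy⟩ :=
    ((eventually_ge_atTop x).and (hlim.eventually_ne one_ne_zero)).exists
  have hVy : V.real (Ioi y) = 0 :=
    le_antisymm ((measureReal_mono (Ioi_subset_Ioi hxy)).trans hx.le) measureReal_nonneg
  simp [hVy] at hy

theorem IsRegVar.tendsto_div_of_tendsto_div {V : Measure ℝ} [IsFiniteMeasure V]
    (hV : IsRegVar V α) {f : ℝ → ℝ} {s c : ℝ} (hs : 0 < s) (hc : c ≠ 0)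
    (hf : Tendsto (fun x => f (s * x) / V.real (Ioi x)) atTop (𝓝 c)) {t : ℝ} (ht : 0 < t) :
    Tendsto (fun x => f (t * x) / f x) atTop (𝓝 (t ^ (-α))) := by
  have hdiv : Tendsto (fun x : ℝ => x / s) atTop atTop := tendsto_id.atTop_div_const hs
  have hlim := ((hf.comp (hdiv.const_mul_atTop ht)).mul ((hV t ht).comp hdiv)).div
    (hf.comp hdiv) hc
  rw [mul_div_cancel_left₀ _ hc] at hlim
  refine hlim.congr fun x => ?_
  have hts : s * (t * (x / s)) = t * x := by field_simp
  have hss : s * (x / s) = x := by field_simp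
  simp only [Pi.div_apply, Function.comp_apply, hts, hss]
  rw [div_mul_div_cancel₀ (hV.real_Ioi_ne_zero _),
    div_div_div_cancel_right₀ (hV.real_Ioi_ne_zero _)]

theorem IsRegVarTail.exists_forall_le_mul {G f : ℝ → ℝ} (h : IsRegVarTail G α)
    (hf : ∀ x, f x ≤ 1) {C : ℝ} (hC : ∀ᶠ x in atTop, f x ≤ C * G x) :
    ∃ K : ℝ, ∀ x, f x ≤ K * G x := by
  obtain ⟨x₀, hx₀⟩ := eventually_atTop.1 hC
  refine ⟨max C (G x₀)⁻¹, fun x => ?_⟩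
  have hGx : 0 ≤ G x := h.nonneg x
  rcases le_total x₀ x with hx | hx
  · exact (hx₀ x hx).trans (mul_le_mul_of_nonneg_right (le_max_left _ _) hGx)
  · have hG₀ : 0 < G x₀ := h.pos x₀
    calc f x ≤ 1 := hf x
      _ ≤ (G x₀)⁻¹ * G x := by
        rw [inv_mul_eq_div, one_le_div hG₀]
        exact h.antitone hx
      _ ≤ max C (G x₀)⁻¹ * G x := mul_le_mul_of_nonneg_right (le_max_right _ _) hGx

namespace IsMRV

theorem measure_setOf_le_lt_top (hF : IsMRV F α V ν) (hφ : IsHomogeneousFunctional φ) {s : ℝ}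
    (hs : 0 < s) : ν {v | s ≤ φ v} < ⊤ := by
  obtain ⟨R, hR, hφR⟩ := hφ.exists_le_mul_norm
  refine (measure_mono fun v (hv : s ≤ φ v) => ?_).trans_lt (hF.finite_away (s / R) (by positivity))
  exact (div_le_iff₀' hR).2 (hv.trans (hφR v))

theorem measure_setOf_lt_ne_top (hF : IsMRV F α V ν) (hφ : IsHomogeneousFunctional φ) {s : ℝ}
    (hs : 0 < s) : ν {v | s < φ v} ≠ ⊤ :=
  ((measure_mono fun v (hv : s < φ v) => hv.le).trans_lt (hF.measure_setOf_le_lt_top hφ hs)).ne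

theorem exists_measure_setOf_eq_eq_zero (hF : IsMRV F α V ν) (hφ : IsHomogeneousFunctional φ)
    {a b : ℝ} (ha : 0 < a) (hab : a < b) : ∃ s ∈ Ioo a b, ν {v | φ v = s} = 0 := by
  have hfin : IsFiniteMeasure (ν.restrict {v | a ≤ φ v}) :=
    isFiniteMeasure_restrict.2 (hF.measure_setOf_le_lt_top hφ ha).ne
  have hφm : Measurable φ := hφ.continuous.measurable
  obtain ⟨s, hs, has, hsb⟩ := ((Measure.countable_meas_level_set_pos
    (μ := ν.restrict {v | a ≤ φ v}) hφm).dense_compl ℝ).exists_between hab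
  rw [mem_compl_iff, mem_ofPred, not_lt, nonpos_iff_eq_zero,
    Measure.restrict_apply (measurableSet_eq_fun hφm measurable_const)] at hs
  exact ⟨s, ⟨has, hsb⟩, measure_mono_null (t := {v | φ v = s} ∩ {v | a ≤ φ v})
    (fun v (hv : φ v = s) => ⟨hv, has.le.trans_eq hv.symm⟩) hs⟩

theorem exists_tendsto_div (hF : IsMRV F α V ν) (hφ : IsHomogeneousFunctional φ) {a b : ℝ}
    (ha : 0 < a) (hab : a < b) :
    ∃ s ∈ Ioo a b, Tendsto (fun x : ℝ => F.real {v | s * x < φ v} / V.real (Ioi x)) atTop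
      (𝓝 (ν.real {v | s < φ v})) := by
  obtain ⟨s, hs, hnull⟩ := hF.exists_measure_setOf_eq_eq_zero hφ ha hab
  have hs₀ : 0 < s := ha.trans hs.1
  have hfrontier : ν (frontier {v | s < φ v}) = 0 := measure_mono_null
    (fun v hv => (frontier_lt_subset_eq continuous_const hφ.continuous hv).symm) hnull
  have hlim := (ENNReal.tendsto_toReal (hF.measure_setOf_lt_ne_top hφ hs₀)).comp
    (hF.tendsto {v | s < φ v} (measurableSet_lt measurable_const hφ.continuous.measurable)
      (hφ.zero_notMem_closure_setOf_lt hs₀) hfrontier)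
  refine ⟨s, hs, hlim.congr' ?_⟩
  filter_upwards [eventually_gt_atTop 0] with x hx
  rw [Function.comp_apply, hφ.smul_setOf_lt s hx, ENNReal.toReal_div]
  rfl

theorem exists_tendsto_div_pos (hF : IsMRV F α V ν) (hφ : IsHomogeneousFunctional φ)
    (hpos : ν {v | 1 < φ v} ≠ 0) :
    ∃ s > 1, ∃ c > 0,
      Tendsto (fun x : ℝ => F.real {v | s * x < φ v} / V.real (Ioi x)) atTop (𝓝 c) := by
  obtain ⟨b, hb₁, hb⟩ := exists_lt_measure_setOf_lt_ne_zero hpos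
  obtain ⟨s, ⟨hs₁, hsb⟩, hlim⟩ := hF.exists_tendsto_div hφ one_pos hb₁
  refine ⟨s, hs₁, _, ENNReal.toReal_pos ?_ ?_, hlim⟩
  · exact fun h => hb (measure_mono_null (fun v (hv : b < φ v) => hsb.trans hv) h)
  · exact hF.measure_setOf_lt_ne_top hφ (one_pos.trans hs₁)

theorem isRegVarTail [IsProbabilityMeasure F] (hF : IsMRV F α V ν)
    (hφ : IsHomogeneousFunctional φ) (hpos : ν {v | 1 < φ v} ≠ 0) :
    IsRegVarTail (fun x => F.real {v | x < φ v}) α := by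
  have := hF.isProbabilityMeasure
  obtain ⟨s, hs, c, hc, hlim⟩ := hF.exists_tendsto_div_pos hφ hpos
  exact
    { index_pos := hF.index_pos
      antitone := fun x y hxy => measureReal_mono fun v (hv : y < φ v) => hxy.trans_lt hv
      nonneg := fun _ => measureReal_nonneg
      le_one := fun _ => measureReal_le_one
      tendsto := fun t ht =>
        hF.regVar.tendsto_div_of_tendsto_div (f := fun x => F.real {v | x < φ v})
          (one_pos.trans hs) hc.ne' hlim ht }

theorem exists_norm_tail_le [IsProbabilityMeasure F] (hF : IsMRV F α V ν)
    (hφ : IsHomogeneousFunctional φ) (hpos : ν {v | 1 < φ v} ≠ 0) :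
    ∃ K : ℝ, ∀ x, F.real {v | x < ‖v‖} ≤ K * F.real {v | x < φ v} := by
  have := hF.isProbabilityMeasure
  have hreg : IsRegVarTail (fun x => F.real {v | x < φ v}) α := hF.isRegVarTail hφ hpos
  obtain ⟨s, hs, c, hc, hlim⟩ := hF.exists_tendsto_div_pos hφ hpos
  obtain ⟨r, ⟨-, hr⟩, hlim'⟩ := hF.exists_tendsto_div isHomogeneousFunctional_norm
    one_half_pos one_half_lt_one
  have hs₀ : 0 < s := one_pos.trans hs
  have hratio := (hlim'.div hlim hc.ne').comp (tendsto_id.atTop_div_const hs₀)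
  refine hreg.exists_forall_le_mul (fun _ => measureReal_le_one) 
    (C := ν.real {v | r < ‖v‖} / c + 1) ?_
  filter_upwards [hratio.eventually (ge_mem_nhds (lt_add_one _)), eventually_gt_atTop 0]
    with x hx hx₀
  have hle : r * (x / s) ≤ x := by
    calc r * (x / s) ≤ s * (x / s) := by gcongr; exact hr.le.trans hs.le
      _ = x := by field_simp
  simp only [Function.comp_apply, id_eq, Pi.div_apply,
    div_div_div_cancel_right₀ (hF.regVar.real_Ioi_ne_zero _), mul_div_cancel₀ x hs₀.ne'] at hx
  rw [div_le_iff₀ (hreg.pos x)] at hx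
  exact (measureReal_mono fun v (hv : x < ‖v‖) => hle.trans_lt hv).trans hx

end IsMRV

end MultivariateRegularVariation

section Independence

theorem setLIntegral_comp_prodMk_of_indepFun {Ω E E' : Type*} [MeasurableSpace Ω]
    [MeasurableSpace E] [MeasurableSpace E'] {P : Measure Ω} [IsFiniteMeasure P] {U : Ω → E}
    {V : Ω → E'} (hU : Measurable U) (hV : Measurable V) (hUV : IndepFun U V P)
    {f : E × E' → ℝ≥0∞} (hf : Measurable f) {B : Set E} (hB : MeasurableSet B) :
    ∫⁻ ω in U ⁻¹' B, f (U ω, V ω) ∂P = ∫⁻ ω in U ⁻¹' B, ∫⁻ ω', f (U ω, V ω') ∂P ∂P := by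
  have hmap := (indepFun_iff_map_prod_eq_prod_map_map hU.aemeasurable hV.aemeasurable).1 hUV
  have hBm : MeasurableSet (B ×ˢ (univ : Set E')) := hB.prod .univ
  calc ∫⁻ ω in U ⁻¹' B, f (U ω, V ω) ∂P
      = ∫⁻ p in B ×ˢ univ, f p ∂(P.map fun ω => (U ω, V ω)) := by
        rw [setLIntegral_map hBm hf (hU.prodMk hV), mk_preimage_prod, preimage_univ, inter_univ]
    _ = ∫⁻ u in B, ∫⁻ v, f (u, v) ∂(P.map V) ∂(P.map U) := by
        rw [hmap, setLIntegral_prod f hf.aemeasurable, Measure.restrict_univ]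
    _ = ∫⁻ ω in U ⁻¹' B, ∫⁻ ω', f (U ω, V ω') ∂P ∂P := by
        rw [setLIntegral_map hB hf.lintegral_prod_right' hU]
        exact lintegral_congr fun ω => lintegral_map (hf.comp measurable_prodMk_left) hV

theorem setLIntegral_prodMk_of_indep {Ω : Type*} {m₁ m₂ : MeasurableSpace Ω}
    [mΩ : MeasurableSpace Ω] {P : Measure Ω} [IsFiniteMeasure P] (hm₁ : m₁ ≤ mΩ) (hm₂ : m₂ ≤ mΩ)
    (h : Indep m₁ m₂ P) {f : Ω × Ω → ℝ≥0∞} (hf : Measurable[m₁.prod m₂] f) {S : Set Ω}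
    (hS : MeasurableSet[m₁] S) :
    ∫⁻ ω in S, f (ω, ω) ∂P = ∫⁻ ω in S, ∫⁻ ω', f (ω, ω') ∂P ∂P := by
  have hid : @IndepFun Ω Ω Ω mΩ m₁ m₂ id id P := by
    change Indep (m₁.comap id) (m₂.comap id) P
    rwa [MeasurableSpace.comap_id, MeasurableSpace.comap_id]
  exact @setLIntegral_comp_prodMk_of_indepFun Ω Ω Ω mΩ m₁ m₂ P _ id id (measurable_id'' hm₁)
    (measurable_id'' hm₂) hid f hf S hS

theorem tendsto_floor_mul_add_one_div (t : ℝ≥0) :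
    Tendsto (fun n : ℕ => ((⌊t * (n + 1)⌋₊ : ℝ≥0) + 1) / (n + 1)) atTop (𝓝[≥] t) := by
  have hle (n : ℕ) : t ≤ (⌊t * (n + 1)⌋₊ + 1) / (n + 1) := by
    rw [le_div_iff₀ (by positivity)]
    exact (Nat.lt_floor_add_one _).le
  have hge (n : ℕ) : ((⌊t * (n + 1)⌋₊ : ℝ≥0) + 1) / (n + 1) ≤ t + 1 / (n + 1) := by
    rw [add_div]
    gcongr
    rw [div_le_iff₀ (by positivity)]
    exact Nat.floor_le zero_le
  have hlim : Tendsto (fun n : ℕ => t + 1 / ((n : ℝ≥0) + 1)) atTop (𝓝 t) := by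
    simpa using (tendsto_one_div_add_atTop_nhds_zero_nat (𝕜 := ℝ≥0)).const_add t
  exact tendsto_nhdsWithin_iff.2
    ⟨tendsto_of_tendsto_of_tendsto_of_le_of_le tendsto_const_nhds hlim hle hge, .of_forall hle⟩

theorem measurable_uncurry_of_rightContinuous {Ω : Type*} [MeasurableSpace Ω]
    {ξ : ℝ≥0 → Ω → ℝ} (hm : ∀ t, Measurable (ξ t))
    (hrc : ∀ ω t, ContinuousWithinAt (fun s => ξ s ω) (Ici t) t) :
    Measurable fun p : ℝ≥0 × Ω => ξ p.1 p.2 := by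
  have hcount {N : ℝ≥0 × Ω → ℕ} (hN : Measurable N) (grid : ℕ → ℝ≥0) :
      Measurable fun p : ℝ≥0 × Ω => ξ (grid (N p)) p.2 := by
    have h : Measurable fun q : ℕ × Ω => ξ (grid q.1) q.2 :=
      measurable_from_prod_countable_right fun k => hm (grid k)
    exact h.comp (hN.prodMk measurable_snd)
  have happrox (n : ℕ) :
      Measurable fun p : ℝ≥0 × Ω => ξ ((⌊p.1 * (n + 1)⌋₊ + 1) / (n + 1)) p.2 :=
    hcount (Nat.measurable_floor.comp (measurable_fst.mul_const ((n : ℝ≥0) + 1)))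
      fun k => (k + 1) / (n + 1)
  refine measurable_of_tendsto_metrizable happrox (tendsto_pi_nhds.2 fun p => ?_)
  exact (hrc p.2 p.1).tendsto.comp (tendsto_floor_mul_add_one_div p.1)

theorem measure_inter_lt_mul_eq_of_indep {Ω : Type*} {m : MeasurableSpace Ω}
    [mΩ : MeasurableSpace Ω] {P : Measure Ω} [IsFiniteMeasure P] (hm : m ≤ mΩ) {θ Y : Ω → ℝ}
    (hθm : Measurable[m] θ) (hθ : ∀ ω, 0 < θ ω) (hY : Measurable Y)
    (h : Indep m (MeasurableSpace.comap Y inferInstance) P) (x : ℝ) {S : Set Ω}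
    (hS : MeasurableSet[m] S) :
    P (S ∩ {ω | x < θ ω * Y ω}) = ∫⁻ ω in S, P {ω' | x / θ ω < Y ω'} ∂P := by
  have hB : MeasurableSet[m.prod (MeasurableSpace.comap Y inferInstance)]
      {p : Ω × Ω | x < θ p.1 * Y p.2} :=
    measurableSet_lt measurable_const
      ((hθm.comp measurable_fst).mul ((comap_measurable Y).comp measurable_snd))
  have hA : MeasurableSet {ω | x < θ ω * Y ω} :=
    measurableSet_lt measurable_const ((hθm.mono hm le_rfl).mul hY)
  calc P (S ∩ {ω | x < θ ω * Y ω})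
      = ∫⁻ ω in S, {ω | x < θ ω * Y ω}.indicator 1 ω ∂P := by
        rw [inter_comm, ← Measure.restrict_apply hA, ← lintegral_indicator_one hA]
    _ = ∫⁻ ω in S, ∫⁻ ω', {ω' | x < θ ω * Y ω'}.indicator 1 ω' ∂P ∂P :=
        setLIntegral_prodMk_of_indep hm hY.comap_le h
          ((measurable_const (a := (1 : ℝ≥0∞))).indicator hB) hS
    _ = ∫⁻ ω in S, P {ω' | x / θ ω < Y ω'} ∂P := by
        refine lintegral_congr fun ω => ?_
        simp only [div_lt_iff₀' (hθ ω)]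
        exact lintegral_indicator_one (measurableSet_lt measurable_const (hY.const_mul _))

theorem measure_setOf_lt_comp_eq {Ω E : Type*} [MeasurableSpace Ω] [MeasurableSpace E]
    {P : Measure Ω} [IsFiniteMeasure P] {F : Measure E} {X : Ω → E} (hX : Measurable X)
    (hF : P.map X = F) {φ : E → ℝ} (hφ : Measurable φ) (x : ℝ) :
    P {ω | x < φ (X ω)} = ENNReal.ofReal (F.real {v | x < φ v}) := by
  have hF' : IsFiniteMeasure F := hF ▸ inferInstance
  rw [ofReal_measureReal, ← hF, Measure.map_apply hX (measurableSet_lt measurable_const hφ)]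
  rfl

end Independence

section Discount

/-- A real process with right-continuous paths. -/
structure IsRightContinuousProcess {Ω : Type*} [MeasurableSpace Ω] (ξ : ℝ≥0 → Ω → ℝ) : Prop where
  measurable : ∀ t, Measurable (ξ t)
  right_continuous : ∀ ω t, ContinuousWithinAt (fun s => ξ s ω) (Ici t) t

theorem IsCadlagProcess.isRightContinuousProcess {Ω : Type*} [MeasurableSpace Ω]
    {ξ : ℝ≥0 → Ω → ℝ} (hξ : IsCadlagProcess ξ) : IsRightContinuousProcess ξ :=
  ⟨hξ.measurable, hξ.right_continuous⟩

variable {Ω : Type*}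

/-- The σ-algebra generated by the arrival times. -/
@[reducible]
def arrivalSigma (T : ℕ → Ω → ℝ≥0) : MeasurableSpace Ω :=
  MeasurableSpace.comap (fun ω i => T i ω) inferInstance

/-- The σ-algebra generated by the return process. -/
@[reducible]
def returnSigma (ξ : ℝ≥0 → Ω → ℝ) : MeasurableSpace Ω :=
  MeasurableSpace.comap (fun ω t => ξ t ω) inferInstance

/-- The σ-algebra generated by the arrival times and the return process. -/
@[reducible]
def discountSigma (T : ℕ → Ω → ℝ≥0) (ξ : ℝ≥0 → Ω → ℝ) : MeasurableSpace Ω :=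
  arrivalSigma T ⊔ returnSigma ξ

/-- The discount factor `e^{-ξ(Tᵢ)}` at the `i`-th arrival time. -/
noncomputable def discountFactor (T : ℕ → Ω → ℝ≥0) (ξ : ℝ≥0 → Ω → ℝ) (i : ℕ) (ω : Ω) : ℝ :=
  Real.exp (-ξ (T i ω) ω)

variable {T : ℕ → Ω → ℝ≥0} {ξ : ℝ≥0 → Ω → ℝ}

theorem discountFactor_pos (i : ℕ) (ω : Ω) : 0 < discountFactor T ξ i ω := Real.exp_pos _

theorem discountFactor_rpow (i : ℕ) (ω : Ω) (k : ℝ) :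
    discountFactor T ξ i ω ^ k = Real.exp (-k * ξ (T i ω) ω) := by
  rw [discountFactor, ← Real.exp_mul]
  ring_nf

theorem measurable_arrivalSigma (i : ℕ) : Measurable[arrivalSigma T] (T i) :=
  (measurable_pi_apply i).comp (comap_measurable fun ω i => T i ω)

theorem measurableSet_arrival_le (i : ℕ) (t : ℝ≥0∞) :
    MeasurableSet[arrivalSigma T] {ω | (T i ω : ℝ≥0∞) ≤ t} :=
  measurable_arrivalSigma i
    (measurableSet_le measurable_coe_nnreal_ennreal measurable_const :
      MeasurableSet {s : ℝ≥0 | (s : ℝ≥0∞) ≤ t})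

theorem arrivalSigma_le_discountSigma : arrivalSigma T ≤ discountSigma T ξ :=
  le_sup_left

theorem measurable_returnSigma (t : ℝ≥0) : Measurable[returnSigma ξ] (ξ t) :=
  (measurable_pi_apply t).comp (comap_measurable fun ω t => ξ t ω)

variable [mΩ : MeasurableSpace Ω] {P : Measure Ω}

theorem posMoment_discountFactor (k : ℝ) (i : ℕ) :
    posMoment P (discountFactor T ξ i) k = discountMoment P ξ k (T i) := by
  simp only [posMoment, discountFactor_rpow, discountMoment]

theorem arrivalSigma_le (hT : ∀ i, Measurable (T i)) : arrivalSigma T ≤ mΩ :=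
  (measurable_pi_iff.2 hT).comap_le

namespace IsRightContinuousProcess

theorem returnSigma_le (hξ : IsRightContinuousProcess ξ) : returnSigma ξ ≤ mΩ :=
  (measurable_pi_iff.2 hξ.measurable).comap_le

theorem discountSigma_le (hξ : IsRightContinuousProcess ξ) (hT : ∀ i, Measurable (T i)) :
    discountSigma T ξ ≤ mΩ :=
  sup_le (arrivalSigma_le hT) hξ.returnSigma_le

theorem measurable_uncurry (hξ : IsRightContinuousProcess ξ) :
    Measurable[(inferInstance : MeasurableSpace ℝ≥0).prod (returnSigma ξ)]
      fun p : ℝ≥0 × Ω => ξ p.1 p.2 :=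
  @measurable_uncurry_of_rightContinuous Ω (returnSigma ξ) ξ measurable_returnSigma
    hξ.right_continuous

theorem measurable_exp_mul_arrival (hξ : IsRightContinuousProcess ξ) (c : ℝ) (i : ℕ) :
    Measurable[(arrivalSigma T).prod (returnSigma ξ)]
      fun p : Ω × Ω => Real.exp (c * ξ (T i p.1) p.2) :=
  Real.measurable_exp.comp ((hξ.measurable_uncurry.comp
    (((measurable_arrivalSigma i).comp measurable_fst).prodMk measurable_snd)).const_mul c)

theorem measurable_discountFactor (hξ : IsRightContinuousProcess ξ) (i : ℕ) :
    Measurable[discountSigma T ξ] (discountFactor T ξ i) := by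
  have hcomp := @Measurable.comp _ _ _ (discountSigma T ξ) _ _ _ (fun ω : Ω => (ω, ω))
    (hξ.measurable_exp_mul_arrival (T := T) (-1) i)
    ((measurable_id'' le_sup_left).prodMk (measurable_id'' le_sup_right))
  change Measurable[discountSigma T ξ] fun ω => Real.exp (-ξ (T i ω) ω)
  simpa only [Function.comp_def, neg_one_mul] using hcomp

theorem measurable_discountMoment [SFinite P] (hξ : IsRightContinuousProcess ξ) (k : ℝ) :
    Measurable fun s : ℝ≥0 => discountMoment P ξ k fun _ => s := by
  have hexp : Measurable fun p : ℝ≥0 × Ω => ENNReal.ofReal (Real.exp (-k * ξ p.1 p.2)) :=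
    ENNReal.measurable_ofReal.comp (Real.measurable_exp.comp (Measurable.const_mul
      (measurable_uncurry_of_rightContinuous hξ.measurable hξ.right_continuous) _))
  exact hexp.lintegral_prod_right'

end IsRightContinuousProcess

namespace IndepIngredients

variable {d : ℕ} {X : ℕ → Ω → Fin d → ℝ}

theorem indep_claims (h : IndepIngredients P X T ξ) (hX : ∀ i, Measurable (X i))
    (hT : ∀ i, Measurable (T i)) (hξ : IsRightContinuousProcess ξ) (i : ℕ) :
    Indep (discountSigma T ξ) (MeasurableSpace.comap (X i) inferInstance) P := by
  have hle : ∀ j : Fin 3, ![MeasurableSpace.comap (fun ω i => X i ω) inferInstance,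
      arrivalSigma T, returnSigma ξ] j ≤ mΩ :=
    Fin.forall_fin_succ.2 ⟨(measurable_pi_iff.2 hX).comap_le,
      Fin.forall_fin_two.2 ⟨arrivalSigma_le hT, hξ.returnSigma_le⟩⟩
  have hall := indep_iSup_of_disjoint hle h (S := {1, 2}) (T := {0}) (by simp)
  rw [iSup_insert, iSup_singleton, iSup_singleton] at hall
  refine indep_of_indep_of_le_right hall (Measurable.comap_le ?_)
  exact (measurable_pi_apply i).comp (comap_measurable fun ω i => X i ω)

theorem indep_times (h : IndepIngredients P X T ξ) : Indep (arrivalSigma T) (returnSigma ξ) P :=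
  iIndep.indep h (i := 1) (j := 2) (by decide)

theorem isDiscountedModel [IsFiniteMeasure P] (hind : IndepIngredients P X T ξ)
    (hX : ∀ i, Measurable (X i)) (hT : ∀ i, Measurable (T i)) (hξ : IsRightContinuousProcess ξ)
    {F : Measure (Fin d → ℝ)} (hF : ∀ i, P.map (X i) = F) {φ : (Fin d → ℝ) → ℝ}
    (hφ : Measurable φ) (hφ₀ : ∀ v, 0 ≤ φ v) :
    IsDiscountedModel (discountSigma T ξ) P (fun x => F.real {v | x < φ v})
      (discountFactor T ξ) (fun i ω => φ (X i ω)) where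
  le := hξ.discountSigma_le hT
  measurable_discount := hξ.measurable_discountFactor
  discount_pos := discountFactor_pos
  measurable_claim i := hφ.comp (hX i)
  claim_nonneg _ _ := hφ₀ _
  tail i x S _ hS := by
    have hindep : Indep (discountSigma T ξ)
        (MeasurableSpace.comap (fun ω => φ (X i ω)) inferInstance) P :=
      indep_of_indep_of_le_right (hind.indep_claims hX hT hξ i)
        (hφ.comp (comap_measurable (X i))).comap_le
    simp only [← measure_setOf_lt_comp_eq (hX i) (hF i) hφ]
    exact measure_inter_lt_mul_eq_of_indep (hξ.discountSigma_le hT)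
      (hξ.measurable_discountFactor i) (discountFactor_pos i) (hφ.comp (hX i)) hindep x hS

theorem setLIntegral_discountFactor [IsFiniteMeasure P] (hind : IndepIngredients P X T ξ)
    (hT : ∀ i, Measurable (T i)) (hξ : IsRightContinuousProcess ξ) {S : Set Ω}
    (hS : MeasurableSet[arrivalSigma T] S) (k : ℝ) (i : ℕ) :
    ∫⁻ ω in S, ENNReal.ofReal (discountFactor T ξ i ω ^ k) ∂P =
      ∫⁻ ω in S, discountMoment P ξ k (fun _ => T i ω) ∂P := by
  have hf : Measurable[(arrivalSigma T).prod (returnSigma ξ)]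
      fun p : Ω × Ω => ENNReal.ofReal (Real.exp (-k * ξ (T i p.1) p.2)) :=
    ENNReal.measurable_ofReal.comp (hξ.measurable_exp_mul_arrival (-k) i)
  simp only [discountFactor_rpow, discountMoment]
  exact setLIntegral_prodMk_of_indep (arrivalSigma_le hT) hξ.returnSigma_le hind.indep_times hf hS

theorem discountIntegral_eq_tsum [IsFiniteMeasure P] (hind : IndepIngredients P X T ξ)
    (hT : ∀ i, Measurable (T i)) (hξ : IsRightContinuousProcess ξ) (α : ℝ) (t : ℝ≥0∞) :
    discountIntegral P T ξ α t =
      ∑' i, ∫⁻ ω in {ω | (T i ω : ℝ≥0∞) ≤ t}, ENNReal.ofReal (discountFactor T ξ i ω ^ α) ∂P := by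
  have hS : MeasurableSet {s : ℝ≥0 | (s : ℝ≥0∞) ≤ t} :=
    measurableSet_le measurable_coe_nnreal_ennreal measurable_const
  rw [discountIntegral, renewalMeasure, Measure.restrict_sum _ hS, lintegral_sum_measure]
  congr with i
  rw [setLIntegral_map hS (hξ.measurable_discountMoment α) (hT i)]
  exact (hind.setLIntegral_discountFactor hT hξ (measurable_arrivalSigma i hS) α i).symm

end IndepIngredients

end Discount

section RelativeError

theorem abs_toReal_div_sub_one_le {p Δ : ℝ≥0∞} {g ε : ℝ} (hg : 0 < g) (hε : 0 ≤ ε) (hp : p ≠ ⊤)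
    (hΔ₀ : Δ ≠ 0) (hΔ : Δ ≠ ⊤)
    (hup : p ≤ ENNReal.ofReal g * (Δ + ENNReal.ofReal ε * Δ))
    (hlow : ENNReal.ofReal g * Δ ≤ p + ENNReal.ofReal g * (ENNReal.ofReal ε * Δ)) :
    |p.toReal / (g * Δ.toReal) - 1| ≤ ε := by
  lift p to ℝ≥0 using hp
  lift Δ to ℝ≥0 using hΔ
  lift g to ℝ≥0 using hg.le
  lift ε to ℝ≥0 using hε
  simp only [ENNReal.ofReal_coe_nnreal, ENNReal.coe_toReal] at *
  norm_cast at hup hlow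
  have hpos : (0 : ℝ) < g * Δ :=
    mul_pos hg (NNReal.coe_pos.2 (by simpa [pos_iff_ne_zero] using hΔ₀))
  have hup' : (p : ℝ) ≤ g * (Δ + ε * Δ) := mod_cast hup
  have hlow' : (g : ℝ) * Δ ≤ p + g * (ε * Δ) := mod_cast hlow
  rw [div_sub_one hpos.ne', abs_div, abs_of_pos hpos, div_le_iff₀ hpos, abs_le]
  constructor <;> linarith [hup', hlow']

namespace IsDiscountedModel

variable {Ω : Type*} {m : MeasurableSpace Ω} [mΩ : MeasurableSpace Ω] {P : Measure Ω}
  {G : ℝ → ℝ} {α k₁ k₂ : ℝ} {θ Y : ℕ → Ω → ℝ} {c K : ℝ≥0∞} {ε : ℝ}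

theorem tsum_setLIntegral_ne_top (D : IsDiscountedModel m P G θ Y)
    (M : HasSummableMoments P θ α k₁ k₂) (S : ℕ → Set Ω) :
    ∑' i, ∫⁻ ω in S i, ENNReal.ofReal (θ i ω ^ α) ∂P ≠ ⊤ :=
  ne_top_of_le_ne_top M.tsum_ne_top (ENNReal.tsum_le_tsum fun i =>
    (D.setLIntegral_rpow_le M.lt_index.le M.index_lt.le i (S i)).trans
      (setLIntegral_le_lintegral _ _))

theorem setLIntegral_rpow_ne_zero (D : IsDiscountedModel m P G θ Y) {S : Set Ω} (hS : P S ≠ 0)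
    (α : ℝ) (i : ℕ) : ∫⁻ ω in S, ENNReal.ofReal (θ i ω ^ α) ∂P ≠ 0 := by
  have hm : Measurable fun ω => ENNReal.ofReal (θ i ω ^ α) :=
    (((D.measurable_discount i).mono D.le le_rfl).pow_const α).ennreal_ofReal
  have hsupport : Function.support (fun ω => ENNReal.ofReal (θ i ω ^ α)) = univ :=
    eq_univ_of_forall fun ω => by simpa using Real.rpow_pos_of_pos (D.discount_pos i ω) α
  rw [← pos_iff_ne_zero, setLIntegral_pos_iff hm, hsupport, univ_inter, pos_iff_ne_zero]
  exact hS

theorem eventually_abs_div_sub_one_le [IsFiniteMeasure P] (D : IsDiscountedModel m P G θ Y)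
    (h : IsRegVarTail G α) (hTAI : PairwiseTAI P G Y)
    (hneg : HasNegligibleTails P G fun i ω => ENNReal.ofReal (θ i ω * Y i ω))
    (M : HasSummableMoments P θ α k₁ k₂) (hc : c ≠ 0) (hε : 0 < ε) :
    ∀ᶠ x in atTop, ∀ (S : ℕ → Set Ω) (E : Set Ω), (∀ i, MeasurableSet[m] (S i)) →
      c ≤ ∑' i, ∫⁻ ω in S i, ENNReal.ofReal (θ i ω ^ α) ∂P →
      P (⋃ i, S i ∩ {ω | x < θ i ω * Y i ω}) ≤ P E →
      P E ≤ P {ω | ENNReal.ofReal x <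
        ∑' i, ENNReal.ofReal ((S i).indicator (fun ω => θ i ω * Y i ω) ω)} →
      |P.real E / (G x * (∑' i, ∫⁻ ω in S i, ENNReal.ofReal (θ i ω ^ α) ∂P).toReal) - 1| ≤ ε := by
  have hεc : ENNReal.ofReal ε * c ≠ 0 := mul_ne_zero (by simpa using hε) hc
  filter_upwards [D.eventually_measure_lt_tsum_indicator_le h hTAI hneg M hεc,
    D.eventually_le_measure_iUnion_inter_lt_mul h hTAI M hεc] with x hup hlow S E hS hcS hES hEsum
  refine abs_toReal_div_sub_one_le (h.pos x) hε.le (measure_ne_top _ _)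
    ((pos_iff_ne_zero.2 hc).trans_le hcS).ne' (D.tsum_setLIntegral_ne_top M S) ?_ ?_
  · refine hEsum.trans ((hup S hS).trans ?_)
    gcongr
  · refine (hlow S hS).trans ?_
    gcongr

theorem exists_eventually_abs_div_sub_one_le_of_small [IsFiniteMeasure P]
    (D : IsDiscountedModel m P G θ Y) (h : IsRegVarTail G α) (hk₁ : 0 < k₁) (hk₁α : k₁ < α)
    (hαk₂ : α < k₂) (hK : K ≠ ⊤) (hc : c ≠ 0) (hε : 0 < ε) :
    ∃ q ≠ 0, ∀ᶠ x in atTop, ∀ (S : ℕ → Set Ω) (E : Set Ω),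
      IsGeometricFamily m P θ k₁ k₂ K S → P (S 0) ≤ q → P (S 0) ≠ 0 →
      c * P (S 0) ≤ ∫⁻ ω in S 0, ENNReal.ofReal (θ 0 ω ^ α) ∂P →
      ∑' i, ∫⁻ ω in S i, ENNReal.ofReal (θ i ω ^ α) ∂P ≠ ⊤ →
      P (⋃ i, S i ∩ {ω | x < θ i ω * Y i ω}) ≤ P E →
      P E ≤ P {ω | ENNReal.ofReal x <
        ∑' i, ENNReal.ofReal ((S i).indicator (fun ω => θ i ω * Y i ω) ω)} →
      |P.real E / (G x * (∑' i, ∫⁻ ω in S i, ENNReal.ofReal (θ i ω ^ α) ∂P).toReal) - 1| ≤ ε := by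
  have hεc : ENNReal.ofReal ε * c ≠ 0 := mul_ne_zero (by simpa using hε) hc
  obtain ⟨q, hq, hup⟩ := D.exists_eventually_measure_lt_tsum_indicator_le_of_small h
    hk₁ hk₁α hαk₂ hK hεc
  obtain ⟨r, hr, hlow⟩ := D.exists_eventually_le_measure_iUnion_inter_lt_mul_of_small h
    hk₁ hk₁α hαk₂ hK hεc
  refine ⟨min q r, by simp [min_eq_iff, hq, hr], ?_⟩
  filter_upwards [hup, hlow] with x hup hlow S E hS hqr hS₀ hcS hfin hES hEsum
  obtain ⟨hSq, hSr⟩ := le_min_iff.1 hqr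
  have hcsum : c * P (S 0) ≤ ∑' i, ∫⁻ ω in S i, ENNReal.ofReal (θ i ω ^ α) ∂P :=
    hcS.trans (ENNReal.le_tsum (f := fun i => ∫⁻ ω in S i, ENNReal.ofReal (θ i ω ^ α) ∂P) 0)
  refine abs_toReal_div_sub_one_le (h.pos x) hε.le (measure_ne_top _ _)
    ((pos_iff_ne_zero.2 (mul_ne_zero hc hS₀)).trans_le hcsum).ne' hfin ?_ ?_
  · refine hEsum.trans ((hup S hS hSq).trans ?_)
    rw [mul_assoc (ENNReal.ofReal ε)]
    gcongr
  · refine (hlow S hS hSr).trans ?_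
    rw [mul_assoc (ENNReal.ofReal ε)]
    gcongr

end IsDiscountedModel

end RelativeError

section Renewal

variable {Ω : Type*} [MeasurableSpace Ω] {P : Measure Ω} {T : ℕ → Ω → ℝ≥0}

namespace IsRenewalTimes

theorem measurable (hT : IsRenewalTimes P T) (i : ℕ) : Measurable (T i) := by
  obtain ⟨τ, hτ, -, -, -, hTτ⟩ := hT
  exact funext (hTτ i) ▸ Finset.measurable_sum _ fun j _ => hτ j

theorem monotone (hT : IsRenewalTimes P T) (ω : Ω) : Monotone fun i => T i ω := by
  obtain ⟨τ, -, -, -, -, hTτ⟩ := hT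
  intro i j hij
  simp only [hTτ]
  exact Finset.sum_le_sum_of_subset (Finset.range_mono (by omega))

theorem measure_le_pow (hT : IsRenewalTimes P T) (i : ℕ) (t : ℝ≥0∞) :
    P {ω | (T i ω : ℝ≥0∞) ≤ t} ≤ P {ω | (T 0 ω : ℝ≥0∞) ≤ t} ^ (i + 1) := by
  obtain ⟨τ, -, hind, hid, -, hTτ⟩ := hT
  have hB : MeasurableSet {s : ℝ≥0 | (s : ℝ≥0∞) ≤ t} :=
    measurableSet_le measurable_coe_nnreal_ennreal measurable_const
  have hT₀ : T 0 = τ 0 := funext fun ω => by simp [hTτ]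
  calc P {ω | (T i ω : ℝ≥0∞) ≤ t}
      ≤ P (⋂ j ∈ Finset.range (i + 1), τ j ⁻¹' {s : ℝ≥0 | (s : ℝ≥0∞) ≤ t}) := by
        refine measure_mono fun ω (hω : (T i ω : ℝ≥0∞) ≤ t) => mem_iInter₂.2 fun j hj => ?_
        refine le_trans (ENNReal.coe_le_coe.2 ?_) hω
        rw [hTτ]
        exact Finset.single_le_sum_of_canonicallyOrdered (f := fun j => τ j ω) hj
    _ = ∏ j ∈ Finset.range (i + 1), P (τ j ⁻¹' {s : ℝ≥0 | (s : ℝ≥0∞) ≤ t}) :=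
        hind.measure_inter_preimage_eq_mul _ fun _ _ => hB
    _ = ∏ _j ∈ Finset.range (i + 1), P {ω | (T 0 ω : ℝ≥0∞) ≤ t} :=
        Finset.prod_congr rfl fun j _ => hT₀ ▸ (hid j).measure_preimage_eq hB
    _ = P {ω | (T 0 ω : ℝ≥0∞) ≤ t} ^ (i + 1) := by rw [Finset.prod_const, Finset.card_range]

end IsRenewalTimes

theorem mem_renewalSupport_iff {t : ℝ≥0∞} :
    t ∈ renewalSupport P T ↔ ∃ i, P {ω | (T i ω : ℝ≥0∞) ≤ t} ≠ 0 := by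
  change 0 < ∑' i, P {ω | (T i ω : ℝ≥0∞) ≤ t} ↔ _
  rw [pos_iff_ne_zero, Ne, ENNReal.tsum_eq_zero, not_forall]

theorem mem_renewalSupport_iff_of_monotone (hT : ∀ ω, Monotone fun i => T i ω) {t : ℝ≥0∞} :
    t ∈ renewalSupport P T ↔ P {ω | (T 0 ω : ℝ≥0∞) ≤ t} ≠ 0 := by
  refine mem_renewalSupport_iff.trans
    ⟨fun ⟨i, hi⟩ h₀ => hi (measure_mono_null ?_ h₀), fun h => ⟨0, h⟩⟩
  exact fun ω (hω : (T i ω : ℝ≥0∞) ≤ t) => (ENNReal.coe_le_coe.2 (hT ω i.zero_le)).trans hω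

theorem isUpperSet_renewalSupport : IsUpperSet (renewalSupport P T) := by
  intro s t hst hs
  obtain ⟨i, hi⟩ := mem_renewalSupport_iff.1 hs
  exact mem_renewalSupport_iff.2 ⟨i, fun h₀ => hi (measure_mono_null
    (fun ω (hω : (T i ω : ℝ≥0∞) ≤ s) => hω.trans hst) h₀)⟩

end Renewal

section Summability

variable {Ω : Type*} [MeasurableSpace Ω] {P : Measure Ω} {T : ℕ → Ω → ℝ≥0} {ξ : ℝ≥0 → Ω → ℝ}
  {G : ℝ → ℝ} {α : ℝ}

namespace MomentSummability

theorem exists_tsum_rpow_ne_top (hm : MomentSummability P T ξ α) (hα : 1 < α) :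
    ∃ k > α, ∑' i, posMoment P (discountFactor T ξ i) k ^ (1 / k) ≠ ⊤ := by
  obtain ⟨_, k, -, -, hk, hsum⟩ := hm.1 hα
  simp only [← posMoment_discountFactor] at hsum
  exact ⟨k, hk, ne_top_of_le_ne_top hsum.ne (ENNReal.tsum_le_tsum fun _ => le_max_right _ _)⟩

theorem exists_tsum_max_rpow_ne_top (hm : MomentSummability P T ξ α) (hα : α ≤ 1) :
    ∃ k k₁ k₂, 1 ≤ k ∧ α < k ∧ 0 < k₁ ∧ k₁ < α ∧ α < k₂ ∧
      ∑' i, max (posMoment P (discountFactor T ξ i) k₁)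
        (posMoment P (discountFactor T ξ i) k₂) ^ (1 / k) ≠ ⊤ := by
  obtain ⟨-, hm_eq, hm_lt⟩ := hm
  simp only [← posMoment_discountFactor] at hm_eq hm_lt
  rcases hα.lt_or_eq with hα | rfl
  · obtain ⟨k₁, k₂, hk₁, hk₁α, hαk₂, -, hsum⟩ := hm_lt hα
    exact ⟨1, k₁, k₂, le_rfl, hα, hk₁, hk₁α, hαk₂, by simpa using hsum.ne⟩
  · obtain ⟨k₁, k₂, hk₁, hk₁α, hαk₂, hsum⟩ := hm_eq rfl
    have hmono : Monotone fun a : ℝ≥0∞ => a ^ (1 / k₂) :=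
      ENNReal.monotone_rpow_of_nonneg (one_div_nonneg.2 (zero_le_one.trans hαk₂.le))
    refine ⟨k₂, k₁, k₂, hαk₂.le, hαk₂, hk₁, hk₁α, hαk₂, ?_⟩
    simpa only [hmono.map_max] using hsum.ne

theorem exists_hasSummableMoments [IsProbabilityMeasure P] (hm : MomentSummability P T ξ α)
    (hθm : ∀ i, Measurable (discountFactor T ξ i)) :
    ∃ k₁ k₂, HasSummableMoments P (discountFactor T ξ) α k₁ k₂ := by
  suffices ∃ k₁ k₂, 0 < k₁ ∧ k₁ < α ∧ α < k₂ ∧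
      ∑' i, posMoment P (discountFactor T ξ i) k₁ ≠ ⊤ ∧
      ∑' i, posMoment P (discountFactor T ξ i) k₂ ≠ ⊤ by
    obtain ⟨k₁, k₂, hk₁, hk₁α, hαk₂, hsum₁, hsum₂⟩ := this
    refine ⟨k₁, k₂, hk₁, hk₁α, hαk₂, ?_⟩
    simp only [lintegral_ofReal_rpow_add (hθm _) (discountFactor_pos _), ENNReal.tsum_add]
    exact ENNReal.add_ne_top.2 ⟨hsum₁, hsum₂⟩
  rcases lt_or_ge 1 α with hα | hα
  · obtain ⟨k₂, hαk₂, hsum⟩ := hm.exists_tsum_rpow_ne_top hα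
    obtain ⟨k₁, hk₁, hk₁α⟩ := exists_between hα
    exact ⟨k₁, k₂, one_pos.trans hk₁, hk₁α, hαk₂,
      tsum_posMoment_ne_top_of_one_le hθm discountFactor_pos hk₁.le (hk₁α.trans hαk₂).le hsum,
      tsum_ne_top_of_tsum_rpow_ne_top (hα.trans hαk₂).le hsum⟩
  · obtain ⟨k, k₁, k₂, hk, -, hk₁, hk₁α, hαk₂, hsum⟩ := hm.exists_tsum_max_rpow_ne_top hα
    have hmax := tsum_ne_top_of_tsum_rpow_ne_top hk hsum
    exact ⟨k₁, k₂, hk₁, hk₁α, hαk₂,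
      ne_top_of_le_ne_top hmax (ENNReal.tsum_le_tsum fun _ => le_max_left _ _),
      ne_top_of_le_ne_top hmax (ENNReal.tsum_le_tsum fun _ => le_max_right _ _)⟩

theorem hasNegligibleTails [IsProbabilityMeasure P] (hm : MomentSummability P T ξ α)
    (h : IsRegVarTail G α) (hθm : ∀ i, Measurable (discountFactor T ξ i)) {W : ℕ → Ω → ℝ}
    (hWm : ∀ i, Measurable (W i)) {K : ℝ≥0∞} (hK : K ≠ ⊤)
    (htail : ∀ i x, 0 < x → P {ω | x < discountFactor T ξ i ω * W i ω} ≤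
      K * ∫⁻ ω, ENNReal.ofReal (G (x / discountFactor T ξ i ω)) ∂P) :
    HasNegligibleTails P G fun i ω => ENNReal.ofReal (discountFactor T ξ i ω * W i ω) := by
  rcases lt_or_ge 1 α with hα | hα
  · obtain ⟨k, hαk, hsum⟩ := hm.exists_tsum_rpow_ne_top hα
    exact hasNegligibleTails_mul_of_one_lt h hα hθm discountFactor_pos hWm hK htail hαk hsum
  · obtain ⟨k, k₁, k₂, hk, hαk, hk₁, hk₁α, hαk₂, hsum⟩ := hm.exists_tsum_max_rpow_ne_top hα
    exact hasNegligibleTails_mul_of_max h hθm discountFactor_pos hWm hK htail hk hαk hk₁ hk₁α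
      hαk₂ hsum

end MomentSummability

end Summability

section DiscountedClaims

variable {d : ℕ} {Ω : Type*} [MeasurableSpace Ω] {P : Measure Ω} {X : ℕ → Ω → Fin d → ℝ}
  {T : ℕ → Ω → ℝ≥0} {ξ : ℝ≥0 → Ω → ℝ} {A : Set (Fin d → ℝ)} {F : Measure (Fin d → ℝ)}
  {α x : ℝ}

theorem IsTAI.pairwiseTAI [IsFiniteMeasure P] (hTAI : IsTAI P A X) (hA : IsRareSet A)
    (hX : ∀ i, Measurable (X i)) (hX₀ : ∀ i, ∀ᵐ ω ∂P, 0 ≤ X i ω) (hF : ∀ i, P.map (X i) = F) :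
    PairwiseTAI P (fun x => F.real {v | x < gauge Aᶜ v}) (fun i ω => gauge Aᶜ (X i ω)) := by
  intro i j hij ε hε
  have hgauge := hA.continuous_gauge.measurable
  have hdiag : Tendsto (fun x : ℝ => (x, x)) atTop (atTop ×ˢ atTop) := tendsto_id.prodMk tendsto_id
  filter_upwards [((hTAI i j hij).comp hdiag).eventually (ge_mem_nhds (pos_iff_ne_zero.2 hε))]
    with x hcond
  have hlevel (l : ℕ) : {ω | x < rareLevel A (X l ω)} =ᵐ[P] {ω | x < gauge Aᶜ (X l ω)} := by
    filter_upwards [hX₀ l] with ω hω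
    exact congrArg (x < ·) (hA.rareLevel_eq_gauge hω)
  have hm : MeasurableSet {ω | x < gauge Aᶜ (X j ω)} :=
    measurableSet_lt measurable_const (hgauge.comp (hX j))
  replace hcond : P[{ω | x < gauge Aᶜ (X i ω)} | {ω | x < gauge Aᶜ (X j ω)}] ≤ ε := by
    rwa [← measure_congr (cond_absolutelyContinuous.ae_eq (hlevel i)), ProbabilityTheory.cond,
      ← measure_congr (hlevel j), ← Measure.restrict_congr_set (hlevel j)]
  rw [inter_comm, ← cond_mul_eq_inter hm, ← measure_setOf_lt_comp_eq (hX j) (hF j) hgauge]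
  gcongr

namespace IsRareSet

theorem measure_discountedClaims_le (hA : IsRareSet A)
    (hsum : ∀ᵐ ω ∂P, Summable fun i => Real.exp (-ξ (T i ω) ω) • X i ω) (hx : 0 < x) (t : ℝ≥0∞) :
    P {ω | discountedClaims X T ξ t ω ∈ x • A} ≤ P {ω | ENNReal.ofReal x <
      ∑' i, ENNReal.ofReal ({ω | (T i ω : ℝ≥0∞) ≤ t}.indicator
        (fun ω => discountFactor T ξ i ω * gauge Aᶜ (X i ω)) ω)} := by
  refine measure_mono_ae ?_
  filter_upwards [hsum] with ω hω hmem
  have hlt := hA.lt_tsum_of_tsum_mem hx (hω.indicator {j : ℕ | (T j ω : ℝ≥0∞) ≤ t}) hmem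
  refine hlt.trans_eq (tsum_congr fun i => ?_)
  simp only [indicator, mem_ofPred_eq]
  split_ifs with hi
  · rw [gauge_smul_of_nonneg (Real.exp_pos _).le, smul_eq_mul, discountFactor]
  · rw [gauge_zero]

theorem measure_iUnion_le_discountedClaims (hA : IsRareSet A) (hX₀ : ∀ i, ∀ᵐ ω ∂P, 0 ≤ X i ω)
    (hsum : ∀ᵐ ω ∂P, Summable fun i => Real.exp (-ξ (T i ω) ω) • X i ω) (hx : 0 < x) (t : ℝ≥0∞) :
    P (⋃ i, {ω | (T i ω : ℝ≥0∞) ≤ t} ∩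
        {ω | x < discountFactor T ξ i ω * gauge Aᶜ (X i ω)}) ≤
      P {ω | discountedClaims X T ξ t ω ∈ x • A} := by
  refine measure_mono_ae ?_
  filter_upwards [hsum, ae_all_iff.2 hX₀] with ω hω hω₀ hmem
  obtain ⟨i, hi, hlt⟩ := mem_iUnion.1 hmem
  refine hA.tsum_mem_of_lt hx (hω.indicator _) (fun j => ?_) (i := i) ?_
  · exact indicator_apply_nonneg fun _ => smul_nonneg (Real.exp_pos _).le (hω₀ j)
  · rwa [indicator_of_mem (show i ∈ {j : ℕ | (T j ω : ℝ≥0∞) ≤ t} from hi),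
      gauge_smul_of_nonneg (Real.exp_pos _).le]

end IsRareSet

theorem MomentSummability.ae_summable_exp_smul [IsProbabilityMeasure P] {G : ℝ → ℝ} {K : ℝ}
    (hm : MomentSummability P T ξ α) (h : IsRegVarTail G α)
    (hK : ∀ x, F.real {v | x < ‖v‖} ≤ K * G x) (hind : IndepIngredients P X T ξ)
    (hX : ∀ i, Measurable (X i)) (hF : ∀ i, P.map (X i) = F) (hT : ∀ i, Measurable (T i))
    (hξ : IsRightContinuousProcess ξ) :
    ∀ᵐ ω ∂P, Summable fun i => Real.exp (-ξ (T i ω) ω) • X i ω := by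
  have D := hind.isDiscountedModel hX hT hξ hF measurable_norm norm_nonneg
  have htail (i : ℕ) (x : ℝ) (hx : 0 < x) : P {ω | x < discountFactor T ξ i ω * ‖X i ω‖} ≤
      ENNReal.ofReal K * ∫⁻ ω, ENNReal.ofReal (G (x / discountFactor T ξ i ω)) ∂P := by
    have heq := D.tail i x univ hx .univ
    rw [univ_inter, Measure.restrict_univ] at heq
    rw [heq, ← lintegral_const_mul' _ _ ENNReal.ofReal_ne_top]
    gcongr with ω
    rw [← ENNReal.ofReal_mul' (h.nonneg _)]
    exact ENNReal.ofReal_le_ofReal (hK _)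
  have hneg := hm.hasNegligibleTails h (fun i => (D.measurable_discount i).mono D.le le_rfl)
    D.measurable_claim ENNReal.ofReal_ne_top htail
  filter_upwards [hneg.ae_tsum_ne_top h.le_one fun _ _ => ENNReal.ofReal_ne_top] with ω hω
  refine Summable.of_norm ((ENNReal.summable_toReal hω).congr fun i => ?_)
  rw [ENNReal.toReal_ofReal (mul_nonneg (discountFactor_pos i ω).le (norm_nonneg _)), norm_smul,
    Real.norm_of_nonneg (Real.exp_pos _).le, discountFactor]

end DiscountedClaims

section InitialTimes

variable {d : ℕ} {Ω : Type*} [MeasurableSpace Ω] {P : Measure Ω} {X : ℕ → Ω → Fin d → ℝ}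
  {T : ℕ → Ω → ℝ≥0} {ξ : ℝ≥0 → Ω → ℝ} {k k₁ : ℝ}

theorem tendsto_measure_setOf_le_nhdsGT {β : Type*} [LinearOrder β] [TopologicalSpace β]
    [OrderTopology β] [DenselyOrdered β] [FirstCountableTopology β] [MeasurableSpace β]
    [OpensMeasurableSpace β] [IsFiniteMeasure P] {f : Ω → β} (hf : Measurable f) (s : β) :
    Tendsto (fun t => P {ω | f ω ≤ t}) (𝓝[>] s) (𝓝 (P {ω | f ω ≤ s})) := by
  rcases (Ioi s).eq_empty_or_nonempty with hs | ⟨r, hr⟩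
  · simp [hs]
  have hinter : ⋂ t > s, {ω | f ω ≤ t} = {ω | f ω ≤ s} := by
    ext ω
    simpa using forall_gt_imp_ge_iff_le_of_dense
  rw [← hinter]
  exact tendsto_measure_biInter_gt
    (fun _ _ => (hf measurableSet_Iic).nullMeasurableSet)
    (fun t u _ htu ω (hω : f ω ≤ t) => hω.trans htu) ⟨r, hr, measure_ne_top _ _⟩

/-- Fatou's lemma together with right-continuity. -/
theorem IsRightContinuousProcess.exists_eventually_le_discountMoment [NeZero P]
    (hξ : IsRightContinuousProcess ξ) (k : ℝ) (s₀ : ℝ≥0) :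
    ∃ c ≠ 0, ∀ᶠ t in 𝓝[>] (s₀ : ℝ≥0∞), ∀ s : ℝ≥0, s₀ ≤ s → (s : ℝ≥0∞) ≤ t →
      c ≤ discountMoment P ξ k fun _ => s := by
  set f : ℝ≥0 → Ω → ℝ≥0∞ := fun s ω => ENNReal.ofReal (Real.exp (-k * ξ s ω))
  have hm (s : ℝ≥0) : Measurable (f s) :=
    ENNReal.measurable_ofReal.comp (Real.measurable_exp.comp ((hξ.measurable s).const_mul _))
  have hlim (ω : Ω) : liminf (fun s => f s ω) (𝓝[≥] s₀) = f s₀ ω := by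
    refine Tendsto.liminf_eq ((ENNReal.continuous_ofReal.tendsto _).comp
      ((Real.continuous_exp.tendsto _).comp ?_))
    exact (hξ.right_continuous ω s₀).tendsto.const_mul _
  have hpos : 0 < ∫⁻ ω, f s₀ ω ∂P := by
    have hsupport : Function.support (f s₀) = univ :=
      eq_univ_of_forall fun ω => by simpa [f] using Real.exp_pos _
    rw [lintegral_pos_iff_support (hm s₀), hsupport]
    exact NeZero.pos _
  obtain ⟨c, hc₀, hc⟩ := exists_between hpos
  have hfatou : c < liminf (fun s => ∫⁻ ω, f s ω ∂P) (𝓝[≥] s₀) :=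
    hc.trans_le (by simpa only [hlim] using lintegral_liminf_le (u := 𝓝[≥] s₀) hm)
  obtain ⟨s₁, hs₁, hsub⟩ :=
    mem_nhdsGE_iff_exists_Ico_subset.1 (eventually_lt_of_lt_liminf hfatou)
  refine ⟨c, hc₀.ne', ?_⟩
  filter_upwards [Ioo_mem_nhdsGT (ENNReal.coe_lt_coe.2 hs₁)] with t ht s hs hst
  exact (hsub ⟨hs, ENNReal.coe_lt_coe.1 (hst.trans_lt ht.2)⟩ : c < _).le

theorem rpow_add_rpow_le_one_add_two_mul {θ : ℝ} (hθ : 0 < θ) (hk₁ : 0 ≤ k₁) (hk : k₁ ≤ k) :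
    θ ^ k₁ + θ ^ k ≤ 1 + 2 * θ ^ k := by
  have hpos : 0 < θ ^ k := by positivity
  rcases le_total θ 1 with h | h
  · linarith [Real.rpow_le_one hθ.le h hk₁]
  · linarith [Real.rpow_le_rpow_of_exponent_le h hk]

namespace IndepIngredients

theorem setLIntegral_rpow_add_rpow_le [IsFiniteMeasure P] (hind : IndepIngredients P X T ξ)
    (hT : ∀ i, Measurable (T i)) (hξ : IsRightContinuousProcess ξ) {S : Set Ω}
    (hS : MeasurableSet[arrivalSigma T] S) {i : ℕ} {C : ℝ≥0∞}
    (hmoment : ∀ᵐ ω ∂P, ω ∈ S → discountMoment P ξ k (fun _ => T i ω) ≤ C)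
    (hk₁ : 0 ≤ k₁) (hk : k₁ ≤ k) :
    ∫⁻ ω in S, ENNReal.ofReal (discountFactor T ξ i ω ^ k₁ + discountFactor T ξ i ω ^ k) ∂P ≤
      (1 + 2 * C) * P S := by
  calc ∫⁻ ω in S, ENNReal.ofReal (discountFactor T ξ i ω ^ k₁ + discountFactor T ξ i ω ^ k) ∂P
      ≤ ∫⁻ ω in S, (1 + 2 * ENNReal.ofReal (discountFactor T ξ i ω ^ k)) ∂P := by
        gcongr with ω
        have hθ := discountFactor_pos (T := T) (ξ := ξ) i ω
        rw [← ENNReal.ofReal_one, ← ENNReal.ofReal_ofNat 2, ← ENNReal.ofReal_mul (by norm_num),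
          ← ENNReal.ofReal_add zero_le_one (by positivity)]
        exact ENNReal.ofReal_le_ofReal (rpow_add_rpow_le_one_add_two_mul hθ hk₁ hk)
    _ = P S + 2 * ∫⁻ ω in S, discountMoment P ξ k (fun _ => T i ω) ∂P := by
        rw [lintegral_add_left measurable_const, lintegral_const_mul' _ _ (by simp),
          hind.setLIntegral_discountFactor hT hξ hS, setLIntegral_one]
    _ ≤ P S + 2 * (C * P S) := by
        gcongr
        rw [← setLIntegral_const]
        exact setLIntegral_mono_ae aemeasurable_const hmoment
    _ = (1 + 2 * C) * P S := by ring

theorem mul_measure_le_setLIntegral [IsFiniteMeasure P] (hind : IndepIngredients P X T ξ)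
    (hT : ∀ i, Measurable (T i)) (hξ : IsRightContinuousProcess ξ) {S : Set Ω}
    (hS : MeasurableSet[arrivalSigma T] S) {i : ℕ} {c : ℝ≥0∞}
    (hmoment : ∀ᵐ ω ∂P, ω ∈ S → c ≤ discountMoment P ξ k (fun _ => T i ω)) :
    c * P S ≤ ∫⁻ ω in S, ENNReal.ofReal (discountFactor T ξ i ω ^ k) ∂P := by
  rw [hind.setLIntegral_discountFactor hT hξ hS, ← setLIntegral_const]
  exact setLIntegral_mono_ae ((hξ.measurable_discountMoment k).comp (hT i)).aemeasurable hmoment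

end IndepIngredients

end InitialTimes

section RiskModel

/-- The quotient of the two sides of the asymptotic equivalence
`P[D(t) ∈ x A] ∼ P[X ∈ x A] ∫₀ᵗ E[e^{-α ξ(s)}] λ(ds)`. -/
noncomputable def entranceRatio {d : ℕ} {Ω : Type*} [MeasurableSpace Ω] (P : Measure Ω)
    (X : ℕ → Ω → Fin d → ℝ) (T : ℕ → Ω → ℝ≥0) (ξ : ℝ≥0 → Ω → ℝ) (A : Set (Fin d → ℝ))
    (F : Measure (Fin d → ℝ)) (α x : ℝ) (t : ℝ≥0∞) : ℝ :=
  P.real {ω | discountedClaims X T ξ t ω ∈ x • A} /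
    (F.real (x • A) * (discountIntegral P T ξ α t).toReal)

/-- A risk model in the form in which the asymptotics are derived: the multivariate claims enter
only through the gauge of the complement of `A`, whose value at a claim with law `F` has a regularly
varying tail. -/
structure IsGaugedRiskModel {d : ℕ} {Ω : Type*} [MeasurableSpace Ω] (P : Measure Ω)
    (X : ℕ → Ω → Fin d → ℝ) (T : ℕ → Ω → ℝ≥0) (ξ : ℝ≥0 → Ω → ℝ) (A : Set (Fin d → ℝ))
    (F : Measure (Fin d → ℝ)) (α k₁ k₂ : ℝ) : Prop where
  isRareSet : IsRareSet A
  claim_nonneg : ∀ i, ∀ᵐ ω ∂P, 0 ≤ X i ω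
  measurable_arrival : ∀ i, Measurable (T i)
  isRightContinuous : IsRightContinuousProcess ξ
  indep : IndepIngredients P X T ξ
  isDiscountedModel : IsDiscountedModel (discountSigma T ξ) P (fun x => F.real {v | x < gauge Aᶜ v})
    (discountFactor T ξ) (fun i ω => gauge Aᶜ (X i ω))
  isRegVarTail : IsRegVarTail (fun x => F.real {v | x < gauge Aᶜ v}) α
  pairwiseTAI : PairwiseTAI P (fun x => F.real {v | x < gauge Aᶜ v}) (fun i ω => gauge Aᶜ (X i ω))
  hasNegligibleTails : HasNegligibleTails P (fun x => F.real {v | x < gauge Aᶜ v})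
    (fun i ω => ENNReal.ofReal (discountFactor T ξ i ω * gauge Aᶜ (X i ω)))
  hasSummableMoments : HasSummableMoments P (discountFactor T ξ) α k₁ k₂
  ae_summable : ∀ᵐ ω ∂P, Summable fun i => Real.exp (-ξ (T i ω) ω) • X i ω

variable {d : ℕ} {Ω : Type*} [MeasurableSpace Ω] {P : Measure Ω} {X : ℕ → Ω → Fin d → ℝ}
  {T : ℕ → Ω → ℝ≥0} {ξ : ℝ≥0 → Ω → ℝ} {A : Set (Fin d → ℝ)} {F : Measure (Fin d → ℝ)}
  {α k k₁ k₂ x ε : ℝ} {t t₀ t₁ : ℝ≥0∞}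

theorem uniformlyEquivalent_of_forall_eventually_abs_entranceRatio_sub_one_le {Δ : Set ℝ≥0∞}
    (h : ∀ ε > 0, ∀ᶠ x in atTop, ∀ t ∈ Δ, |entranceRatio P X T ξ A F α x t - 1| ≤ ε) :
    UniformlyEquivalent (fun x t => P.real {ω | discountedClaims X T ξ t ω ∈ x • A})
      (fun x t => F.real (x • A) * (discountIntegral P T ξ α t).toReal) Δ := by
  refine Metric.tendstoUniformlyOn_iff.2 fun ε hε => ?_
  filter_upwards [h (ε / 2) (half_pos hε)] with x hx t ht
  rw [dist_comm, Real.dist_eq]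
  exact (hx t ht).trans_lt (half_lt_self hε)

theorem mem_renewalSupport_of_sInf_lt (ht : sInf (renewalSupport P T) < t) :
    t ∈ renewalSupport P T := by
  obtain ⟨s, hs, hst⟩ := sInf_lt_iff.1 ht
  exact isUpperSet_renewalSupport hst.le hs

theorem ae_sInf_renewalSupport_lt (h : sInf (renewalSupport P T) ∉ renewalSupport P T) (i : ℕ) :
    ∀ᵐ ω ∂P, sInf (renewalSupport P T) < T i ω := by
  rw [mem_renewalSupport_iff, not_exists_not] at h
  simpa only [ae_iff, not_lt] using h i

theorem IsRightContinuousProcess.exists_mem_renewalSupport_measure_le [IsProbabilityMeasure P]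
    (hξ : IsRightContinuousProcess ξ) (hT : ∀ i, Measurable (T i)) (α : ℝ)
    (ht₁ : t₁ ∈ renewalSupport P T) (hs : sInf (renewalSupport P T) ∉ renewalSupport P T) :
    ∃ c ≠ 0, ∀ q ≠ 0, ∃ t ∈ renewalSupport P T, t ≤ t₁ ∧ P {ω | (T 0 ω : ℝ≥0∞) ≤ t} ≤ q ∧
      ∀ᵐ ω ∂P, (T 0 ω : ℝ≥0∞) ≤ t → c ≤ discountMoment P ξ α fun _ => T 0 ω := by
  have hlt := ae_sInf_renewalSupport_lt hs 0
  have hlt_t₁ := (sInf_le ht₁).lt_of_ne fun h => hs (h ▸ ht₁)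
  have hmem {t : ℝ≥0∞} := mem_renewalSupport_of_sInf_lt (P := P) (T := T) (t := t)
  lift sInf (renewalSupport P T) to ℝ≥0 using hlt_t₁.ne_top with s₀
  have hnull : P {ω | (T 0 ω : ℝ≥0∞) ≤ s₀} = 0 := by
    simpa only [ae_iff, not_lt] using hlt
  obtain ⟨c, hc, hc_le⟩ := hξ.exists_eventually_le_discountMoment (P := P) α s₀
  refine ⟨c, hc, fun q hq => ?_⟩
  have hlim := tendsto_measure_setOf_le_nhdsGT (P := P)
    (measurable_coe_nnreal_ennreal.comp (hT 0)) (s₀ : ℝ≥0∞)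
  simp only [Function.comp_apply, hnull] at hlim
  obtain ⟨t, hct, hqt, hs₀t, htt₁⟩ := (hc_le.and
    ((hlim.eventually (ge_mem_nhds (pos_iff_ne_zero.2 hq))).and (Ioc_mem_nhdsGT hlt_t₁))).exists
  refine ⟨t, hmem hs₀t, htt₁, hqt, ?_⟩
  filter_upwards [hlt] with ω hω
  exact hct _ (ENNReal.coe_le_coe.1 hω.le)

theorem IndepIngredients.isGeometricFamily [IsFiniteMeasure P] (hind : IndepIngredients P X T ξ)
    (hT : ∀ i, Measurable (T i)) (hξ : IsRightContinuousProcess ξ)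
    (hmono : ∀ ω, Monotone fun i => T i ω)
    (hpow : ∀ i, P {ω | (T i ω : ℝ≥0∞) ≤ t} ≤ P {ω | (T 0 ω : ℝ≥0∞) ≤ t} ^ (i + 1))
    {C : ℝ≥0∞} (hmoment : ∀ i, ∀ᵐ ω ∂P, (T i ω : ℝ≥0∞) ≤ t →
      discountMoment P ξ k (fun _ => T i ω) ≤ C)
    (hk₁ : 0 ≤ k₁) (hk : k₁ ≤ k) :
    IsGeometricFamily (discountSigma T ξ) P (discountFactor T ξ) k₁ k (1 + 2 * C)
      fun i => {ω | (T i ω : ℝ≥0∞) ≤ t} := by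
  have hsub {i j : ℕ} (hij : i ≤ j) (ω : Ω) (hω : (T j ω : ℝ≥0∞) ≤ t) : (T i ω : ℝ≥0∞) ≤ t :=
    (ENNReal.coe_le_coe.2 (hmono ω hij)).trans hω
  refine ⟨fun i => arrivalSigma_le_discountSigma _ (measurableSet_arrival_le i t),
    fun i j => hsub, hpow, fun i j hij => ?_⟩
  refine hind.setLIntegral_rpow_add_rpow_le hT hξ (measurableSet_arrival_le j t) ?_ hk₁ hk
  filter_upwards [hmoment i] with ω hω hj
  exact hω (hsub hij ω hj)

namespace IsGaugedRiskModel

theorem entranceRatio_eq [IsFiniteMeasure P] (M : IsGaugedRiskModel P X T ξ A F α k₁ k₂)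
    (hx : 0 < x) (t : ℝ≥0∞) :
    entranceRatio P X T ξ A F α x t = P.real {ω | discountedClaims X T ξ t ω ∈ x • A} /
      (F.real {v | x < gauge Aᶜ v} * (∑' i, ∫⁻ ω in {ω | (T i ω : ℝ≥0∞) ≤ t},
        ENNReal.ofReal (discountFactor T ξ i ω ^ α) ∂P).toReal) := by
  have hset : x • A = {v | x < gauge Aᶜ v} := ext fun v => M.isRareSet.mem_smul_iff hx
  rw [entranceRatio, M.indep.discountIntegral_eq_tsum M.measurable_arrival M.isRightContinuous]
  congr 3

theorem eventually_forall_ge [IsFiniteMeasure P] (M : IsGaugedRiskModel P X T ξ A F α k₁ k₂)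
    (ht₀ : t₀ ∈ renewalSupport P T) (hε : 0 < ε) :
    ∀ᶠ x in atTop, ∀ t ≥ t₀, |entranceRatio P X T ξ A F α x t - 1| ≤ ε := by
  obtain ⟨i, hi⟩ := mem_renewalSupport_iff.1 ht₀
  filter_upwards [M.isDiscountedModel.eventually_abs_div_sub_one_le M.isRegVarTail M.pairwiseTAI
    M.hasNegligibleTails M.hasSummableMoments
    (M.isDiscountedModel.setLIntegral_rpow_ne_zero hi α i) hε, eventually_gt_atTop 0]
    with x hratio hx t ht
  rw [M.entranceRatio_eq hx]
  refine hratio (fun i => {ω | (T i ω : ℝ≥0∞) ≤ t}) _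
    (fun i => arrivalSigma_le_discountSigma _ (measurableSet_arrival_le i t)) ?_
    (M.isRareSet.measure_iUnion_le_discountedClaims M.claim_nonneg M.ae_summable hx t)
    (M.isRareSet.measure_discountedClaims_le M.ae_summable hx t)
  calc ∫⁻ ω in {ω | (T i ω : ℝ≥0∞) ≤ t₀}, ENNReal.ofReal (discountFactor T ξ i ω ^ α) ∂P
      ≤ ∫⁻ ω in {ω | (T i ω : ℝ≥0∞) ≤ t}, ENNReal.ofReal (discountFactor T ξ i ω ^ α) ∂P :=
        lintegral_mono_set fun ω (hω : (T i ω : ℝ≥0∞) ≤ t₀) => hω.trans ht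
    _ ≤ _ := ENNReal.le_tsum (f := fun i => ∫⁻ ω in {ω | (T i ω : ℝ≥0∞) ≤ t},
        ENNReal.ofReal (discountFactor T ξ i ω ^ α) ∂P) i

theorem exists_eventually_forall_le [IsProbabilityMeasure P]
    (M : IsGaugedRiskModel P X T ξ A F α k₁ k₂) (hmono : ∀ ω, Monotone fun i => T i ω)
    (hpow : ∀ i t, P {ω | (T i ω : ℝ≥0∞) ≤ t} ≤ P {ω | (T 0 ω : ℝ≥0∞) ≤ t} ^ (i + 1))
    (hbound : InitialMomentBound P T ξ α) (hs : sInf (renewalSupport P T) ∉ renewalSupport P T)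
    (hε : 0 < ε) :
    ∃ t' ∈ renewalSupport P T, ∀ᶠ x in atTop, ∀ t ∈ renewalSupport P T, t ≤ t' →
      |entranceRatio P X T ξ A F α x t - 1| ≤ ε := by
  obtain ⟨k, hαk, t₁, ht₁, C, hC⟩ := hbound
  obtain ⟨c, hc, hsmall⟩ := M.isRightContinuous.exists_mem_renewalSupport_measure_le
    M.measurable_arrival α ht₁ hs
  obtain ⟨q, hq, hratio⟩ := M.isDiscountedModel.exists_eventually_abs_div_sub_one_le_of_small
    M.isRegVarTail M.hasSummableMoments.pos M.hasSummableMoments.lt_index hαk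
    (K := 1 + 2 * C) (by finiteness) hc hε
  obtain ⟨t', ht', ht't₁, hq', hc'⟩ := hsmall q hq
  refine ⟨t', ht', ?_⟩
  filter_upwards [hratio, eventually_gt_atTop 0] with x hratio hx t ht htt'
  rw [M.entranceRatio_eq hx]
  refine hratio (fun i => {ω | (T i ω : ℝ≥0∞) ≤ t}) _
    (M.indep.isGeometricFamily M.measurable_arrival M.isRightContinuous hmono (hpow · t)
      (fun i => ?_) M.hasSummableMoments.pos.le (M.hasSummableMoments.lt_index.trans hαk).le)
    ((measure_mono fun ω (hω : (T 0 ω : ℝ≥0∞) ≤ t) => hω.trans htt').trans hq')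
    ((mem_renewalSupport_iff_of_monotone hmono).1 ht)
    (M.indep.mul_measure_le_setLIntegral M.measurable_arrival M.isRightContinuous
      (measurableSet_arrival_le 0 t) (hc'.mono fun ω hω hωt => hω (hωt.trans htt')))
    (M.isDiscountedModel.tsum_setLIntegral_ne_top M.hasSummableMoments _)
    (M.isRareSet.measure_iUnion_le_discountedClaims M.claim_nonneg M.ae_summable hx t)
    (M.isRareSet.measure_discountedClaims_le M.ae_summable hx t)
  filter_upwards [ae_sInf_renewalSupport_lt hs i] with ω hω hωt
  exact hC _ (mem_renewalSupport_of_sInf_lt hω) (hωt.trans (htt'.trans ht't₁))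

theorem eventually_forall_mem_renewalSupport [IsProbabilityMeasure P]
    (M : IsGaugedRiskModel P X T ξ A F α k₁ k₂) (hmono : ∀ ω, Monotone fun i => T i ω)
    (hpow : ∀ i t, P {ω | (T i ω : ℝ≥0∞) ≤ t} ≤ P {ω | (T 0 ω : ℝ≥0∞) ≤ t} ^ (i + 1))
    (hbound : InitialMomentBound P T ξ α) (hε : 0 < ε) :
    ∀ᶠ x in atTop, ∀ t ∈ renewalSupport P T, |entranceRatio P X T ξ A F α x t - 1| ≤ ε := by
  by_cases hs : sInf (renewalSupport P T) ∈ renewalSupport P T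
  · filter_upwards [M.eventually_forall_ge hs hε] with x hx t ht
    exact hx t (sInf_le ht)
  · obtain ⟨t', ht', hle⟩ := M.exists_eventually_forall_le hmono hpow hbound hs hε
    filter_upwards [hle, M.eventually_forall_ge ht' hε] with x hle hge t ht
    exact (le_total t t').elim (hle t ht) (hge t)

end IsGaugedRiskModel

theorem MomentSummability.exists_isGaugedRiskModel [IsProbabilityMeasure P] {V : Measure ℝ}
    {ν : Measure (Fin d → ℝ)} (hmoment : MomentSummability P T ξ α) (hA : IsRareSet A)
    (hX : ∀ i, Measurable (X i)) (hX_nonneg : ∀ i, ∀ᵐ ω ∂P, 0 ≤ X i ω)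
    (hX_law : ∀ i, P.map (X i) = F) (hF : IsMRV F α V ν) (hνA : 0 < ν A) (hTAI : IsTAI P A X)
    (hT : ∀ i, Measurable (T i)) (hξ : IsRightContinuousProcess ξ)
    (hindep : IndepIngredients P X T ξ) :
    ∃ k₁ k₂, IsGaugedRiskModel P X T ξ A F α k₁ k₂ := by
  have : IsProbabilityMeasure F :=
    hX_law 0 ▸ Measure.isProbabilityMeasure_map (hX 0).aemeasurable
  have hgauge := hA.isHomogeneousFunctional_gauge
  have hpos : ν {v | 1 < gauge Aᶜ v} ≠ 0 := by
    simpa only [hA.one_lt_gauge_iff, ofPred_mem_eq] using hνA.ne'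
  have hreg := hF.isRegVarTail hgauge hpos
  have D := hindep.isDiscountedModel hX hT hξ hX_law hgauge.continuous.measurable gauge_nonneg
  obtain ⟨K, hK⟩ := hF.exists_norm_tail_le hgauge hpos
  have hθ (i : ℕ) := (D.measurable_discount i).mono D.le le_rfl
  obtain ⟨k₁, k₂, hsummable⟩ := hmoment.exists_hasSummableMoments hθ
  exact ⟨k₁, k₂,
    { isRareSet := hA
      claim_nonneg := hX_nonneg
      measurable_arrival := hT
      isRightContinuous := hξ
      indep := hindep
      isDiscountedModel := D
      isRegVarTail := hreg
      pairwiseTAI := hTAI.pairwiseTAI hA hX hX_nonneg hX_law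
      hasNegligibleTails := hmoment.hasNegligibleTails hreg hθ D.measurable_claim
        ENNReal.one_ne_top fun i x hx => by simpa using (D.tail i x univ hx .univ).le
      hasSummableMoments := hsummable
      ae_summable := hmoment.ae_summable_exp_smul hreg hK hindep hX hX_law hT hξ }⟩

end RiskModel

theorem mainTheorem3_general {d : ℕ} {Ω : Type*} [MeasurableSpace Ω] (P : Measure Ω)
    [IsProbabilityMeasure P]
    (X : ℕ → Ω → Fin d → ℝ) (T : ℕ → Ω → ℝ≥0) (ξ : ℝ≥0 → Ω → ℝ)
    (A : Set (Fin d → ℝ)) (hA : IsRareSet A)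
    (F : Measure (Fin d → ℝ)) (α : ℝ) (V : Measure ℝ) (ν : Measure (Fin d → ℝ))
    (hX : ∀ i, Measurable (X i)) (hX_nonneg : ∀ i, ∀ᵐ ω ∂P, 0 ≤ X i ω)
    (hX_law : ∀ i, P.map (X i) = F)
    (hF : IsMRV F α V ν) (hνA : 0 < ν A)
    (hTAI : IsTAI P A X)
    (hT : ∀ i, Measurable (T i))
    (hξ : IsRightContinuousProcess ξ)
    (hindep : IndepIngredients P X T ξ)
    (hmoment : MomentSummability P T ξ α) :
    (∀ᵐ ω ∂P, Summable fun i => Real.exp (-ξ (T i ω) ω) • X i ω) ∧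
    (∀ t₀ ∈ renewalSupport P T,
      UniformlyEquivalent
        (fun x t => P.real {ω | discountedClaims X T ξ t ω ∈ x • A})
        (fun x t => F.real (x • A) * (discountIntegral P T ξ α t).toReal)
        (Ici t₀)) ∧
    ((∀ ω, Monotone fun i => T i ω) →
      (∀ i t, P {ω | (T i ω : ℝ≥0∞) ≤ t} ≤ P {ω | (T 0 ω : ℝ≥0∞) ≤ t} ^ (i + 1)) →
      InitialMomentBound P T ξ α →
      UniformlyEquivalent
        (fun x t => P.real {ω | discountedClaims X T ξ t ω ∈ x • A})
        (fun x t => F.real (x • A) * (discountIntegral P T ξ α t).toReal)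
        (renewalSupport P T)) := by
  obtain ⟨k₁, k₂, M⟩ := hmoment.exists_isGaugedRiskModel hA hX hX_nonneg hX_law hF hνA hTAI hT hξ
    hindep
  refine ⟨M.ae_summable, fun t₀ ht₀ => ?_, fun hmono hpow hbound => ?_⟩ <;>
    refine uniformlyEquivalent_of_forall_eventually_abs_entranceRatio_sub_one_le fun ε hε => ?_
  · exact M.eventually_forall_ge ht₀ hε
  · exact M.eventually_forall_mem_renewalSupport hmono hpow hbound hε

theorem mainTheorem3 {d : ℕ} {Ω : Type*} [MeasurableSpace Ω] (P : Measure Ω)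
    [IsProbabilityMeasure P]
    (X : ℕ → Ω → Fin d → ℝ) (T : ℕ → Ω → ℝ≥0) (ξ : ℝ≥0 → Ω → ℝ)
    (A : Set (Fin d → ℝ)) (hA : IsRareSet A)
    (F : Measure (Fin d → ℝ)) (α : ℝ) (V : Measure ℝ) (ν : Measure (Fin d → ℝ))
    (hX : ∀ i, Measurable (X i)) (hX_nonneg : ∀ i, ∀ᵐ ω ∂P, 0 ≤ X i ω)
    (hX_law : ∀ i, P.map (X i) = F)
    (hF : IsMRV F α V ν) (hνA : 0 < ν A)
    (hTAI : IsTAI P A X)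
    (hT : IsRenewalTimes P T)
    (hξ : IsCadlagProcess ξ)
    (hindep : IndepIngredients P X T ξ)
    (hmoment : MomentSummability P T ξ α) :
    (∀ᵐ ω ∂P, Summable fun i => Real.exp (-ξ (T i ω) ω) • X i ω) ∧
    (∀ t₀ ∈ renewalSupport P T,
      UniformlyEquivalent
        (fun x t => P.real {ω | discountedClaims X T ξ t ω ∈ x • A})
        (fun x t => F.real (x • A) * (discountIntegral P T ξ α t).toReal)
        (Ici t₀)) ∧
    (InitialMomentBound P T ξ α →
      UniformlyEquivalent
        (fun x t => P.real {ω | discountedClaims X T ξ t ω ∈ x • A})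
        (fun x t => F.real (x • A) * (discountIntegral P T ξ α t).toReal)
        (renewalSupport P T)) := by
  obtain ⟨hsum, hge, hall⟩ := mainTheorem3_general P X T ξ A hA F α V ν hX hX_nonneg hX_law hF hνA
    hTAI hT.measurable hξ.isRightContinuousProcess hindep hmoment
  exact ⟨hsum, hge, hall hT.monotone hT.measure_le_pow⟩
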